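/- **Setting.** Let $\mathrm S(a,b)=\{\zeta\in\mathbb C: a<\operatorname{Im}\zeta<b\}$. A *scattering function* is a bounded continuous function $S:\overline{\mathrm S(0,\pi)}\to\mathbb C$, analytic in $\mathrm S(0,\pi)$, with $\overline{S(\theta)}=S(\theta)^{-1}=S(\theta+i\pi)=S(-\theta)$ for all $\theta\in\mathbb R$. Let $S$ be a scattering function with limit, i.e. $S$ moreover continues to a bounded analytic function on $\mathrm S(-\kappa,\pi+\kappa)$ for some $\kappa>0$, and the limits $\lim_{\theta\to\infty}S(\theta)$ and $\lim_{\theta\to-\infty}S(\theta)$ exist. Let $\mathcal H_n\subset L^2(\mathbb R^n)$ be the closed subspace of vectors invariant under the unitary representation $D_n$ of the permutation group generated by $(D_n(\tau_k)\Psi_n)(\beta_1,\dots,\beta_n)=S(\beta_{k+1}-\beta_k)\Psi_n(\beta_1,\dots,\beta_{k+1},\beta_k,\dots,\beta_n)$, $1\le k<n$, with orthogonal projection $P_n$ onto it ($\mathcal H_0=\mathbb C$, $\mathcal H_1=L^2(\mathbb R)$). Let $\mathcal H=\bigoplus_{n\ge0}\mathcal H_n$ be the Hilbert space direct sum, $\mathcal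 D\subset\mathcal H$ the subspace of terminating sequences, and $\Omega=1\oplus0\oplus0\oplus\cdots$. For $\xi,\lambda\in\mathbb R$ define the unitary $U(\xi,\lambda)$ and the antiunitary involution $U(j)$ by $$(U(\xi,\lambda)\Psi)_n(\beta_1,\dots,\beta_n)=e^{i\xi(e^{\beta_1}+\dots+e^{\beta_n})}\Psi_n(\beta_1+\lambda,\dots,\beta_n+\lambda),\qquad (U(j)\Psi)_n(\beta_1,\dots,\beta_n)=\overline{\Psi_n(\beta_n,\dots,\beta_1)} .$$ For $\psi\in\mathcal H_1$ let $y^\dagger(\psi)$ be the operator with domain $\mathcal D$ given by $(y^\dagger(\psi)\Phi)_n=\sqrt n\,P_n(\psi\otimes\Phi_{n-1})$ for $n\ge1$ and $(y^\dagger(\psi)\Phi)_0=0$, and let $y(\psi)=y^\dagger(\overline\psi)^*$. For $f\in\mathscr S(\mathbb R)$ (complex valued Schwartz functions) put $$\hat f^\pm(\beta)=\pm\frac{i\,e^\beta}{\sqrt{2\pi}}\int_{\mathbb R} f(\xi)\,e^{\pm ie^\beta\xi}\,d\xi,\qquad f^{\xi,\lambda}(x)=f(e^{-\lambda}(x-\xi)),\qquad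 f^j(x)=\overline{f(-x)},$$ and define the fields (the sum being defined on the intersection of the domains) $$\phi(f)=y^\dagger(\hat f^+)+y(\hat f^-),\qquad \phi'(f)=U(j)\,\phi(f^j)\,U(j).$$ **Proposition.** (a) The map $f\mapsto\phi(f)$ is an operator-valued tempered distribution: for every $f\in\mathscr S(\mathbb R)$ the domain of $\phi(f)$ contains $\mathcal D$ and $\phi(f)\mathcal D\subset\mathcal D$, and for every $\Psi\in\mathcal D$ the map $\mathscr S(\mathbb R)\ni f\mapsto\phi(f)\Psi\in\mathcal H$ is linear and continuous. For real-valued $f$, $\phi(f)$ is essentially self-adjoint, and every $\Psi\in\mathcal D$ is an entire analytic vector for it, i.e. $\phi(f)^n\Psi$ is defined for all $n$ and $\sum_{n\ge0}\frac{|t|^n}{n!}\|\phi(f)^n\Psi\|<\infty$ for all $t\in\mathbb R$. (b) $U(\xi,\lambda)\phi(f)U(\xi,\lambda)^{-1}=\phi(f^{\xi,\lambda})$, as an equality of unbounded operators including domains, for all $\xi,\lambda\in\mathbb R$, $f\in\mathscr S(\mathbb R)$. (c) (Reeh–Schlieder property) For every non-empty open interval $I\subset\mathbb R$ (bounded or not),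 the linear span of all vectors $\phi(f_1)\cdots\phi(f_n)\Omega$ with $n\in\mathbb N_0$ and $f_1,\dots,f_n\in\mathscr S(\mathbb R)$ supported in $\overline I$ is dense in $\mathcal H$. (d) (Relative half-locality) If $f,g\in\mathscr S(\mathbb R)$ satisfy $\operatorname{supp}f\subset(a,\infty)$ and $\operatorname{supp}g\subset(-\infty,a)$ for some $a\in\mathbb R$, then for every $\Psi\in\mathcal D$ the vectors $\phi(f)\phi'(g)\Psi$ and $\phi'(g)\phi(f)\Psi$ are defined and $[\phi(f),\phi'(g)]\Psi=0$. Statements (a)–(c) also hold with $\phi$ replaced by $\phi'$. -/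

import Mathlib

open MeasureTheory Filter Topology
open scoped SchwartzMap ENNReal ComplexConjugate InnerProductSpace

namespace ChiralModel

noncomputable section

/-! ### Scattering functions -/

/-- The open strip `S(a,b) = {ζ : a < Im ζ < b}`. -/
def strip (a b : ℝ) : Set ℂ := {ζ | a < ζ.im ∧ ζ.im < b}

/-- The closed strip `{ζ : a ≤ Im ζ ≤ b}`. -/
def closedStrip (a b : ℝ) : Set ℂ := {ζ | a ≤ ζ.im ∧ ζ.im ≤ b}

/-- Scattering functions: bounded continuous functions on the closed strip `0 ≤ Im ζ ≤ π`, analytic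
in its interior, with `conj (S θ) = (S θ)⁻¹ = S (θ + iπ) = S (-θ)` for real `θ`.
The values of `toFun` outside the closed strip play no role. The field `ne_zero` makes `(S θ)⁻¹`
the true inverse. -/
structure ScatteringFunction where
  toFun : ℂ → ℂ
  continuousOn : ContinuousOn toFun (closedStrip 0 Real.pi)
  bounded : ∃ C : ℝ, ∀ ζ ∈ closedStrip 0 Real.pi, ‖toFun ζ‖ ≤ C
  analytic : AnalyticOnNhd ℂ toFun (strip 0 Real.pi)
  ne_zero : ∀ θ : ℝ, toFun θ ≠ 0
  conj_eq_inv : ∀ θ : ℝ, conj (toFun θ) = (toFun θ)⁻¹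
  inv_eq_crossing : ∀ θ : ℝ, (toFun θ)⁻¹ = toFun (θ + Real.pi * Complex.I)
  crossing_eq_neg : ∀ θ : ℝ, toFun (θ + Real.pi * Complex.I) = toFun (-θ)

namespace ScatteringFunction

/-- Regularity: `S` continues to a bounded analytic function on a larger strip. -/
def IsRegular (S : ScatteringFunction) : Prop :=
  ∃ κ : ℝ, 0 < κ ∧ ∃ F : ℂ → ℂ,
    AnalyticOnNhd ℂ F (strip (-κ) (Real.pi + κ)) ∧
    (∃ C : ℝ, ∀ ζ ∈ strip (-κ) (Real.pi + κ), ‖F ζ‖ ≤ C) ∧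
    Set.EqOn F S.toFun (closedStrip 0 Real.pi)

/-- Regular scattering functions for which both limits of `S θ`, `θ → ±∞`, exist. -/
def HasLimit (S : ScatteringFunction) : Prop :=
  S.IsRegular ∧
  (∃ L : ℂ, Tendsto (fun θ : ℝ => S.toFun θ) atTop (𝓝 L)) ∧
  (∃ L : ℂ, Tendsto (fun θ : ℝ => S.toFun θ) atBot (𝓝 L))

theorem continuous_real (S : ScatteringFunction) : Continuous (fun θ : ℝ => S.toFun θ) := by
  refine S.continuousOn.comp_continuous Complex.continuous_ofReal (fun θ => ?_)
  simp [closedStrip, Real.pi_pos.le]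

theorem norm_real (S : ScatteringFunction) (θ : ℝ) : ‖S.toFun θ‖ = 1 := by
  have h : S.toFun θ * conj (S.toFun θ) = 1 := by
    rw [S.conj_eq_inv, mul_inv_cancel₀ (S.ne_zero θ)]
  rw [Complex.mul_conj, Complex.normSq_eq_norm_sq] at h
  have h2 : ‖S.toFun θ‖ ^ 2 = 1 := by exact_mod_cast h
  exact (pow_eq_one_iff_of_nonneg (norm_nonneg _) two_ne_zero).1 h2

theorem conj_real (S : ScatteringFunction) (θ : ℝ) : conj (S.toFun θ) = S.toFun (-θ) := by
  rw [S.conj_eq_inv, S.inv_eq_crossing, S.crossing_eq_neg]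

end ScatteringFunction

/-! ### Square integrable functions and elementary unitaries -/

/-- `L²(ℝⁿ, dβ)`; for `n = 0` this is `ℂ`. -/
abbrev L2 (n : ℕ) : Type := Lp ℂ 2 (volume : Measure (Fin n → ℝ))

/-- The single particle space `L²(ℝ, dβ)`. -/
abbrev L2R : Type := Lp ℂ 2 (volume : Measure ℝ)

section WeightedComposition

variable {n : ℕ}

theorem memLp_weighted {m : (Fin n → ℝ) → ℂ} (hm : Measurable m) (h1 : ∀ β, ‖m β‖ = 1)
    {σ : (Fin n → ℝ) → (Fin n → ℝ)} (hσ : MeasurePreserving σ volume volume) (Ψ : L2 n) :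
    MemLp (fun β => m β * Ψ (σ β)) 2 volume := by
  have h := (Lp.memLp Ψ).comp_measurePreserving hσ
  refine h.of_le (hm.aestronglyMeasurable.mul h.1) (Eventually.of_forall fun β => ?_)
  simp only [norm_mul, h1, one_mul, Function.comp_apply, le_refl]

/-- The isometry `(W Ψ)(β) = m(β) Ψ(σ β)` of `L²(ℝⁿ)` for a measurable phase factor `m` and a measure
preserving map `σ`. -/
def weighted (m : (Fin n → ℝ) → ℂ) (hm : Measurable m) (h1 : ∀ β, ‖m β‖ = 1)
    (σ : (Fin n → ℝ) → (Fin n → ℝ)) (hσ : MeasurePreserving σ volume volume) :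
    L2 n →ₗᵢ[ℂ] L2 n where
  toFun Ψ := (memLp_weighted hm h1 hσ Ψ).toLp _
  map_add' Ψ Φ := by
    rw [← MemLp.toLp_add]
    refine MemLp.toLp_congr _ _ ?_
    filter_upwards [hσ.quasiMeasurePreserving.ae (Lp.coeFn_add Ψ Φ)] with β h
    simp only [Pi.add_apply] at h ⊢
    rw [h, mul_add]
  map_smul' c Ψ := by
    rw [RingHom.id_apply, ← MemLp.toLp_const_smul]
    refine MemLp.toLp_congr _ _ ?_
    filter_upwards [hσ.quasiMeasurePreserving.ae (Lp.coeFn_smul c Ψ)] with β h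
    simp only [Pi.smul_apply, smul_eq_mul] at h ⊢
    rw [h, mul_left_comm]
  norm_map' Ψ := by
    change ‖(memLp_weighted hm h1 hσ Ψ).toLp _‖ = ‖Ψ‖
    rw [Lp.norm_toLp, ← Lp.norm_compMeasurePreserving Ψ hσ, Lp.norm_def]
    congr 1
    refine eLpNorm_congr_norm_ae ?_
    filter_upwards [Lp.coeFn_compMeasurePreserving Ψ hσ] with β h
    rw [h, norm_mul, h1, one_mul, Function.comp_apply]

theorem weighted_ae {m : (Fin n → ℝ) → ℂ} (hm : Measurable m) (h1 : ∀ β, ‖m β‖ = 1)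
    {σ : (Fin n → ℝ) → (Fin n → ℝ)} (hσ : MeasurePreserving σ volume volume) (Ψ : L2 n) :
    weighted m hm h1 σ hσ Ψ =ᵐ[volume] fun β => m β * Ψ (σ β) :=
  MemLp.coeFn_toLp (memLp_weighted hm h1 hσ Ψ)

theorem measurePreserving_perm (e : Equiv.Perm (Fin n)) :
    MeasurePreserving (fun (β : Fin n → ℝ) i => β (e i)) volume volume := by
  have h := volume_measurePreserving_piCongrLeft (fun _ : Fin n => ℝ) e.symm
  convert h using 1
  funext β i
  have := MeasurableEquiv.piCongrLeft_apply_apply (β := fun _ : Fin n => ℝ) (e := e.symm)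
    (x := β) (i := e i)
  simpa using this.symm

theorem measurePreserving_shift (t : ℝ) :
    MeasurePreserving (fun (β : Fin n → ℝ) i => β i + t) volume volume :=
  measurePreserving_add_right (volume : Measure (Fin n → ℝ)) (fun _ => t)

end WeightedComposition

/-! ### The `S`-symmetric Fock space -/

variable (S : ScatteringFunction)

/-- The action of the transposition of the (zero based) indices `k` and `k + 1`:
`(Dₙ(τ_k)Ψ)(β) = S(β_{k+1} - β_k) Ψ(…, β_{k+1}, β_k, …)`. -/
def transpositionAction (n k : ℕ) (hk : k + 1 < n) : L2 n →ₗᵢ[ℂ] L2 n :=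
  weighted
    (fun β => S.toFun ((β ⟨k + 1, hk⟩ - β ⟨k, by omega⟩ : ℝ) : ℂ))
    (S.continuous_real.measurable.comp
      ((measurable_pi_apply _).sub (measurable_pi_apply _)))
    (fun _ => S.norm_real _)
    (fun β i => β (Equiv.swap ⟨k, by omega⟩ ⟨k + 1, hk⟩ i))
    (measurePreserving_perm _)

/-- The `n`-particle space: the vectors of `L²(ℝⁿ)` fixed by all `Dₙ(τ_k)`. As the `τ_k` generate the
permutation group, these are the vectors invariant under the representation `Dₙ`. -/
def nParticle (n : ℕ) : Submodule ℂ (L2 n) :=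
  ⨅ (k : ℕ) (hk : k + 1 < n),
    LinearMap.eqLocus (transpositionAction S n k hk).toLinearMap LinearMap.id

theorem mem_nParticle {n : ℕ} {Ψ : L2 n} :
    Ψ ∈ nParticle S n ↔ ∀ k (hk : k + 1 < n), transpositionAction S n k hk Ψ = Ψ := by
  simp [nParticle, Submodule.mem_iInf]

instance (n : ℕ) : CompleteSpace (nParticle S n) := by
  have : IsClosed (nParticle S n : Set (L2 n)) := by
    have h : (nParticle S n : Set (L2 n)) =
        ⋂ (k : ℕ) (hk : k + 1 < n), {Ψ | transpositionAction S n k hk Ψ = Ψ} := by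
      ext Ψ
      simp [mem_nParticle]
    rw [h]
    exact isClosed_iInter fun k => isClosed_iInter fun hk =>
      isClosed_eq (transpositionAction S n k hk).continuous continuous_id
  exact this.completeSpace_coe

/-- The `S`-symmetric Fock space, the Hilbert space direct sum of the `n`-particle spaces. -/
abbrev Fock : Type := lp (fun n : ℕ => nParticle S n) 2

/-- The subspace `𝒟` of vectors of bounded particle number (terminating sequences). -/
def finiteParticle : Submodule ℂ (Fock S) where
  carrier := {Ψ | ∃ N : ℕ, ∀ n, N ≤ n → Ψ n = 0}
  zero_mem' := ⟨0, fun _ _ => rfl⟩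
  add_mem' := by
    rintro Ψ Φ ⟨N, hN⟩ ⟨M, hM⟩
    refine ⟨max N M, fun n hn => ?_⟩
    simp [hN n (le_trans (le_max_left _ _) hn), hM n (le_trans (le_max_right _ _) hn)]
  smul_mem' := by
    rintro c Ψ ⟨N, hN⟩
    exact ⟨N, fun n hn => by simp [hN n hn]⟩

/-- `𝒟` is dense, so that adjoints of operators with domain `𝒟` are proper adjoints. -/
theorem dense_finiteParticle : Dense (finiteParticle S : Set (Fock S)) := by
  classical
  intro Ψ
  have h : HasSum (fun i => lp.single 2 i (Ψ i)) Ψ := lp.hasSum_single (by simp) Ψ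
  refine mem_closure_of_tendsto h (Eventually.of_forall fun s => ?_)
  refine Submodule.sum_mem _ fun i _ => ⟨i + 1, fun n hn => ?_⟩
  exact lp.single_apply_ne 2 i _ (by omega)

theorem const_one_mem_nParticle_zero :
    (memLp_const (1 : ℂ)).toLp (fun _ : Fin 0 → ℝ => (1 : ℂ)) ∈ nParticle S 0 := by
  rw [mem_nParticle]
  intro k hk
  omega

/-- The vacuum `Ω = 1 ⊕ 0 ⊕ 0 ⊕ ⋯`. -/
def vacuum : Fock S :=
  lp.single 2 0 ⟨_, const_one_mem_nParticle_zero S⟩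

/-! ### The representation of the affine group -/

section Componentwise

variable {σ : ℂ →+* ℂ} {E : ℕ → Type} [∀ n, NormedAddCommGroup (E n)]
  [∀ n, InnerProductSpace ℂ (E n)]

/-- The isometry `(T Ψ)ₙ = Tₙ Ψₙ` of a Hilbert space direct sum. -/
def componentwise (T : ∀ n, E n →ₛₗᵢ[σ] E n) : lp E 2 →ₛₗᵢ[σ] lp E 2 where
  toFun Ψ := ⟨fun n => T n (Ψ n), (lp.memℓp Ψ).mono' (fun n => ((T n).norm_map _).le)⟩
  map_add' Ψ Φ := by
    ext n
    exact (T n).map_add _ _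
  map_smul' c Ψ := by
    ext n
    exact (T n).map_smulₛₗ _ _
  norm_map' Ψ := by
    have h2 : 0 < (2 : ℝ≥0∞).toReal := by norm_num
    rw [lp.norm_eq_tsum_rpow h2, lp.norm_eq_tsum_rpow h2]
    congr 1
    exact tsum_congr fun n => congrArg (· ^ (2 : ℝ≥0∞).toReal) ((T n).norm_map (Ψ n))

theorem componentwise_apply (T : ∀ n, E n →ₛₗᵢ[σ] E n) (Ψ : lp E 2) (n : ℕ) :
    componentwise T Ψ n = T n (Ψ n) := rfl

end Componentwise

/-- Translations and dilations on `L²(ℝⁿ)`: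
`Ψ ↦ e^{iξ(e^{β₁} + ⋯ + e^{βₙ})} Ψ(β₁ + t, …, βₙ + t)`. -/
def affineL2 (n : ℕ) (ξ t : ℝ) : L2 n →ₗᵢ[ℂ] L2 n :=
  weighted
    (fun β => Complex.exp (Complex.I * ((ξ * ∑ i, Real.exp (β i) : ℝ) : ℂ)))
    (by fun_prop)
    (fun β => by rw [mul_comm]; exact Complex.norm_exp_ofReal_mul_I _)
    (fun β i => β i + t)
    (measurePreserving_shift t)

theorem weighted_weighted_ae {n : ℕ} {m m' : (Fin n → ℝ) → ℂ} (hm : Measurable m)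
    (h1 : ∀ β, ‖m β‖ = 1) (hm' : Measurable m') (h1' : ∀ β, ‖m' β‖ = 1)
    {σ σ' : (Fin n → ℝ) → (Fin n → ℝ)} (hσ : MeasurePreserving σ volume volume)
    (hσ' : MeasurePreserving σ' volume volume) (Ψ : L2 n) :
    weighted m hm h1 σ hσ (weighted m' hm' h1' σ' hσ' Ψ) =ᵐ[volume]
      fun β => m β * (m' (σ β) * Ψ (σ' (σ β))) := by
  filter_upwards [weighted_ae hm h1 hσ (weighted m' hm' h1' σ' hσ' Ψ),
    hσ.quasiMeasurePreserving.ae (weighted_ae hm' h1' hσ' Ψ)] with β h h'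
  rw [h, h']

theorem affineL2_comp (n : ℕ) (ξ t ξ' t' : ℝ) (Ψ : L2 n) :
    affineL2 n ξ t (affineL2 n ξ' t' Ψ) = affineL2 n (ξ + Real.exp t * ξ') (t + t') Ψ := by
  refine Lp.ext ((weighted_weighted_ae _ _ _ _ _ _ Ψ).trans
    (EventuallyEq.trans ?_ (weighted_ae _ _ _ Ψ).symm))
  refine Eventually.of_forall fun β => ?_
  dsimp only
  rw [← mul_assoc, ← Complex.exp_add, ← mul_add, ← Complex.ofReal_add]
  have h1 : ξ * ∑ i, Real.exp (β i) + ξ' * ∑ i, Real.exp (β i + t) =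
      (ξ + Real.exp t * ξ') * ∑ i, Real.exp (β i) := by
    simp_rw [Real.exp_add, ← Finset.sum_mul]
    ring
  simp_rw [h1, add_assoc]

theorem affineL2_zero (n : ℕ) (Ψ : L2 n) : affineL2 n 0 0 Ψ = Ψ := by
  refine Lp.ext ((weighted_ae _ _ _ Ψ).trans (Eventually.of_forall fun β => ?_))
  simp

theorem affineL2_mem {n : ℕ} (ξ t : ℝ) {Ψ : L2 n} (hΨ : Ψ ∈ nParticle S n) :
    affineL2 n ξ t Ψ ∈ nParticle S n := by
  rw [mem_nParticle] at hΨ ⊢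
  intro k hk
  conv_rhs => rw [← hΨ k hk]
  refine Lp.ext ((weighted_weighted_ae _ _ _ _ _ _ Ψ).trans
    (EventuallyEq.trans ?_ (weighted_weighted_ae _ _ _ _ _ _ Ψ).symm))
  refine Eventually.of_forall fun β => ?_
  dsimp only
  rw [Equiv.sum_comp (Equiv.swap (⟨k, by omega⟩ : Fin n) ⟨k + 1, hk⟩) (fun i => Real.exp (β i)),
    add_sub_add_right_eq_sub, mul_left_comm]

theorem memLp_reflection {n : ℕ} (Ψ : L2 n) :
    MemLp (fun β : Fin n → ℝ => conj (Ψ (fun i => β (Fin.revPerm i)))) 2 volume :=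
  MemLp.star ((Lp.memLp Ψ).comp_measurePreserving (measurePreserving_perm Fin.revPerm))

/-- The reflection on `L²(ℝⁿ)`: `Ψ ↦ conj Ψ(βₙ, …, β₁)`. -/
def reflectionL2 (n : ℕ) : L2 n →ₛₗᵢ[starRingEnd ℂ] L2 n where
  toFun Ψ := (memLp_reflection Ψ).toLp _
  map_add' Ψ Φ := by
    rw [← MemLp.toLp_add]
    refine MemLp.toLp_congr _ _ ?_
    filter_upwards [(measurePreserving_perm Fin.revPerm).quasiMeasurePreserving.ae
      (Lp.coeFn_add Ψ Φ)] with β h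
    simp only [Pi.add_apply] at h ⊢
    rw [h, map_add]
  map_smul' c Ψ := by
    rw [← MemLp.toLp_const_smul]
    refine MemLp.toLp_congr _ _ ?_
    filter_upwards [(measurePreserving_perm Fin.revPerm).quasiMeasurePreserving.ae
      (Lp.coeFn_smul c Ψ)] with β h
    simp only [Pi.smul_apply, smul_eq_mul] at h ⊢
    rw [h, map_mul]
  norm_map' Ψ := by
    change ‖(memLp_reflection Ψ).toLp _‖ = ‖Ψ‖
    rw [Lp.norm_toLp, ← Lp.norm_compMeasurePreserving Ψ (measurePreserving_perm Fin.revPerm),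
      Lp.norm_def]
    congr 1
    refine eLpNorm_congr_norm_ae ?_
    filter_upwards [Lp.coeFn_compMeasurePreserving Ψ (measurePreserving_perm Fin.revPerm)] with β h
    rw [h, RCLike.norm_conj, Function.comp_apply]

theorem reflectionL2_ae {n : ℕ} (Ψ : L2 n) :
    reflectionL2 n Ψ =ᵐ[volume] fun β => conj (Ψ (fun i => β (Fin.revPerm i))) :=
  MemLp.coeFn_toLp (memLp_reflection Ψ)

theorem reflectionL2_invol {n : ℕ} (Ψ : L2 n) : reflectionL2 n (reflectionL2 n Ψ) = Ψ := by
  refine Lp.ext ?_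
  filter_upwards [reflectionL2_ae (reflectionL2 n Ψ),
    (measurePreserving_perm Fin.revPerm).quasiMeasurePreserving.ae (reflectionL2_ae Ψ)] with β h h'
  rw [h, h']
  simp

theorem reflectionL2_mem {n : ℕ} {Ψ : L2 n} (hΨ : Ψ ∈ nParticle S n) :
    reflectionL2 n Ψ ∈ nParticle S n := by
  rw [mem_nParticle] at hΨ ⊢
  intro k hk
  -- the transposition of `k, k + 1` is reflected to that of `l, l + 1`
  obtain ⟨l, hl⟩ : ∃ l, l + k + 2 = n := ⟨n - k - 2, by omega⟩
  have hl' : l + 1 < n := by omega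
  set r := measurePreserving_perm (Fin.revPerm (n := n)) with hr
  set w := measurePreserving_perm (Equiv.swap (⟨k, by omega⟩ : Fin n) ⟨k + 1, hk⟩) with hw
  have hsym : Ψ =ᵐ[volume] _ := (Lp.ext_iff.1 (hΨ l hl')).symm.trans (weighted_ae _ _ _ Ψ)
  refine Lp.ext ?_
  filter_upwards [weighted_ae (S.continuous_real.measurable.comp
      ((measurable_pi_apply (⟨k + 1, hk⟩ : Fin n)).sub (measurable_pi_apply ⟨k, by omega⟩)))
      (fun _ => S.norm_real _) w (reflectionL2 n Ψ),
    w.quasiMeasurePreserving.ae (reflectionL2_ae Ψ), reflectionL2_ae Ψ,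
    w.quasiMeasurePreserving.ae (r.quasiMeasurePreserving.ae hsym)] with β h1 h2 h3 h4
  refine h1.trans ?_
  have hk1 : Fin.rev (⟨l, by omega⟩ : Fin n) = ⟨k + 1, hk⟩ := by
    ext; simp [Fin.val_rev]; omega
  have hk2 : Fin.rev (⟨l + 1, hl'⟩ : Fin n) = ⟨k, by omega⟩ := by
    ext; simp [Fin.val_rev]; omega
  have harg : (fun i => β (Equiv.swap (⟨k, by omega⟩ : Fin n) ⟨k + 1, hk⟩
      (Fin.revPerm (Equiv.swap (⟨l, by omega⟩ : Fin n) ⟨l + 1, hl'⟩ i)))) =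
      fun i => β (Fin.revPerm i) := by
    funext i
    congr 1
    have : (Fin.revPerm (Equiv.swap (⟨l, by omega⟩ : Fin n) ⟨l + 1, hl'⟩ i)) =
        Equiv.swap (⟨k, by omega⟩ : Fin n) ⟨k + 1, hk⟩ (Fin.revPerm i) := by
      have h := (Fin.revPerm (n := n)).injective.swap_apply ⟨l, by omega⟩ ⟨l + 1, hl'⟩ i
      rw [Fin.revPerm_apply ⟨l, _⟩, Fin.revPerm_apply ⟨l + 1, _⟩, hk1, hk2, Equiv.swap_comm] at h
      exact h.symm
    rw [this, Equiv.swap_apply_self]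
  rw [h2, h3, h4, harg, Fin.revPerm_apply, Fin.revPerm_apply, hk1, hk2, Equiv.swap_apply_left,
    Equiv.swap_apply_right, map_mul, ← mul_assoc]
  simp only [Function.comp_apply, Pi.sub_apply]
  rw [S.conj_eq_inv, mul_inv_cancel₀ (S.ne_zero _), one_mul]

/-- Restriction of an isometry that leaves the `n`-particle space invariant. -/
def restrictIsometry {σ : ℂ →+* ℂ} {n : ℕ} (T : L2 n →ₛₗᵢ[σ] L2 n)
    (hT : ∀ Ψ ∈ nParticle S n, T Ψ ∈ nParticle S n) : nParticle S n →ₛₗᵢ[σ] nParticle S n where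
  toFun Ψ := ⟨T Ψ, hT Ψ Ψ.2⟩
  map_add' _ _ := Subtype.ext (T.map_add _ _)
  map_smul' _ _ := Subtype.ext (T.map_smulₛₗ _ _)
  norm_map' _ := T.norm_map _

/-- `U(ξ,t)` as an isometry of the Fock space. -/
def affineIsometry (ξ t : ℝ) : Fock S →ₗᵢ[ℂ] Fock S :=
  componentwise fun n => restrictIsometry S (affineL2 n ξ t) fun _ h => affineL2_mem S ξ t h

theorem affineIsometry_comp (ξ t ξ' t' : ℝ) (Ψ : Fock S) :
    affineIsometry S ξ t (affineIsometry S ξ' t' Ψ) =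
      affineIsometry S (ξ + Real.exp t * ξ') (t + t') Ψ := by
  ext1
  funext n
  exact Subtype.ext (affineL2_comp n ξ t ξ' t' _)

theorem affineIsometry_zero (Ψ : Fock S) : affineIsometry S 0 0 Ψ = Ψ := by
  ext1
  funext n
  exact Subtype.ext (affineL2_zero n _)

/-- The unitary `U(ξ,t)` representing the affine map `x ↦ eᵗ x + ξ`:
`(U(ξ,t)Ψ)ₙ(β) = e^{iξ(e^{β₁} + ⋯ + e^{βₙ})} Ψₙ(β₁ + t, …, βₙ + t)`. -/
def affineRep (ξ t : ℝ) : Fock S ≃ₗᵢ[ℂ] Fock S :=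
  { affineIsometry S ξ t with
    invFun := affineIsometry S (-(Real.exp (-t) * ξ)) (-t)
    left_inv := fun Ψ => by
      change affineIsometry S _ _ (affineIsometry S _ _ Ψ) = Ψ
      rw [affineIsometry_comp, neg_add_cancel, neg_add_cancel, affineIsometry_zero]
    right_inv := fun Ψ => by
      change affineIsometry S _ _ (affineIsometry S _ _ Ψ) = Ψ
      rw [affineIsometry_comp, add_neg_cancel, mul_neg, ← mul_assoc, ← Real.exp_add,
        add_neg_cancel, Real.exp_zero, one_mul, add_neg_cancel, affineIsometry_zero] }

/-- `U(j)` as an antilinear isometry of the Fock space. -/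
def reflectionIsometry : Fock S →ₛₗᵢ[starRingEnd ℂ] Fock S :=
  componentwise fun n => restrictIsometry S (reflectionL2 n) fun _ h => reflectionL2_mem S h

theorem reflectionIsometry_invol (Ψ : Fock S) :
    reflectionIsometry S (reflectionIsometry S Ψ) = Ψ := by
  ext1
  funext n
  exact Subtype.ext (reflectionL2_invol _)

/-- The antiunitary involution `U(j)`: `(U(j)Ψ)ₙ(β₁, …, βₙ) = conj Ψₙ(βₙ, …, β₁)`. -/
def reflectionRep : Fock S ≃ₛₗᵢ[starRingEnd ℂ] Fock S :=
  { reflectionIsometry S with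
    invFun := reflectionIsometry S
    left_inv := reflectionIsometry_invol S
    right_inv := reflectionIsometry_invol S }

/-! ### Creation and annihilation operators -/

theorem memLp_tensor {n : ℕ} (ψ : L2R) (Φ : L2 n) :
    MemLp (fun β : Fin (n + 1) → ℝ => ψ (β 0) * Φ (fun i => β i.succ)) 2 volume := by
  have hψ := Lp.memLp ψ
  have hΦ := Lp.memLp Φ
  have hm : AEStronglyMeasurable (fun z : ℝ × (Fin n → ℝ) => ψ z.1 * Φ z.2)
      (volume.prod volume) := hψ.1.comp_fst.mul hΦ.1.comp_snd
  have h : MemLp (fun z : ℝ × (Fin n → ℝ) => ψ z.1 * Φ z.2) 2 (volume.prod volume) := by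
    rw [memLp_two_iff_integrable_sq_norm hm]
    simp_rw [norm_mul, mul_pow]
    exact ((memLp_two_iff_integrable_sq_norm hψ.1).1 hψ).mul_prod
      ((memLp_two_iff_integrable_sq_norm hΦ.1).1 hΦ)
  exact h.comp_measurePreserving (volume_preserving_piFinSuccAbove (fun _ => ℝ) 0)

/-- `(ψ ⊗ Φ)(β₁, …, βₙ₊₁) = ψ(β₁) Φ(β₂, …, βₙ₊₁)`, linear in `Φ`. -/
def tensor {n : ℕ} (ψ : L2R) : L2 n →ₗ[ℂ] L2 (n + 1) where
  toFun Φ := (memLp_tensor ψ Φ).toLp _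
  map_add' Φ Φ' := by
    rw [← MemLp.toLp_add]
    refine MemLp.toLp_congr _ _ ?_
    have hq := Measure.quasiMeasurePreserving_snd.comp
      (volume_preserving_piFinSuccAbove (fun _ : Fin (n + 1) => ℝ) 0).quasiMeasurePreserving
    filter_upwards [hq.ae (Lp.coeFn_add Φ Φ')] with β h
    change _ = (_ : ℂ) + _
    rw [← mul_add]
    exact congrArg _ h
  map_smul' c Φ := by
    rw [RingHom.id_apply, ← MemLp.toLp_const_smul]
    refine MemLp.toLp_congr _ _ ?_
    have hq := Measure.quasiMeasurePreserving_snd.comp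
      (volume_preserving_piFinSuccAbove (fun _ : Fin (n + 1) => ℝ) 0).quasiMeasurePreserving
    filter_upwards [hq.ae (Lp.coeFn_smul c Φ)] with β h
    change _ = c * (_ * _)
    rw [mul_left_comm]
    exact congrArg _ h

/-- The components of `y†(ψ)Φ`: `(y†(ψ)Φ)₀ = 0` and `(y†(ψ)Φ)ₙ₊₁ = √(n+1) Pₙ₊₁(ψ ⊗ Φₙ)`, where `Pₙ` is
the orthogonal projection onto the `n`-particle space. -/
def creationComponent (ψ : L2R) (Φ : Fock S) : ∀ n : ℕ, nParticle S n
  | 0 => 0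
  | n + 1 => ((Real.sqrt (n + 1) : ℝ) : ℂ) •
      (nParticle S (n + 1)).orthogonalProjectionOnto (tensor ψ (Φ n : L2 n))

theorem memℓp_creationComponent (ψ : L2R) {Φ : Fock S} (hΦ : Φ ∈ finiteParticle S) :
    Memℓp (creationComponent S ψ Φ) 2 := by
  obtain ⟨N, hN⟩ := hΦ
  refine (memℓp_zero ((Set.finite_Iic N).subset fun n hn => ?_)).of_exponent_ge zero_le
  by_contra hlt
  rcases n with _ | n
  · exact hn rfl
  · refine hn ?_
    have : Φ n = 0 := hN n (by simp at hlt; omega)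
    simp [creationComponent, this]

/-- The creation operator `y†(ψ)`, with domain `𝒟`. -/
def creation (ψ : L2R) : Fock S →ₗ.[ℂ] Fock S where
  domain := finiteParticle S
  toFun :=
    { toFun := fun Φ => ⟨creationComponent S ψ Φ, memℓp_creationComponent S ψ Φ.2⟩
      map_add' := fun Φ Φ' => by
        ext1
        funext n
        rcases n with _ | n
        · exact (add_zero (0 : nParticle S 0)).symm
        · change _ = creationComponent S ψ Φ (n + 1) + creationComponent S ψ Φ' (n + 1)
          simp [creationComponent]
      map_smul' := fun c Φ => by
        ext1
        funext n
        rcases n with _ | n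
        · exact (smul_zero (A := nParticle S 0) c).symm
        · change _ = c • creationComponent S ψ Φ (n + 1)
          simp only [creationComponent]
          rw [smul_comm c]
          simp }

/-- The annihilation operator `y(ψ) = y†(conj ψ)^*`, the Hilbert space adjoint. -/
def annihilation (ψ : L2R) : Fock S →ₗ.[ℂ] Fock S := (creation S (star ψ)).adjoint

/-! ### Test functions -/

/-- `f̃(p) = (2π)^{-1/2} ∫ f(ξ) e^{ipξ} dξ`. -/
def tilde (f : 𝓢(ℝ, ℂ)) (p : ℝ) : ℂ :=
  1 / (Real.sqrt (2 * Real.pi) : ℂ) * ∫ ξ : ℝ, f ξ * Complex.exp (Complex.I * p * ξ)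

/-- `f̂⁺(β) = i e^β f̃(e^β)`. -/
def hatPlusFun (f : 𝓢(ℝ, ℂ)) (β : ℝ) : ℂ :=
  Complex.I * (Real.exp β : ℂ) * tilde f (Real.exp β)

/-- `f̂⁻(β) = -i e^β f̃(-e^β)`. -/
def hatMinusFun (f : 𝓢(ℝ, ℂ)) (β : ℝ) : ℂ :=
  -Complex.I * (Real.exp β : ℂ) * tilde f (-Real.exp β)

theorem tilde_eq (f : 𝓢(ℝ, ℂ)) (p : ℝ) :
    tilde f p = 1 / (Real.sqrt (2 * Real.pi) : ℂ) *
      FourierTransform.fourier f (-p / (2 * Real.pi)) := by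
  rw [SchwartzMap.fourier_coe, Real.fourier_real_eq_integral_exp_smul, tilde]
  congr 2
  funext ξ
  rw [smul_eq_mul, mul_comm]
  congr 2
  push_cast
  have : (Real.pi : ℂ) ≠ 0 := by exact_mod_cast Real.pi_ne_zero
  field_simp

theorem continuous_tilde (f : 𝓢(ℝ, ℂ)) : Continuous (tilde f) := by
  have : tilde f = fun p => 1 / (Real.sqrt (2 * Real.pi) : ℂ) *
      FourierTransform.fourier f (-p / (2 * Real.pi)) := funext (tilde_eq f)
  rw [this]
  exact continuous_const.mul ((FourierTransform.fourier f).continuous.comp (by fun_prop))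

theorem tilde_decay (f : 𝓢(ℝ, ℂ)) : ∃ C : ℝ, ∀ p, (1 + p ^ 2) * ‖tilde f p‖ ≤ C := by
  obtain ⟨C₀, -, h₀⟩ := (FourierTransform.fourier f).decay 0 0
  obtain ⟨C₂, -, h₂⟩ := (FourierTransform.fourier f).decay 2 0
  refine ⟨‖1 / (Real.sqrt (2 * Real.pi) : ℂ)‖ * (C₀ + (2 * Real.pi) ^ 2 * C₂), fun p => ?_⟩
  have h0 := h₀ (-p / (2 * Real.pi))
  have h2 := h₂ (-p / (2 * Real.pi))
  simp only [norm_iteratedFDeriv_zero, pow_zero, one_mul, Real.norm_eq_abs, sq_abs] at h0 h2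
  rw [tilde_eq, norm_mul, mul_left_comm]
  refine mul_le_mul_of_nonneg_left ?_ (norm_nonneg _)
  have h3 := mul_le_mul_of_nonneg_left h2 (sq_nonneg (2 * Real.pi))
  rw [← mul_assoc, ← mul_pow, mul_div_cancel₀ _ (by positivity : (2 * Real.pi) ≠ 0), neg_sq] at h3
  linarith

theorem memLp_hat_aux (f : 𝓢(ℝ, ℂ)) {c : ℂ} (hc : ‖c‖ = 1) {ε : ℝ} (hε : ε ^ 2 = 1) :
    MemLp (fun β : ℝ => c * (Real.exp β : ℂ) * tilde f (ε * Real.exp β)) 2 volume := by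
  obtain ⟨C, hC⟩ := tilde_decay f
  have hcont : Continuous (fun β : ℝ => c * (Real.exp β : ℂ) * tilde f (ε * Real.exp β)) := by
    have := continuous_tilde f
    fun_prop
  rw [memLp_two_iff_integrable_sq_norm hcont.aestronglyMeasurable]
  refine (integrable_inv_one_add_sq.const_mul (C ^ 2)).mono'
    (hcont.norm.pow 2).aestronglyMeasurable (Eventually.of_forall fun β => ?_)
  rw [Real.norm_of_nonneg (by positivity), norm_mul, norm_mul, hc, one_mul, Complex.norm_real,
    Real.norm_of_nonneg (Real.exp_pos β).le]
  have h := hC (ε * Real.exp β)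
  rw [mul_pow, hε, one_mul] at h
  set x := ‖tilde f (ε * Real.exp β)‖ with hx
  have hx0 : 0 ≤ x := norm_nonneg _
  set e := Real.exp β with he
  have he0 : 0 < e := Real.exp_pos β
  have hb : (1 + β ^ 2) * e ^ 2 ≤ (1 + e ^ 2) ^ 2 := by
    have h1 : (1 + |β|) * e ≤ 1 + e ^ 2 := by
      rcases le_total 0 β with h0 | h0
      · rw [abs_of_nonneg h0]
        nlinarith [Real.add_one_le_exp β]
      · rw [abs_of_nonpos h0]
        have h2 : Real.exp (-β) * e = 1 := by rw [he, ← Real.exp_add]; simp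
        nlinarith [Real.add_one_le_exp (-β)]
    calc (1 + β ^ 2) * e ^ 2 ≤ ((1 + |β|) * e) ^ 2 := by
          nlinarith [abs_nonneg β, sq_abs β, mul_nonneg (abs_nonneg β) (sq_nonneg e)]
      _ ≤ (1 + e ^ 2) ^ 2 := by gcongr
  rw [← div_eq_mul_inv, le_div_iff₀ (by positivity)]
  calc (e * x) ^ 2 * (1 + β ^ 2) = ((1 + β ^ 2) * e ^ 2) * x ^ 2 := by ring
    _ ≤ (1 + e ^ 2) ^ 2 * x ^ 2 := by gcongr
    _ = ((1 + e ^ 2) * x) ^ 2 := by ring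
    _ ≤ C ^ 2 := by gcongr

theorem memLp_hatPlusFun (f : 𝓢(ℝ, ℂ)) : MemLp (hatPlusFun f) 2 volume := by
  have h := memLp_hat_aux f (c := Complex.I) (by simp) (ε := 1) (by norm_num)
  simp only [one_mul] at h
  exact h

theorem memLp_hatMinusFun (f : 𝓢(ℝ, ℂ)) : MemLp (hatMinusFun f) 2 volume := by
  have h := memLp_hat_aux f (c := -Complex.I) (by simp) (ε := -1) (by norm_num)
  have hfun : hatMinusFun f =
      fun β : ℝ => -Complex.I * (Real.exp β : ℂ) * tilde f (-1 * Real.exp β) := by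
    funext β
    rw [hatMinusFun, neg_one_mul]
  rwa [hfun]

/-- `f̂⁺` as a vector of the single particle space. -/
def hatPlus (f : 𝓢(ℝ, ℂ)) : L2R := (memLp_hatPlusFun f).toLp _

/-- `f̂⁻` as a vector of the single particle space. -/
def hatMinus (f : 𝓢(ℝ, ℂ)) : L2R := (memLp_hatMinusFun f).toLp _

/-- `f^j(x) = conj f(-x)`. -/
def reflectTest (f : 𝓢(ℝ, ℂ)) : 𝓢(ℝ, ℂ) :=
  SchwartzMap.compCLMOfContinuousLinearEquiv ℝ (ContinuousLinearEquiv.neg ℝ)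
    (SchwartzMap.postcompCLM (Complex.conjCLE : ℂ →L[ℝ] ℂ) f)

theorem reflectTest_apply (f : 𝓢(ℝ, ℂ)) (x : ℝ) : reflectTest f x = conj (f (-x)) := rfl

/-- `f^{ξ,t}(x) = f(e^{-t}(x - ξ))`. -/
def affineTest (ξ t : ℝ) (f : 𝓢(ℝ, ℂ)) : 𝓢(ℝ, ℂ) :=
  SchwartzMap.compSubConstCLM ℂ ξ
    (SchwartzMap.compCLMOfContinuousLinearEquiv ℂ
      (ContinuousLinearEquiv.smulLeft (Units.mk0 (Real.exp (-t)) (Real.exp_pos _).ne')) f)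

theorem affineTest_apply (ξ t : ℝ) (f : 𝓢(ℝ, ℂ)) (x : ℝ) :
    affineTest ξ t f x = f (Real.exp (-t) * (x - ξ)) := rfl

/-! ### Unbounded operators -/

section Operators

variable {H : Type} [NormedAddCommGroup H] [InnerProductSpace ℂ H]

/-- The operator `V A V⁻¹` with domain `V (dom A)`, for a unitary or antiunitary `V`. -/
def conjugateBy {σ σ' : ℂ →+* ℂ} [RingHomInvPair σ σ'] [RingHomInvPair σ' σ]
    (V : H ≃ₛₗᵢ[σ] H) (A : H →ₗ.[ℂ] H) : H →ₗ.[ℂ] H where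
  domain := A.domain.comap (V.symm.toLinearEquiv : H →ₛₗ[σ'] H)
  toFun :=
    { toFun := fun Ψ => V (A ⟨V.symm Ψ, Ψ.2⟩)
      map_add' := fun Ψ Φ => by
        rw [← map_add V, ← LinearPMap.map_add]
        congr 2
        exact Subtype.ext (map_add V.symm _ _)
      map_smul' := fun c Ψ => by
        have h : (⟨V.symm (c • Ψ : A.domain.comap (V.symm.toLinearEquiv : H →ₛₗ[σ'] H)),
            (c • Ψ).2⟩ : A.domain) = σ' c • ⟨V.symm Ψ, Ψ.2⟩ :=
          Subtype.ext (V.symm.map_smulₛₗ _ _)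
        rw [h, LinearPMap.map_smul, V.map_smulₛₗ, RingHomInvPair.comp_apply_eq₂, RingHom.id_apply] }

/-- A densely defined closable operator is essentially self-adjoint if its closure is
self-adjoint. -/
def IsEssentiallySelfAdjoint [CompleteSpace H] (A : H →ₗ.[ℂ] H) : Prop :=
  Dense (A.domain : Set H) ∧ A.IsClosable ∧ IsSelfAdjoint A.closure

/-- `Ψ` is an entire analytic vector for `A`: all powers `Aⁿ Ψ` are defined, and
`∑ ‖Aⁿ Ψ‖ tⁿ / n! < ∞` for all `t`. Here `v n = Aⁿ Ψ`. -/
def IsEntireAnalyticVector (A : H →ₗ.[ℂ] H) (Ψ : H) : Prop :=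
  ∃ v : ℕ → H, v 0 = Ψ ∧ (∀ n, ∃ h : v n ∈ A.domain, v (n + 1) = A ⟨v n, h⟩) ∧
    ∀ t : ℝ, Summable fun n : ℕ => ‖v n‖ * t ^ n / (n.factorial : ℝ)

/-- `f ↦ Φ(f)` is an operator-valued tempered distribution on the domain `D`: `D` is contained in the
domain of each `Φ(f)` and invariant under it, and for each `Ψ ∈ D` the map `f ↦ Φ(f)Ψ` is linear and
continuous from the Schwartz space to the Hilbert space with its norm topology. -/
def IsOperatorValuedTemperedDistribution (D : Submodule ℂ H) (Φ : 𝓢(ℝ, ℂ) → H →ₗ.[ℂ] H) : Prop :=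
  (∀ f, D ≤ (Φ f).domain) ∧
  (∀ f (x : (Φ f).domain), (x : H) ∈ D → Φ f x ∈ D) ∧
  ∀ Ψ ∈ D, ∃ T : 𝓢(ℝ, ℂ) →L[ℂ] H, ∀ f (x : (Φ f).domain), (x : H) = Ψ → Φ f x = T f

/-- The vectors `Φ(f₁) ⋯ Φ(fₙ) Ω`, `n ≥ 0`, where the `fₖ` are supported in the closure of `I`. -/
inductive IsFieldVector (Φ : 𝓢(ℝ, ℂ) → H →ₗ.[ℂ] H) (Ω : H) (I : Set ℝ) : H → Prop
  | vacuum : IsFieldVector Φ Ω I Ω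
  | apply (f : 𝓢(ℝ, ℂ)) (hf : tsupport f ⊆ closure I) (x : (Φ f).domain)
      (hx : IsFieldVector Φ Ω I x) : IsFieldVector Φ Ω I (Φ f x)

/-- `[A, B]Ψ = 0`, including that `ABΨ` and `BAΨ` are defined. -/
def CommuteAt (A B : H →ₗ.[ℂ] H) (Ψ : H) : Prop :=
  ∃ (hA : Ψ ∈ A.domain) (hB : Ψ ∈ B.domain) (hAB : B ⟨Ψ, hB⟩ ∈ A.domain)
    (hBA : A ⟨Ψ, hA⟩ ∈ B.domain), A ⟨B ⟨Ψ, hB⟩, hAB⟩ - B ⟨A ⟨Ψ, hA⟩, hBA⟩ = 0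

end Operators

/-! ### The chiral fields -/

/-- The field `φ(f) = y†(f̂⁺) + y(f̂⁻)`, on the intersection of the domains of both summands. -/
def field (f : 𝓢(ℝ, ℂ)) : Fock S →ₗ.[ℂ] Fock S :=
  creation S (hatPlus f) + annihilation S (hatMinus f)

/-- The field `φ'(f) = U(j) φ(f^j) U(j)`; recall that `U(j)⁻¹ = U(j)`. -/
def reflectedField (f : 𝓢(ℝ, ℂ)) : Fock S →ₗ.[ℂ] Fock S :=
  conjugateBy (reflectionRep S) (field S (reflectTest f))

end

end ChiralModel

namespace ChiralModel

noncomputable section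

/-! ### Unbounded operators: a self-adjointness criterion, antiunitaries, conjugation by unitaries.
-/

section AbstractOperators

variable {H : Type} [NormedAddCommGroup H] [InnerProductSpace ℂ H]

/-! The field `φ(f)` has domain exactly `𝒟` (`field_domain`) and acts there as `fieldEnd`, a sum of
level-raising and level-lowering bounded maps with norm of order `√n` at level `n`. All four
statements are therefore proved for endomorphisms of `𝒟`, and (a)–(c) are carried over to `φ'` by
the antiunitary `U(j)`.

(a) Continuity in `f` holds because `f̂±` is dominated by a fixed square integrable weight times a
Schwartz seminorm of the Fourier transform of `f`. The `√n` growth against `n!` gives entire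
analytic vectors. Essential self-adjointness comes from a direct computation of deficiency vectors
(`field_deficiency`): if `x` solves the equation for `±i`, the imaginary part of the matrix element
of the creation operator between levels `N` and `N+1` telescopes to `∑_{n≤N} ‖xₙ‖²`. It is at most
of order `√(N+1) ‖x_N‖ ‖x_{N+1}‖`, and divergence of the harmonic series then forces `x = 0`.

(b) `U(ξ,t)` factorizes over tensor products and commutes with the projections `Pₙ`, so creation
operators are covariant, domains included. The annihilation part follows because conjugation by a
unitary commutes with taking adjoints.

(c) Translating a test function inside `I` multiplies `f̂⁺` by `e^{it e^β}`. A vector orthogonal to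
all these translates yields a boundary value of an analytic function on the upper half plane that
vanishes on an interval, hence everywhere; this gives one-particle density
(`ae_eq_zero_of_orthogonal`). Totality of tensor products and induction on the particle number
(`levelBelow_le_fieldClosure`) do the rest: modulo lower levels, `φ(f)` acts on the top level as a
creation operator.

(d) `φ'` creates and annihilates at the right end of the variable list, `φ` at the left. Left and
right creators commute, and so do the annihilators. Each mixed commutator is multiplication by a
function `∫ ψ(θ) χ(θ) ∏ S(β_l - θ) dθ` (`mixedKernel_eq_integral`). The two mixed commutators cancel
after moving the contour from `Im θ = 0` to `Im θ = -π` (`integral_hat_contour_shift`): the support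
conditions make the one-particle functions analytic and decaying there, `S` is analytic and bounded
in the strip, and crossing identifies the values on the two lines. -/

/-- A densely defined symmetric operator with trivial deficiency spaces is essentially
self-adjoint. -/
theorem isEssentiallySelfAdjoint_of_deficiency [CompleteSpace H] {A : H →ₗ.[ℂ] H}
    (hd : Dense (A.domain : Set H)) (hsym : A.IsFormalAdjoint A)
    (hdef : ∀ z : ℂ, z = Complex.I ∨ z = -Complex.I →
      ∀ x : H, (∀ y : A.domain, ⟪x, A y⟫_ℂ = z * ⟪x, y⟫_ℂ) → x = 0) :
    IsEssentiallySelfAdjoint A := by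
  have hle : A ≤ A.adjoint := hsym.le_adjoint hd
  have hcl : A.IsClosable :=
    LinearPMap.isClosable_iff_exists_closed_extension.2 ⟨_, A.adjoint_isClosed hd, hle⟩
  refine ⟨hd, hcl, ?_⟩
  have hgr := hcl.graph_closure_eq_closure_graph
  have hAG : ∀ u : A.domain, ((u : H), A u) ∈ A.closure.graph := fun u => by
    rw [← hgr]; exact A.graph.le_topologicalClosure (A.mem_graph u)
  have hsymL : ∀ p ∈ A.closure.graph, ∀ u : A.domain, ⟪p.2, u⟫_ℂ = ⟪p.1, A u⟫_ℂ := by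
    intro p hp u
    rw [← hgr] at hp
    -- Symmetry is a closed condition on each argument separately, so it passes to the closure of
    -- the graph one argument at a time.
    have hC : IsClosed {p : H × H | ⟪p.2, (u : H)⟫_ℂ = ⟪p.1, A u⟫_ℂ} :=
      isClosed_eq (by fun_prop) (by fun_prop)
    refine closure_minimal ?_ hC hp
    intro q hq
    obtain ⟨v, hv1, hv2⟩ := (A.mem_graph_iff).1 hq
    simpa [← hv1, ← hv2] using hsym v u
  have hsymG : ∀ p ∈ A.closure.graph, ∀ q ∈ A.closure.graph, ⟪p.2, q.1⟫_ℂ = ⟪p.1, q.2⟫_ℂ := by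
    intro p hp q hq
    rw [← hgr] at hq
    have hC : IsClosed {q : H × H | ⟪p.2, q.1⟫_ℂ = ⟪p.1, q.2⟫_ℂ} :=
      isClosed_eq (by fun_prop) (by fun_prop)
    refine closure_minimal ?_ hC hq
    intro q hq
    obtain ⟨v, hv1, hv2⟩ := (A.mem_graph_iff).1 hq
    simpa [← hv1, ← hv2] using hsymL p hp v
  have hcd : Dense (A.closure.domain : Set H) := hd.mono A.le_closure.1
  have hsymC : A.closure.IsFormalAdjoint A.closure := fun x y =>
    hsymG _ (A.closure.mem_graph x) _ (A.closure.mem_graph y)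
  -- the range of `closure A + i`
  let L : A.closure.graph →L[ℂ] H :=
    (ContinuousLinearMap.snd ℂ H H + Complex.I • ContinuousLinearMap.fst ℂ H H).comp
      A.closure.graph.subtypeL
  have hL : ∀ p : A.closure.graph, L p = p.1.2 + Complex.I • p.1.1 := fun p => rfl
  -- Symmetry makes the cross term in `‖Āx + ix‖²` vanish, so `Ā + i` is bounded below in the graph
  -- norm and its range is closed.
  have hnorm : ∀ p : A.closure.graph, ‖p‖ ≤ 1 * ‖L p‖ := by
    intro p
    have h1 : ‖L p‖ ^ 2 = ‖p.1.2‖ ^ 2 + ‖p.1.1‖ ^ 2 := by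
      have hre : RCLike.re ⟪p.1.2, Complex.I • p.1.1⟫_ℂ = 0 := by
        have hs : conj ⟪p.1.2, p.1.1⟫_ℂ = ⟪p.1.2, p.1.1⟫_ℂ := by
          rw [inner_conj_symm]; exact (hsymG _ p.2 _ p.2).symm
        rw [inner_smul_right]
        have := Complex.conj_eq_iff_im.1 hs
        simp [this]
      rw [hL, @norm_add_sq ℂ, hre, norm_smul]
      simp
    rw [one_mul, show ‖p‖ = ‖(p : H × H)‖ from rfl, Prod.norm_def]
    refine max_le ?_ ?_
    · nlinarith [norm_nonneg p.1.1, norm_nonneg (L p), norm_nonneg p.1.2]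
    · nlinarith [norm_nonneg p.1.1, norm_nonneg (L p), norm_nonneg p.1.2]
  have hcomp : CompleteSpace A.closure.graph := hcl.closure_isClosed.completeSpace_coe
  have hrc : IsClosed (L.range : Set H) := by
    have := (ContinuousLinearMap.antilipschitz_of_bound L (K := 1) (by simpa using hnorm)).isClosed_range
      L.uniformContinuous
    rw [LinearMap.coe_range]
    exact this
  -- A vector orthogonal to the closed range of `Ā + i` solves the deficiency equation for `-i`;
  -- hence `Ā + i` is onto.
  have hrt : L.range = ⊤ := by
    have : CompleteSpace L.range := hrc.completeSpace_coe
    rw [← Submodule.orthogonal_eq_bot_iff, Submodule.eq_bot_iff]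
    intro x hx
    refine hdef (-Complex.I) (Or.inr rfl) x fun y => ?_
    have h := (Submodule.mem_orthogonal' _ _).1 hx (L ⟨_, hAG y⟩) ⟨_, rfl⟩
    rw [hL, inner_add_right, inner_smul_right] at h
    simp only at h
    linear_combination h
  rw [LinearPMap.isSelfAdjoint_def]
  refine le_antisymm ?_ (hsymC.le_adjoint hcd)
  refine LinearPMap.le_of_le_graph fun p hp => ?_
  obtain ⟨x, hx1, hx2⟩ := (LinearPMap.mem_graph_iff _).1 hp
  -- Choose `q` in the graph of `Ā` with the same image under `(·) + i` as the point `p` of the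
  -- adjoint graph. The difference of their first components solves the deficiency equation for `i`,
  -- so `p = q`.
  obtain ⟨q, hq⟩ : ∃ q, L q = p.2 + Complex.I • p.1 := by
    have : p.2 + Complex.I • p.1 ∈ L.range := by rw [hrt]; trivial
    exact this
  rw [hL] at hq
  have hxq : p.1 - q.1.1 = 0 := by
    refine hdef Complex.I (Or.inl rfl) _ fun u => ?_
    have h1 : ⟪p.2, u⟫_ℂ = ⟪p.1, A u⟫_ℂ := by
      obtain ⟨w, hw1, hw2⟩ := (LinearPMap.mem_graph_iff _).1 (hAG u)
      have := LinearPMap.adjoint_isFormalAdjoint hcd x w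
      simpa only [hx1, hx2, hw1, hw2] using this
    have h2 := hsymL _ q.2 u
    have h3 : p.2 - q.1.2 = -(Complex.I • (p.1 - q.1.1)) := by
      have : q.1.2 = p.2 + Complex.I • p.1 - Complex.I • q.1.1 := eq_sub_of_add_eq hq
      rw [this, smul_sub]
      abel
    have h4 : ⟪p.2 - q.1.2, u⟫_ℂ = Complex.I * ⟪p.1 - q.1.1, u⟫_ℂ := by
      rw [h3, inner_neg_left, inner_smul_left, Complex.conj_I]; ring
    rw [inner_sub_left, ← h1, ← h2, ← inner_sub_left, h4]
  have hpq : p = q.1 := by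
    have h1 : p.1 = q.1.1 := sub_eq_zero.1 hxq
    refine Prod.ext h1 ?_
    rw [h1] at hq
    exact (add_right_cancel hq).symm
  rw [hpq]
  exact q.2

/-- Polarization: antilinearity interchanges the two terms of the identity that contain `i`, which
conjugates the inner product. -/
theorem antilinear_inner (J : H →ₛₗᵢ[starRingEnd ℂ] H) (x y : H) : ⟪J x, J y⟫_ℂ = ⟪y, x⟫_ℂ := by
  have h1 : ∀ z : H, J (Complex.I • z) = -(Complex.I • J z) := fun z => by
    rw [J.map_smulₛₗ]; simp
  rw [← inner_conj_symm y x, inner_eq_sum_norm_sq_div_four, inner_eq_sum_norm_sq_div_four x y]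
  have e1 : ‖J x + J y‖ = ‖x + y‖ := by rw [← map_add, J.norm_map]
  have e2 : ‖J x - J y‖ = ‖x - y‖ := by rw [← map_sub, J.norm_map]
  have e3 : ‖J x - Complex.I • J y‖ = ‖x + Complex.I • y‖ := by
    rw [← J.norm_map (x + _), map_add, h1, sub_eq_add_neg]
  have e4 : ‖J x + Complex.I • J y‖ = ‖x - Complex.I • y‖ := by
    rw [← J.norm_map (x - _), map_sub, h1, sub_neg_eq_add]
  simp only [RCLike.I_to_complex] at *
  rw [e1, e2, e3, e4]
  simp only [map_div₀, map_add, map_sub, map_mul, map_pow, map_ofNat, Complex.conj_I]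
  simp
  ring

theorem antiunitary_inner (J : H ≃ₛₗᵢ[starRingEnd ℂ] H) (x y : H) : ⟪J x, J y⟫_ℂ = ⟪y, x⟫_ℂ :=
  antilinear_inner J.toLinearIsometry x y

theorem mem_conjugateBy_domain {σ σ' : ℂ →+* ℂ} [RingHomInvPair σ σ'] [RingHomInvPair σ' σ]
    (V : H ≃ₛₗᵢ[σ] H) (A : H →ₗ.[ℂ] H) (x : H) :
    x ∈ (conjugateBy V A).domain ↔ V.symm x ∈ A.domain := Iff.rfl

theorem conjugateBy_apply {σ σ' : ℂ →+* ℂ} [RingHomInvPair σ σ'] [RingHomInvPair σ' σ]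
    (V : H ≃ₛₗᵢ[σ] H) (A : H →ₗ.[ℂ] H) (x : (conjugateBy V A).domain) :
    conjugateBy V A x = V (A ⟨V.symm x, x.2⟩) := rfl

theorem linearPMap_ext_mk {A B : H →ₗ.[ℂ] H} (hd : ∀ x, x ∈ A.domain ↔ x ∈ B.domain)
    (h : ∀ x (hA : x ∈ A.domain) (hB : x ∈ B.domain), A ⟨x, hA⟩ = B ⟨x, hB⟩) : A = B :=
  LinearPMap.ext (Submodule.ext hd) fun x y z => h x y z

theorem conjugateBy_add {σ σ' : ℂ →+* ℂ} [RingHomInvPair σ σ'] [RingHomInvPair σ' σ]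
    (V : H ≃ₛₗᵢ[σ] H) (A B : H →ₗ.[ℂ] H) :
    conjugateBy V (A + B) = conjugateBy V A + conjugateBy V B := by
  refine linearPMap_ext_mk (fun x => Iff.rfl) fun x hA hB => ?_
  rw [conjugateBy_apply, LinearPMap.add_apply, LinearPMap.add_apply, map_add]
  rfl

theorem dense_conjugateBy {σ σ' : ℂ →+* ℂ} [RingHomInvPair σ σ'] [RingHomInvPair σ' σ]
    (V : H ≃ₛₗᵢ[σ] H) {A : H →ₗ.[ℂ] H} (hA : Dense (A.domain : Set H)) :
    Dense ((conjugateBy V A).domain : Set H) :=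
  hA.preimage V.symm.toHomeomorph.isOpenMap

/-- The vectors `V u` with `u ∈ dom A` exhaust the new domain, and a unitary moves freely across the
inner product, so each adjoint domain is contained in the other. -/
theorem conjugateBy_adjoint [CompleteSpace H] (V : H ≃ₗᵢ[ℂ] H) {A : H →ₗ.[ℂ] H}
    (hA : Dense (A.domain : Set H)) :
    (conjugateBy V A).adjoint = conjugateBy V A.adjoint := by
  have hV := dense_conjugateBy V hA
  have hmem : ∀ u : A.domain, V u ∈ (conjugateBy V A).domain := fun u => by
    rw [mem_conjugateBy_domain, V.symm_apply_apply]; exact u.2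
  have happ : ∀ u : A.domain, conjugateBy V A ⟨V u, hmem u⟩ = V (A u) := fun u => by
    rw [conjugateBy_apply]; congr 2; exact Subtype.ext (V.symm_apply_apply _)
  refine le_antisymm ?_ ?_
  · have key : ∀ x : (conjugateBy V A).adjoint.domain, ∀ u : A.domain,
        ⟪V.symm ((conjugateBy V A).adjoint x), u⟫_ℂ = ⟪V.symm (x : H), A u⟫_ℂ := fun x u => by
      have h := LinearPMap.adjoint_isFormalAdjoint hV x ⟨V u, hmem u⟩
      rw [happ] at h
      have e : ∀ a b : H, ⟪V.symm a, b⟫_ℂ = ⟪a, V b⟫_ℂ := fun a b => by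
        rw [← V.inner_map_map, V.apply_symm_apply]
      rw [e, e]
      exact h
    refine ⟨fun x hx => ?_, fun x y hxy => ?_⟩
    · exact LinearPMap.mem_adjoint_domain_of_exists _ ⟨_, key ⟨x, hx⟩⟩
    · rw [conjugateBy_apply, LinearPMap.adjoint_apply_eq hA _ (x₀ := V.symm ((conjugateBy V A).adjoint x))]
      · rw [V.apply_symm_apply]
      · intro u
        rw [key x u]
        exact congrArg (fun a => ⟪V.symm a, A u⟫_ℂ) hxy
  · refine LinearPMap.IsFormalAdjoint.le_adjoint hV fun x y => ?_
    rw [conjugateBy_apply, conjugateBy_apply, ← V.symm.inner_map_map, V.symm_apply_apply,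
      ← V.symm.inner_map_map (x : H), V.symm_apply_apply]
    exact (LinearPMap.adjoint_isFormalAdjoint hA).symm ⟨_, x.2⟩ ⟨_, y.2⟩

end AbstractOperators

end

end ChiralModel

namespace ChiralModel

noncomputable section

/-! ### Tensor products of square integrable functions -/

section Tensor

variable {n : ℕ}

theorem measurePreserving_headTail (n : ℕ) :
    MeasurePreserving (fun β : Fin (n + 1) → ℝ => (β 0, fun i : Fin n => β i.succ))
      volume (volume.prod volume) :=
  volume_preserving_piFinSuccAbove (fun _ : Fin (n + 1) => ℝ) 0

theorem measurableEmbedding_headTail (n : ℕ) :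
    MeasurableEmbedding (fun β : Fin (n + 1) → ℝ => (β 0, fun i : Fin n => β i.succ)) :=
  (MeasurableEquiv.piFinSuccAbove (fun _ : Fin (n + 1) => ℝ) 0).measurableEmbedding

theorem quasiMeasurePreserving_head (n : ℕ) :
    Measure.QuasiMeasurePreserving (fun β : Fin (n + 1) → ℝ => β 0) volume volume :=
  Measure.quasiMeasurePreserving_fst.comp (measurePreserving_headTail n).quasiMeasurePreserving

theorem quasiMeasurePreserving_tail (n : ℕ) :
    Measure.QuasiMeasurePreserving (fun (β : Fin (n + 1) → ℝ) (i : Fin n) => β i.succ)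
      volume volume :=
  Measure.quasiMeasurePreserving_snd.comp (measurePreserving_headTail n).quasiMeasurePreserving

theorem tensor_ae (ψ : L2R) (Φ : L2 n) :
    tensor ψ Φ =ᵐ[volume] fun β => ψ (β 0) * Φ (fun i => β i.succ) :=
  MemLp.coeFn_toLp (memLp_tensor ψ Φ)

theorem tensor_add_left (ψ ψ' : L2R) (Φ : L2 n) :
    tensor (ψ + ψ') Φ = tensor ψ Φ + tensor ψ' Φ := by
  refine Lp.ext ?_
  filter_upwards [tensor_ae (ψ + ψ') Φ, tensor_ae ψ Φ, tensor_ae ψ' Φ,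
    Lp.coeFn_add (tensor ψ Φ) (tensor ψ' Φ),
    (quasiMeasurePreserving_head n).ae (Lp.coeFn_add ψ ψ')] with β h1 h2 h3 h4 h5
  rw [h1, h4, Pi.add_apply, h2, h3, h5, Pi.add_apply, add_mul]

theorem tensor_smul_left (c : ℂ) (ψ : L2R) (Φ : L2 n) :
    tensor (c • ψ) Φ = c • tensor ψ Φ := by
  refine Lp.ext ?_
  filter_upwards [tensor_ae (c • ψ) Φ, tensor_ae ψ Φ, Lp.coeFn_smul c (tensor ψ Φ),
    (quasiMeasurePreserving_head n).ae (Lp.coeFn_smul c ψ)] with β h1 h2 h3 h4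
  rw [h1, h3, Pi.smul_apply, h2, h4, Pi.smul_apply, smul_eq_mul, smul_eq_mul, mul_assoc]

theorem inner_tensor_tensor (ψ ψ' : L2R) (Φ Φ' : L2 n) :
    ⟪tensor ψ Φ, tensor ψ' Φ'⟫_ℂ = ⟪ψ, ψ'⟫_ℂ * ⟪Φ, Φ'⟫_ℂ := by
  rw [L2.inner_def, L2.inner_def, L2.inner_def, ← integral_prod_mul,
    ← (measurePreserving_headTail n).integral_comp (measurableEmbedding_headTail n)]
  refine integral_congr_ae ?_
  filter_upwards [tensor_ae ψ Φ, tensor_ae ψ' Φ'] with β h1 h2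
  rw [h1, h2]
  simp only [RCLike.inner_apply, map_mul]
  ring

theorem norm_tensor (ψ : L2R) (Φ : L2 n) : ‖tensor ψ Φ‖ = ‖ψ‖ * ‖Φ‖ := by
  have h := inner_tensor_tensor ψ ψ Φ Φ
  rw [inner_self_eq_norm_sq_to_K, inner_self_eq_norm_sq_to_K, inner_self_eq_norm_sq_to_K] at h
  have h2 : ‖tensor ψ Φ‖ ^ 2 = (‖ψ‖ * ‖Φ‖) ^ 2 := by
    rw [mul_pow]; exact_mod_cast h
  exact (pow_left_inj₀ (norm_nonneg _) (by positivity) two_ne_zero).1 h2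

/-- `Φ ↦ ψ ⊗ Φ` as a bounded operator. -/
def tensorL (n : ℕ) (ψ : L2R) : L2 n →L[ℂ] L2 (n + 1) :=
  (tensor ψ).mkContinuous ‖ψ‖ fun Φ => (norm_tensor ψ Φ).le

@[simp]
theorem tensorL_apply (ψ : L2R) (Φ : L2 n) : tensorL n ψ Φ = tensor ψ Φ := rfl

end Tensor

variable (S : ScatteringFunction)

/-! ### Creation and annihilation between neighbouring particle numbers -/

/-- `Φ ↦ √(n+1) Pₙ₊₁ (ψ ⊗ Φ)` on the `n`-particle space. -/
def creationLevel (ψ : L2R) (n : ℕ) : nParticle S n →L[ℂ] nParticle S (n + 1) :=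
  ((Real.sqrt (n + 1) : ℝ) : ℂ) •
    ((nParticle S (n + 1)).orthogonalProjectionOnto ∘L tensorL n ψ ∘L (nParticle S n).subtypeL)

theorem creationLevel_apply (ψ : L2R) (n : ℕ) (Φ : nParticle S n) :
    creationLevel S ψ n Φ = ((Real.sqrt (n + 1) : ℝ) : ℂ) •
      (nParticle S (n + 1)).orthogonalProjectionOnto (tensor ψ (Φ : L2 n)) := rfl

/-- The adjoint of the creation operator with the conjugate function. -/
def annihilationLevel (ψ : L2R) (n : ℕ) : nParticle S (n + 1) →L[ℂ] nParticle S n :=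
  ContinuousLinearMap.adjoint (creationLevel S (star ψ) n)

theorem creationLevel_add (ψ ψ' : L2R) (n : ℕ) :
    creationLevel S (ψ + ψ') n = creationLevel S ψ n + creationLevel S ψ' n := by
  ext1 Φ
  simp [creationLevel_apply, tensor_add_left, smul_add]

theorem creationLevel_smul (c : ℂ) (ψ : L2R) (n : ℕ) :
    creationLevel S (c • ψ) n = c • creationLevel S ψ n := by
  ext1 Φ
  rw [smul_apply, creationLevel_apply, creationLevel_apply, tensor_smul_left,
    map_smul, smul_comm]

theorem norm_creationLevel_le (ψ : L2R) (n : ℕ) (Φ : nParticle S n) :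
    ‖creationLevel S ψ n Φ‖ ≤ Real.sqrt (n + 1) * ‖ψ‖ * ‖Φ‖ := by
  rw [creationLevel_apply, norm_smul, Complex.norm_real, Real.norm_of_nonneg (Real.sqrt_nonneg _),
    mul_assoc]
  refine mul_le_mul_of_nonneg_left ?_ (Real.sqrt_nonneg _)
  refine ((nParticle S (n + 1)).orthogonalProjectionOnto.le_of_opNorm_le
    (Submodule.orthogonalProjectionOnto_norm_le _) _).trans ?_
  rw [one_mul, norm_tensor]
  rfl

theorem star_add_L2R (ψ ψ' : L2R) : star (ψ + ψ') = star ψ + star ψ' := by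
  refine Lp.ext ?_
  filter_upwards [Lp.coeFn_star (ψ + ψ'), Lp.coeFn_add ψ ψ', Lp.coeFn_star ψ, Lp.coeFn_star ψ',
    Lp.coeFn_add (star ψ) (star ψ')] with β h1 h2 h3 h4 h5
  rw [h1, h5, Pi.star_apply, h2, Pi.add_apply, Pi.add_apply, h3, h4, Pi.star_apply, Pi.star_apply,
    star_add]

theorem star_smul_L2R (c : ℂ) (ψ : L2R) : star (c • ψ) = conj c • star ψ := by
  refine Lp.ext ?_
  filter_upwards [Lp.coeFn_star (c • ψ), Lp.coeFn_smul c ψ, Lp.coeFn_star ψ,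
    Lp.coeFn_smul (conj c) (star ψ)] with β h1 h2 h3 h4
  rw [h1, h4, Pi.star_apply, h2, Pi.smul_apply, Pi.smul_apply, h3, Pi.star_apply]
  simp

theorem norm_star_L2R (ψ : L2R) : ‖star ψ‖ = ‖ψ‖ := by
  rw [Lp.norm_def, Lp.norm_def]
  refine congrArg _ (eLpNorm_congr_norm_ae ?_)
  filter_upwards [Lp.coeFn_star ψ] with β h
  rw [h, Pi.star_apply, norm_star]

theorem annihilationLevel_add (ψ ψ' : L2R) (n : ℕ) :
    annihilationLevel S (ψ + ψ') n = annihilationLevel S ψ n + annihilationLevel S ψ' n := by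
  rw [annihilationLevel, star_add_L2R, creationLevel_add, map_add]; rfl

theorem annihilationLevel_smul (c : ℂ) (ψ : L2R) (n : ℕ) :
    annihilationLevel S (c • ψ) n = c • annihilationLevel S ψ n := by
  rw [annihilationLevel, star_smul_L2R, creationLevel_smul, map_smulₛₗ, Complex.conj_conj]; rfl

theorem norm_annihilationLevel_le (ψ : L2R) (n : ℕ) (Φ : nParticle S (n + 1)) :
    ‖annihilationLevel S ψ n Φ‖ ≤ Real.sqrt (n + 1) * ‖ψ‖ * ‖Φ‖ := by
  refine (annihilationLevel S ψ n).le_of_opNorm_le ?_ Φ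
  rw [annihilationLevel, LinearIsometryEquiv.norm_map]
  refine ContinuousLinearMap.opNorm_le_bound _ (by positivity) fun Φ => ?_
  have := norm_creationLevel_le S (star ψ) n Φ
  rwa [norm_star_L2R] at this

theorem inner_creationLevel_left (ψ : L2R) (n : ℕ) (Φ : nParticle S n) (Ψ : nParticle S (n + 1)) :
    ⟪creationLevel S ψ n Φ, Ψ⟫_ℂ = ⟪Φ, annihilationLevel S (star ψ) n Ψ⟫_ℂ := by
  rw [annihilationLevel, star_star, ContinuousLinearMap.adjoint_inner_right]

theorem inner_annihilationLevel_left (ψ : L2R) (n : ℕ) (Φ : nParticle S n)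
    (Ψ : nParticle S (n + 1)) :
    ⟪annihilationLevel S ψ n Ψ, Φ⟫_ℂ = ⟪Ψ, creationLevel S (star ψ) n Φ⟫_ℂ := by
  rw [annihilationLevel, ContinuousLinearMap.adjoint_inner_left]

/-! ### Creation and annihilation on the vectors of bounded particle number -/

/-- The vector of `𝒟` with given components. -/
def finiteParticleMk (x : ∀ n, nParticle S n) (hx : ∃ N : ℕ, ∀ n, N ≤ n → x n = 0) :
    finiteParticle S :=
  ⟨⟨x, by
    obtain ⟨N, hN⟩ := hx
    refine (memℓp_zero ((Set.finite_Iio N).subset fun n hn => ?_)).of_exponent_ge zero_le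
    by_contra h
    exact hn (hN n (not_lt.1 h))⟩, hx⟩

@[simp]
theorem finiteParticleMk_apply (x : ∀ n, nParticle S n) (hx : ∃ N : ℕ, ∀ n, N ≤ n → x n = 0)
    (n : ℕ) : (finiteParticleMk S x hx : Fock S) n = x n := rfl

theorem finiteParticle_ext {x y : finiteParticle S} (h : ∀ n, (x : Fock S) n = (y : Fock S) n) :
    x = y :=
  Subtype.ext (lp.ext (funext h))

/-- `y†(ψ)` as an endomorphism of `𝒟`. -/
def creationEnd (ψ : L2R) : Module.End ℂ (finiteParticle S) where
  toFun Φ := ⟨creation S ψ Φ, by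
    obtain ⟨N, hN⟩ := Φ.2
    refine ⟨N + 1, fun n hn => ?_⟩
    obtain ⟨m, rfl⟩ : ∃ m, n = m + 1 := ⟨n - 1, by omega⟩
    change creationLevel S ψ m ((Φ : Fock S) m) = 0
    rw [hN m (by omega), map_zero]⟩
  map_add' Φ Φ' := Subtype.ext ((creation S ψ).map_add Φ Φ')
  map_smul' c Φ := Subtype.ext ((creation S ψ).map_smul c Φ)

@[simp]
theorem creationEnd_apply_zero (ψ : L2R) (Φ : finiteParticle S) :
    (creationEnd S ψ Φ : Fock S) 0 = 0 := rfl

@[simp]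
theorem creationEnd_apply_succ (ψ : L2R) (Φ : finiteParticle S) (n : ℕ) :
    (creationEnd S ψ Φ : Fock S) (n + 1) = creationLevel S ψ n ((Φ : Fock S) n) := rfl

theorem coe_creationEnd (ψ : L2R) (Φ : finiteParticle S) :
    (creationEnd S ψ Φ : Fock S) = creation S ψ Φ := rfl

/-- `y(ψ)` as an endomorphism of `𝒟`. -/
def annihilationEnd (ψ : L2R) : Module.End ℂ (finiteParticle S) where
  toFun Φ := finiteParticleMk S (fun n => annihilationLevel S ψ n ((Φ : Fock S) (n + 1))) (by
    obtain ⟨N, hN⟩ := Φ.2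
    exact ⟨N, fun n hn => by rw [hN (n + 1) (by omega), map_zero]⟩)
  map_add' Φ Φ' := finiteParticle_ext S fun n => by
    simp
  map_smul' c Φ := finiteParticle_ext S fun n => by
    simp

@[simp]
theorem annihilationEnd_apply (ψ : L2R) (Φ : finiteParticle S) (n : ℕ) :
    (annihilationEnd S ψ Φ : Fock S) n = annihilationLevel S ψ n ((Φ : Fock S) (n + 1)) := rfl

theorem inner_creation_left (ψ : L2R) (Φ Ψ : finiteParticle S) :
    ⟪(creationEnd S ψ Φ : Fock S), (Ψ : Fock S)⟫_ℂ =
      ⟪(Φ : Fock S), (annihilationEnd S (star ψ) Ψ : Fock S)⟫_ℂ := by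
  have h := lp.summable_inner (𝕜 := ℂ) (creationEnd S ψ Φ : Fock S) (Ψ : Fock S)
  rw [lp.inner_eq_tsum, lp.inner_eq_tsum, h.tsum_eq_zero_add, creationEnd_apply_zero,
    inner_zero_left, zero_add]
  exact tsum_congr fun n => inner_creationLevel_left S ψ n _ _

theorem inner_annihilation_left (ψ : L2R) (Φ Ψ : finiteParticle S) :
    ⟪(annihilationEnd S ψ Φ : Fock S), (Ψ : Fock S)⟫_ℂ =
      ⟪(Φ : Fock S), (creationEnd S (star ψ) Ψ : Fock S)⟫_ℂ := by
  rw [← inner_conj_symm, ← inner_conj_symm (Φ : Fock S), inner_creation_left, star_star]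

/-- `annihilationEnd` is a formal adjoint of the creation operator on the dense domain `𝒟`;
uniqueness of the adjoint identifies the levelwise operator with the Hilbert space one. -/
theorem annihilation_eq (ψ : L2R) (Φ : finiteParticle S) :
    ∃ h : (Φ : Fock S) ∈ (annihilation S ψ).domain,
      annihilation S ψ ⟨Φ, h⟩ = annihilationEnd S ψ Φ := by
  have key : ∀ x : (creation S (star ψ)).domain,
      ⟪(annihilationEnd S ψ Φ : Fock S), x⟫_ℂ = ⟪(Φ : Fock S), creation S (star ψ) x⟫_ℂ := by
    intro x
    have h : ∀ y : finiteParticle S, creation S (star ψ) y = creationEnd S (star ψ) y :=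
      fun y => (coe_creationEnd S (star ψ) y).symm
    have h2 := inner_annihilation_left S ψ Φ x
    rwa [← h x] at h2
  have h : (Φ : Fock S) ∈ (annihilation S ψ).domain :=
    LinearPMap.mem_adjoint_domain_of_exists _ ⟨_, key⟩
  exact ⟨h, LinearPMap.adjoint_apply_eq (dense_finiteParticle S) ⟨_, h⟩ key⟩

/-- `φ(f)` as an endomorphism of `𝒟`. -/
def fieldEnd (f : 𝓢(ℝ, ℂ)) : Module.End ℂ (finiteParticle S) :=
  creationEnd S (hatPlus f) + annihilationEnd S (hatMinus f)

theorem fieldEnd_apply (f : 𝓢(ℝ, ℂ)) (Φ : finiteParticle S) :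
    fieldEnd S f Φ = creationEnd S (hatPlus f) Φ + annihilationEnd S (hatMinus f) Φ := rfl

/-- The creation part has domain exactly `𝒟` and the annihilation part is defined there, so the
intersection is `𝒟` and statements about the unbounded field become statements about `fieldEnd`. -/
theorem field_domain (f : 𝓢(ℝ, ℂ)) : (field S f).domain = finiteParticle S :=
  inf_eq_left.2 fun Φ hΦ => (annihilation_eq S (hatMinus f) ⟨Φ, hΦ⟩).choose

theorem field_apply (f : 𝓢(ℝ, ℂ)) (Φ : finiteParticle S) (h : (Φ : Fock S) ∈ (field S f).domain) :
    field S f ⟨Φ, h⟩ = fieldEnd S f Φ := by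
  obtain ⟨h1, h2⟩ := annihilation_eq S (hatMinus f) Φ
  rw [fieldEnd_apply, Submodule.coe_add, ← h2]
  rfl

/-! ### Norm estimates -/

theorem norm_sq_eq_tsum (Φ : Fock S) : ‖Φ‖ ^ 2 = ∑' n, ‖Φ n‖ ^ 2 := by
  have := lp.norm_rpow_eq_tsum (p := 2) (by norm_num) Φ
  simpa using this

theorem summable_norm_sq (Φ : Fock S) : Summable fun n => ‖Φ n‖ ^ 2 := by
  have := (lp.memℓp Φ).summable (by norm_num)
  simpa using this

/-- The highest occupied level is at most `N - 1`, where the factor `√(n+1)` is at most `√N`. -/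
theorem norm_creationEnd_le (ψ : L2R) {Φ : finiteParticle S} {N : ℕ}
    (hN : ∀ n, N ≤ n → (Φ : Fock S) n = 0) :
    ‖(creationEnd S ψ Φ : Fock S)‖ ≤ Real.sqrt N * ‖ψ‖ * ‖(Φ : Fock S)‖ := by
  refine le_of_sq_le_sq ?_ (by positivity)
  rw [norm_sq_eq_tsum, (summable_norm_sq S _).tsum_eq_zero_add, mul_pow, norm_sq_eq_tsum,
    ← tsum_mul_left]
  simp only [creationEnd_apply_zero, norm_zero, ne_eq, two_ne_zero, not_false_eq_true, zero_pow,
    zero_add, creationEnd_apply_succ]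
  have hs : Summable fun n => ‖creationLevel S ψ n ((Φ : Fock S) n)‖ ^ 2 :=
    (summable_norm_sq S (creationEnd S ψ Φ : Fock S)).comp_injective (add_left_injective 1)
  refine Summable.tsum_le_tsum (fun n => ?_) hs ((summable_norm_sq S (Φ : Fock S)).mul_left _)
  rw [← mul_pow]
  gcongr
  rcases lt_or_ge n N with h | h
  · refine (norm_creationLevel_le S ψ n _).trans ?_
    gcongr
    exact_mod_cast h
  · rw [hN n h]; simp

theorem norm_annihilationEnd_le (ψ : L2R) {Φ : finiteParticle S} {N : ℕ}
    (hN : ∀ n, N ≤ n → (Φ : Fock S) n = 0) :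
    ‖(annihilationEnd S ψ Φ : Fock S)‖ ≤ Real.sqrt N * ‖ψ‖ * ‖(Φ : Fock S)‖ := by
  refine le_of_sq_le_sq ?_ (by positivity)
  rw [norm_sq_eq_tsum, mul_pow, norm_sq_eq_tsum S (Φ : Fock S),
    (summable_norm_sq S (Φ : Fock S)).tsum_eq_zero_add]
  -- The vacuum component does not contribute to the left side; leaving it out only lowers the right
  -- side.
  refine le_trans ?_ (mul_le_mul_of_nonneg_left (le_add_of_nonneg_left (sq_nonneg _))
    (sq_nonneg _))
  rw [← tsum_mul_left]
  have hs : Summable fun n => ‖(Φ : Fock S) (n + 1)‖ ^ 2 :=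
    (summable_norm_sq S (Φ : Fock S)).comp_injective (add_left_injective 1)
  refine Summable.tsum_le_tsum (fun n => ?_)
    (summable_norm_sq S (annihilationEnd S ψ Φ : Fock S)) (hs.mul_left _)
  rw [← mul_pow]
  gcongr
  rcases lt_or_ge (n + 1) N with h | h
  · refine (norm_annihilationLevel_le S ψ n _).trans ?_
    gcongr
    exact_mod_cast h.le
  · simp [hN (n + 1) h]

end

end ChiralModel

namespace ChiralModel

noncomputable section

/-! ### Continuity of the one-particle vectors in the test function -/

theorem tilde_add (f g : 𝓢(ℝ, ℂ)) (p : ℝ) : tilde (f + g) p = tilde f p + tilde g p := by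
  rw [tilde_eq, tilde_eq, tilde_eq, FourierTransform.fourier_add, add_apply, mul_add]

theorem tilde_smul (c : ℂ) (f : 𝓢(ℝ, ℂ)) (p : ℝ) : tilde (c • f) p = c * tilde f p := by
  rw [tilde_eq, tilde_eq, FourierTransform.fourier_smul, smul_apply, smul_eq_mul]
  ring

theorem hatPlus_ae (f : 𝓢(ℝ, ℂ)) : hatPlus f =ᵐ[volume] hatPlusFun f :=
  MemLp.coeFn_toLp (memLp_hatPlusFun f)

theorem hatMinus_ae (f : 𝓢(ℝ, ℂ)) : hatMinus f =ᵐ[volume] hatMinusFun f :=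
  MemLp.coeFn_toLp (memLp_hatMinusFun f)

theorem hatPlus_add (f g : 𝓢(ℝ, ℂ)) : hatPlus (f + g) = hatPlus f + hatPlus g := by
  rw [hatPlus, hatPlus, hatPlus, ← MemLp.toLp_add]
  refine MemLp.toLp_congr _ _ (Eventually.of_forall fun β => ?_)
  simp only [hatPlusFun, Pi.add_apply, tilde_add, mul_add]

theorem hatPlus_smul (c : ℂ) (f : 𝓢(ℝ, ℂ)) : hatPlus (c • f) = c • hatPlus f := by
  rw [hatPlus, hatPlus, ← MemLp.toLp_const_smul]
  refine MemLp.toLp_congr _ _ (Eventually.of_forall fun β => ?_)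
  simp only [hatPlusFun, Pi.smul_apply, tilde_smul, smul_eq_mul]
  ring

theorem hatMinus_add (f g : 𝓢(ℝ, ℂ)) : hatMinus (f + g) = hatMinus f + hatMinus g := by
  rw [hatMinus, hatMinus, hatMinus, ← MemLp.toLp_add]
  refine MemLp.toLp_congr _ _ (Eventually.of_forall fun β => ?_)
  simp only [hatMinusFun, Pi.add_apply, tilde_add, mul_add]

theorem hatMinus_smul (c : ℂ) (f : 𝓢(ℝ, ℂ)) : hatMinus (c • f) = c • hatMinus f := by
  rw [hatMinus, hatMinus, ← MemLp.toLp_const_smul]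
  refine MemLp.toLp_congr _ _ (Eventually.of_forall fun β => ?_)
  simp only [hatMinusFun, Pi.smul_apply, tilde_smul, smul_eq_mul]
  ring

/-- Follows from `(1 + |β|) e^β ≤ 1 + e^{2β}`. It turns decay of order `p⁻²` in the momentum `p =
e^β` into integrability in the rapidity `β`, here and in the contour shift. -/
theorem one_add_sq_mul_exp_sq_le (β : ℝ) :
    (1 + β ^ 2) * Real.exp β ^ 2 ≤ (1 + Real.exp β ^ 2) ^ 2 := by
  set e := Real.exp β with he
  have he0 : 0 < e := Real.exp_pos β
  have h1 : (1 + |β|) * e ≤ 1 + e ^ 2 := by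
    rcases le_total 0 β with h0 | h0
    · rw [abs_of_nonneg h0]
      nlinarith [Real.add_one_le_exp β]
    · rw [abs_of_nonpos h0]
      have h2 : Real.exp (-β) * e = 1 := by rw [he, ← Real.exp_add]; simp
      nlinarith [Real.add_one_le_exp (-β)]
  calc (1 + β ^ 2) * e ^ 2 ≤ ((1 + |β|) * e) ^ 2 := by
        nlinarith [abs_nonneg β, sq_abs β, mul_nonneg (abs_nonneg β) (sq_nonneg e)]
    _ ≤ (1 + e ^ 2) ^ 2 := by gcongr

theorem memLp_exp_weight :
    MemLp (fun β : ℝ => Real.exp β / (1 + Real.exp β ^ 2)) 2 volume := by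
  have hcont : Continuous fun β : ℝ => Real.exp β / (1 + Real.exp β ^ 2) :=
    Real.continuous_exp.div (by fun_prop) fun β => by positivity
  rw [memLp_two_iff_integrable_sq_norm hcont.aestronglyMeasurable]
  refine integrable_inv_one_add_sq.mono' (hcont.norm.pow 2).aestronglyMeasurable
    (Eventually.of_forall fun β => ?_)
  rw [Real.norm_of_nonneg (by positivity), Real.norm_of_nonneg (by positivity), div_pow,
    ← one_div, div_le_div_iff₀ (by positivity) (by positivity)]
  linarith [one_add_sq_mul_exp_sq_le β]

/-- The seminorm of the Fourier transform that controls `f̃`. -/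
def decayConst (g : 𝓢(ℝ, ℂ)) : ℝ :=
  (1 + (2 * Real.pi) ^ 2) *
    (({(0, 0), (2, 0)} : Finset (ℕ × ℕ)).sup (schwartzSeminormFamily ℂ ℝ ℂ)) g

theorem norm_tilde_le (f : 𝓢(ℝ, ℂ)) (p : ℝ) :
    ‖tilde f p‖ ≤ decayConst (FourierTransform.fourier f) / (1 + p ^ 2) := by
  set g := FourierTransform.fourier f with hg
  set q := ({(0, 0), (2, 0)} : Finset (ℕ × ℕ)).sup (schwartzSeminormFamily ℂ ℝ ℂ) with hq
  have h0 := SchwartzMap.norm_pow_mul_le_seminorm ℂ g 0 (-p / (2 * Real.pi))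
  have h2 := SchwartzMap.norm_pow_mul_le_seminorm ℂ g 2 (-p / (2 * Real.pi))
  have hq0 : (SchwartzMap.seminorm ℂ 0 0) g ≤ q g :=
    Seminorm.le_def.1 (Finset.le_sup (f := schwartzSeminormFamily ℂ ℝ ℂ)
      (by simp : ((0, 0) : ℕ × ℕ) ∈ ({(0, 0), (2, 0)} : Finset (ℕ × ℕ)))) g
  have hq2 : (SchwartzMap.seminorm ℂ 2 0) g ≤ q g :=
    Seminorm.le_def.1 (Finset.le_sup (f := schwartzSeminormFamily ℂ ℝ ℂ)
      (by simp : ((2, 0) : ℕ × ℕ) ∈ ({(0, 0), (2, 0)} : Finset (ℕ × ℕ)))) g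
  simp only [pow_zero, one_mul, Real.norm_eq_abs, sq_abs] at h0 h2
  have hs : 1 ≤ Real.sqrt (2 * Real.pi) := by
    rw [Real.one_le_sqrt]; linarith [Real.pi_gt_three]
  have hc : ‖(1 / (Real.sqrt (2 * Real.pi) : ℂ))‖ ≤ 1 := by
    rw [norm_div, norm_one, Complex.norm_real, Real.norm_of_nonneg (by positivity),
      div_le_one (by positivity)]
    exact hs
  -- The Fourier transform is evaluated at `-p/(2π)`, so `p²` is `(2π)²` times the square of its
  -- argument.
  have h3 := mul_le_mul_of_nonneg_left h2 (sq_nonneg (2 * Real.pi))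
  rw [← mul_assoc, ← mul_pow, mul_div_cancel₀ _ (by positivity : (2 * Real.pi) ≠ 0), neg_sq] at h3
  rw [le_div_iff₀ (by positivity), tilde_eq, norm_mul, ← hg]
  set y := ‖g (-p / (2 * Real.pi))‖ with hy
  have hy0 : 0 ≤ y := norm_nonneg _
  have h4 : (1 + p ^ 2) * y ≤ (1 + (2 * Real.pi) ^ 2) * q g := by
    nlinarith [sq_nonneg (2 * Real.pi), mul_le_mul_of_nonneg_left hq2 (sq_nonneg (2 * Real.pi))]
  calc _ ≤ 1 * y * (1 + p ^ 2) := by gcongr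
    _ ≤ _ := by rw [decayConst]; linarith

/-- All dependence on `β` is absorbed by one weight `e^β / (1 + e^{2β})` in `L²`; `C` is its norm,
and `f` enters only through a seminorm. -/
theorem exists_norm_hat_le : ∃ C : ℝ, 0 ≤ C ∧ ∀ f : 𝓢(ℝ, ℂ),
    ‖hatPlus f‖ ≤ C * decayConst (FourierTransform.fourier f) ∧
    ‖hatMinus f‖ ≤ C * decayConst (FourierTransform.fourier f) := by
  refine ⟨‖memLp_exp_weight.toLp _‖, norm_nonneg _, fun f => ?_⟩
  rw [mul_comm]
  constructor
  · refine Lp.norm_le_mul_norm_of_ae_le_mul ?_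
    filter_upwards [hatPlus_ae f, memLp_exp_weight.coeFn_toLp] with β h1 h2
    rw [h1, h2, hatPlusFun, norm_mul, norm_mul, Complex.norm_I, one_mul, Complex.norm_real,
      Real.norm_of_nonneg (Real.exp_pos β).le, Real.norm_of_nonneg (by positivity)]
    calc _ ≤ Real.exp β * (decayConst (FourierTransform.fourier f) / (1 + Real.exp β ^ 2)) := by
          gcongr; exact norm_tilde_le f _
      _ = _ := by ring
  · refine Lp.norm_le_mul_norm_of_ae_le_mul ?_
    filter_upwards [hatMinus_ae f, memLp_exp_weight.coeFn_toLp] with β h1 h2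
    rw [h1, h2, hatMinusFun, norm_mul, norm_mul, norm_neg, Complex.norm_I, one_mul,
      Complex.norm_real, Real.norm_of_nonneg (Real.exp_pos β).le,
      Real.norm_of_nonneg (by positivity)]
    calc _ ≤ Real.exp β * (decayConst (FourierTransform.fourier f) / (1 + (-Real.exp β) ^ 2)) := by
          gcongr; exact norm_tilde_le f _
      _ = _ := by rw [neg_sq]; ring

/-- The bound is a Schwartz seminorm of the Fourier transform, so continuity is checked for `A`
composed with the inverse transform and then precomposed with the transform, itself continuous on
Schwartz space. -/
theorem exists_clm_of_decay {G : Type} [NormedAddCommGroup G] [NormedSpace ℂ G] (A : 𝓢(ℝ, ℂ) → G)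
    (hadd : ∀ f g, A (f + g) = A f + A g) (hsmul : ∀ (c : ℂ) f, A (c • f) = c • A f)
    (hb : ∃ C : ℝ, 0 ≤ C ∧ ∀ f, ‖A f‖ ≤ C * decayConst (FourierTransform.fourier f)) :
    ∃ T : 𝓢(ℝ, ℂ) →L[ℂ] G, ∀ f, T f = A f := by
  obtain ⟨C, hC, h⟩ := hb
  let B : 𝓢(ℝ, ℂ) →L[ℂ] G := SchwartzMap.mkCLMtoNormedSpace
    (fun g => A ((FourierTransform.fourierCLE ℂ 𝓢(ℝ, ℂ)).symm g))
    (fun f g => by rw [map_add, hadd]) (fun c f => by rw [map_smul, hsmul]; rfl)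
    ⟨_, C * (1 + (2 * Real.pi) ^ 2), by positivity, fun g => by
      have h' := h ((FourierTransform.fourierCLE ℂ 𝓢(ℝ, ℂ)).symm g)
      rw [← FourierTransform.fourierCLE_apply (R := ℂ), ContinuousLinearEquiv.apply_symm_apply,
        decayConst, ← mul_assoc] at h'
      exact h'⟩
  refine ⟨B.comp (FourierTransform.fourierCLE ℂ 𝓢(ℝ, ℂ) : 𝓢(ℝ, ℂ) →L[ℂ] 𝓢(ℝ, ℂ)), fun f => ?_⟩
  change A ((FourierTransform.fourierCLE ℂ 𝓢(ℝ, ℂ)).symm (FourierTransform.fourierCLE ℂ 𝓢(ℝ, ℂ) f)) = _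
  rw [ContinuousLinearEquiv.symm_apply_apply]

theorem tilde_conj (f : 𝓢(ℝ, ℂ)) (p : ℝ) :
    conj (tilde f p) = 1 / (Real.sqrt (2 * Real.pi) : ℂ) *
      ∫ ξ : ℝ, conj (f ξ) * Complex.exp (Complex.I * (-p : ℝ) * ξ) := by
  rw [tilde, map_mul, ← integral_conj, map_div₀, map_one, Complex.conj_ofReal]
  congr 2
  funext ξ
  rw [map_mul, ← Complex.exp_conj]
  congr 2
  simp

/-- For real `f`, complex conjugation sends `f̃(p)` to `f̃(-p)`. This is what makes the creation and
annihilation parts of `φ(f)` mutual adjoints. -/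
theorem star_hatPlus_of_real {f : 𝓢(ℝ, ℂ)} (hf : ∀ x, conj (f x) = f x) :
    star (hatPlus f) = hatMinus f := by
  refine Lp.ext ?_
  filter_upwards [Lp.coeFn_star (hatPlus f), hatPlus_ae f, hatMinus_ae f] with β h1 h2 h3
  rw [h1, h3, Pi.star_apply, h2, hatPlusFun, hatMinusFun, RCLike.star_def, map_mul, map_mul,
    Complex.conj_I, Complex.conj_ofReal, tilde_conj]
  simp_rw [hf]
  rfl

theorem star_hatMinus_of_real {f : 𝓢(ℝ, ℂ)} (hf : ∀ x, conj (f x) = f x) :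
    star (hatMinus f) = hatPlus f := by
  rw [← star_hatPlus_of_real hf, star_star]

/-! ### The field as an operator-valued distribution -/

variable (S : ScatteringFunction)

theorem fieldEnd_apply_zero (f : 𝓢(ℝ, ℂ)) (Φ : finiteParticle S) :
    (fieldEnd S f Φ : Fock S) 0 = annihilationLevel S (hatMinus f) 0 ((Φ : Fock S) 1) :=
  zero_add (annihilationLevel S (hatMinus f) 0 ((Φ : Fock S) 1))

theorem fieldEnd_apply_succ (f : 𝓢(ℝ, ℂ)) (Φ : finiteParticle S) (n : ℕ) :
    (fieldEnd S f Φ : Fock S) (n + 1) = creationLevel S (hatPlus f) n ((Φ : Fock S) n) +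
      annihilationLevel S (hatMinus f) (n + 1) ((Φ : Fock S) (n + 2)) := rfl

theorem fieldEnd_add (f g : 𝓢(ℝ, ℂ)) : fieldEnd S (f + g) = fieldEnd S f + fieldEnd S g := by
  refine LinearMap.ext fun Φ => finiteParticle_ext S fun n => ?_
  rcases n with _ | n
  · simp [fieldEnd, hatMinus_add, annihilationLevel_add]
  · simp [fieldEnd, hatPlus_add, hatMinus_add, annihilationLevel_add, creationLevel_add]
    abel

theorem fieldEnd_smul (c : ℂ) (f : 𝓢(ℝ, ℂ)) : fieldEnd S (c • f) = c • fieldEnd S f := by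
  refine LinearMap.ext fun Φ => finiteParticle_ext S fun n => ?_
  rcases n with _ | n
  · change _ = c • (fieldEnd S f Φ : Fock S) 0
    rw [fieldEnd_apply_zero, fieldEnd_apply_zero, hatMinus_smul, annihilationLevel_smul]
    rfl
  · change _ = c • (fieldEnd S f Φ : Fock S) (n + 1)
    rw [fieldEnd_apply_succ, fieldEnd_apply_succ, hatPlus_smul, hatMinus_smul,
      annihilationLevel_smul, creationLevel_smul, smul_add]
    rfl

theorem norm_fieldEnd_le (f : 𝓢(ℝ, ℂ)) {Φ : finiteParticle S} {N : ℕ}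
    (hN : ∀ n, N ≤ n → (Φ : Fock S) n = 0) :
    ‖(fieldEnd S f Φ : Fock S)‖ ≤
      Real.sqrt N * (‖hatPlus f‖ + ‖hatMinus f‖) * ‖(Φ : Fock S)‖ := by
  rw [fieldEnd_apply, Submodule.coe_add]
  refine (norm_add_le _ _).trans ?_
  have h1 := norm_creationEnd_le S (hatPlus f) hN
  have h2 := norm_annihilationEnd_le S (hatMinus f) hN
  linarith

theorem fieldEnd_apply_eq_zero (f : 𝓢(ℝ, ℂ)) {Φ : finiteParticle S} {N : ℕ}
    (hN : ∀ n, N ≤ n → (Φ : Fock S) n = 0) (n : ℕ) (hn : N + 1 ≤ n) :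
    (fieldEnd S f Φ : Fock S) n = 0 := by
  obtain ⟨m, rfl⟩ : ∃ m, n = m + 1 := ⟨n - 1, by omega⟩
  rw [fieldEnd_apply_succ, hN m (by omega), hN (m + 2) (by omega), map_zero, map_zero, add_zero]

theorem exists_fieldEnd_clm (Φ : finiteParticle S) :
    ∃ T : 𝓢(ℝ, ℂ) →L[ℂ] Fock S, ∀ f, T f = fieldEnd S f Φ := by
  refine exists_clm_of_decay _ (fun f g => by rw [fieldEnd_add]; rfl)
    (fun c f => by rw [fieldEnd_smul]; rfl) ?_
  obtain ⟨C, hC, h⟩ := exists_norm_hat_le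
  obtain ⟨N, hN⟩ := Φ.2
  refine ⟨Real.sqrt N * (C + C) * ‖(Φ : Fock S)‖, by positivity, fun f => ?_⟩
  refine (norm_fieldEnd_le S f hN).trans ?_
  calc _ ≤ Real.sqrt N * (C * decayConst (FourierTransform.fourier f) +
        C * decayConst (FourierTransform.fourier f)) * ‖(Φ : Fock S)‖ := by
        gcongr
        · exact (h f).1
        · exact (h f).2
    _ = _ := by ring

theorem field_isOperatorValuedTemperedDistribution :
    IsOperatorValuedTemperedDistribution (finiteParticle S) (field S) := by
  refine ⟨fun f => (field_domain S f).ge, fun f x hx => ?_, fun Ψ hΨ => ?_⟩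
  · have := field_apply S f ⟨x, hx⟩ x.2
    rw [show field S f x = _ from this]
    exact (fieldEnd S f ⟨x, hx⟩).2
  · obtain ⟨T, hT⟩ := exists_fieldEnd_clm S ⟨Ψ, hΨ⟩
    refine ⟨T, fun f x hx => ?_⟩
    subst hx
    rw [hT]
    exact field_apply S f ⟨x, hΨ⟩ x.2

/-! ### Entire analytic vectors -/

/-- Ratio test: consecutive terms have ratio at most `√(N+n) K|t| / (n+1)`, which tends to zero. -/
theorem summable_of_sqrt_growth {a : ℕ → ℝ} (ha : ∀ n, 0 ≤ a n) {K : ℝ} (N : ℕ)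
    (h : ∀ n, a (n + 1) ≤ Real.sqrt (N + n : ℕ) * K * a n) (t : ℝ) :
    Summable fun n : ℕ => a n * t ^ n / (n.factorial : ℝ) := by
  refine summable_of_ratio_norm_eventually_le (r := 1 / 2) (by norm_num) ?_
  -- The constant 8: for `n ≥ N` and `8 (K|t|)² ≤ n` one has `(N+n)(K|t|)² ≤ 2n · n/8 = (n/2)²`,
  -- which makes the ratio at most `1/2`.
  obtain ⟨M, hM⟩ := exists_nat_ge (8 * (K * |t|) ^ 2)
  filter_upwards [eventually_ge_atTop (max M N)] with n hn
  have hnM : (8 * (K * |t|) ^ 2 : ℝ) ≤ n := hM.trans (by exact_mod_cast (le_max_left _ _).trans hn)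
  have hnN : (N : ℝ) ≤ n := by exact_mod_cast (le_max_right _ _).trans hn
  have hsq : Real.sqrt (N + n : ℕ) * (K * |t|) ≤ (n + 1) / 2 := by
    refine le_of_sq_le_sq ?_ (by positivity)
    rw [mul_pow, Real.sq_sqrt (by positivity)]
    push_cast
    nlinarith [sq_nonneg (K * |t|)]
  simp only [norm_div, norm_mul, norm_pow, Real.norm_eq_abs, abs_of_nonneg (ha _), Nat.abs_cast,
    Nat.factorial_succ]
  push_cast
  rw [div_le_iff₀ (by positivity)]
  calc a (n + 1) * |t| ^ (n + 1) ≤ Real.sqrt (N + n : ℕ) * K * a n * |t| ^ (n + 1) := by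
        gcongr; exact h n
    _ = Real.sqrt (N + n : ℕ) * (K * |t|) * (a n * |t| ^ n) := by ring
    _ ≤ (n + 1) / 2 * (a n * |t| ^ n) := by
        have := mul_nonneg (ha n) (pow_nonneg (abs_nonneg t) n)
        gcongr
    _ = _ := by field_simp

theorem field_isEntireAnalyticVector (f : 𝓢(ℝ, ℂ)) {Ψ : Fock S} (hΨ : Ψ ∈ finiteParticle S) :
    IsEntireAnalyticVector (field S f) Ψ := by
  set v : ℕ → finiteParticle S := fun n => ((fieldEnd S f) ^ n) ⟨Ψ, hΨ⟩ with hv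
  have hsucc : ∀ n, v (n + 1) = fieldEnd S f (v n) := fun n => by
    simp only [hv, pow_succ']; rfl
  refine ⟨fun n => v n, rfl, fun n => ⟨(field_domain S f).ge (v n).2, ?_⟩, ?_⟩
  · change (v (n + 1) : Fock S) = _
    rw [hsucc]
    exact (field_apply S f (v n) _).symm
  · obtain ⟨N, hN⟩ := hΨ
    -- Each application of the field raises the particle bound by at most one, so the `n`-th vector
    -- occupies only levels below `N + n`.
    have hlev : ∀ n k, N + n ≤ k → (v n : Fock S) k = 0 := by
      intro n
      induction n with
      | zero => exact hN
      | succ n ih =>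
        intro k hk
        rw [hsucc]
        exact fieldEnd_apply_eq_zero S f ih k hk
    refine fun t => summable_of_sqrt_growth (fun n => norm_nonneg _)
      (K := ‖hatPlus f‖ + ‖hatMinus f‖) N (fun n => ?_) t
    change ‖(v (n + 1) : Fock S)‖ ≤ _
    rw [hsucc]
    exact norm_fieldEnd_le S f (hlev n)

/-! ### Essential self-adjointness -/

/-- If `a m > 0`, the partial sums stay above `a m`, so `a N + a (N+1)` is bounded below by a
multiple of `1/(N+1)` for `N ≥ m`, contradicting summability. -/
theorem eq_zero_of_partial_sums_le {a : ℕ → ℝ} (ha : ∀ n, 0 ≤ a n) (hs : Summable a) {C : ℝ}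
    (hC : 0 ≤ C)
    (h : ∀ N : ℕ, ∑ n ∈ Finset.range (N + 1), a n ≤ C * Real.sqrt (N + 1) * (a N + a (N + 1)))
    (m : ℕ) : a m = 0 := by
  by_contra hm
  have hpos : 0 < a m := lt_of_le_of_ne (ha m) (Ne.symm hm)
  have hsum : Summable fun N => C / a m * (a (N + m) + a (N + m + 1)) :=
    (((summable_nat_add_iff m).2 hs).add ((summable_nat_add_iff (m + 1)).2 hs)).mul_left _
  have hdiv : Summable fun N : ℕ => 1 / ((N + (m + 1) : ℕ) : ℝ) := by
    refine Summable.of_nonneg_of_le (fun N => by positivity) (fun N => ?_) hsum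
    have h1 : a m ≤ ∑ n ∈ Finset.range (N + m + 1), a n :=
      Finset.single_le_sum (f := a) (fun n _ => ha n) (Finset.mem_range.2 (by omega))
    have h2 := h1.trans (h (N + m))
    have h0 : (1 : ℝ) ≤ ((N + m : ℕ) : ℝ) + 1 := by
      have : (0 : ℝ) ≤ ((N + m : ℕ) : ℝ) := by positivity
      linarith
    -- Replacing the square root by `N + m + 1` is a loss that the divergence of the harmonic series
    -- still tolerates.
    have hsq : Real.sqrt (((N + m : ℕ) : ℝ) + 1) ≤ ((N + m : ℕ) : ℝ) + 1 := by
      rw [Real.sqrt_le_left (by linarith)]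
      nlinarith
    have hb : 0 ≤ a (N + m) + a (N + m + 1) := add_nonneg (ha _) (ha _)
    have h3 : a m ≤ C * (((N + m : ℕ) : ℝ) + 1) * (a (N + m) + a (N + m + 1)) :=
      h2.trans (by gcongr)
    have h4 : ((N + (m + 1) : ℕ) : ℝ) = ((N + m : ℕ) : ℝ) + 1 := by push_cast; ring
    rw [h4, div_mul_eq_mul_div, div_le_div_iff₀ (by linarith) hpos]
    linarith
  exact Real.not_summable_one_div_natCast ((summable_nat_add_iff (m + 1)).1 hdiv)

/-- The vector of `𝒟` with a single component. -/
def singleParticle (n : ℕ) (u : nParticle S n) : finiteParticle S :=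
  ⟨(lp.single (E := fun n => nParticle S n) 2 n u : Fock S), n + 1, fun k hk =>
    lp.single_apply_ne (E := fun n => nParticle S n) 2 n u (by omega : k ≠ n)⟩

theorem coe_singleParticle (n : ℕ) (u : nParticle S n) :
    (singleParticle S n u : Fock S) = lp.single (E := fun n => nParticle S n) 2 n u := rfl

theorem creationEnd_singleParticle (ψ : L2R) (n : ℕ) (u : nParticle S n) :
    creationEnd S ψ (singleParticle S n u) = singleParticle S (n + 1) (creationLevel S ψ n u) := by
  refine finiteParticle_ext S fun k => ?_
  rcases k with _ | k
  · rw [creationEnd_apply_zero, coe_singleParticle, lp.single_apply_ne _ _ _ (by omega)]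
  · rw [creationEnd_apply_succ, coe_singleParticle, coe_singleParticle]
    by_cases h : k = n
    · subst h; rw [lp.single_apply_self, lp.single_apply_self]
    · rw [lp.single_apply_ne _ _ _ h, lp.single_apply_ne _ _ _ (by omega), map_zero]

theorem annihilationEnd_singleParticle_zero (ψ : L2R) (u : nParticle S 0) :
    annihilationEnd S ψ (singleParticle S 0 u) = 0 := by
  refine finiteParticle_ext S fun k => ?_
  rw [annihilationEnd_apply, coe_singleParticle, lp.single_apply_ne _ _ _ (by omega), map_zero]
  rfl

theorem annihilationEnd_singleParticle_succ (ψ : L2R) (n : ℕ) (u : nParticle S (n + 1)) :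
    annihilationEnd S ψ (singleParticle S (n + 1) u) =
      singleParticle S n (annihilationLevel S ψ n u) := by
  refine finiteParticle_ext S fun k => ?_
  rw [annihilationEnd_apply, coe_singleParticle, coe_singleParticle]
  by_cases h : k = n
  · subst h; rw [lp.single_apply_self, lp.single_apply_self]
  · rw [lp.single_apply_ne _ _ _ h, lp.single_apply_ne _ _ _ (by omega), map_zero]

theorem inner_singleParticle_right (x : Fock S) (n : ℕ) (u : nParticle S n) :
    ⟪x, (singleParticle S n u : Fock S)⟫_ℂ = ⟪x n, u⟫_ℂ :=
  lp.inner_single_right (G := fun n => nParticle S n) n u x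

theorem field_isFormalAdjoint {f : 𝓢(ℝ, ℂ)} (hf : ∀ x, conj (f x) = f x) :
    (field S f).IsFormalAdjoint (field S f) := by
  rintro ⟨x, hx⟩ ⟨y, hy⟩
  have hx' := (field_domain S f).le hx
  have hy' := (field_domain S f).le hy
  have h1 := field_apply S f ⟨x, hx'⟩ hx
  have h2 := field_apply S f ⟨y, hy'⟩ hy
  rw [h1, h2, fieldEnd_apply, fieldEnd_apply, Submodule.coe_add, Submodule.coe_add,
    inner_add_left, inner_add_right, add_comm]
  have e1 := inner_creation_left S (hatPlus f) ⟨x, hx'⟩ ⟨y, hy'⟩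
  have e2 := inner_annihilation_left S (hatMinus f) ⟨x, hx'⟩ ⟨y, hy'⟩
  rw [star_hatPlus_of_real hf] at e1
  rw [star_hatMinus_of_real hf] at e2
  exact congrArg₂ _ e2 e1

/-- Let `E n` be the matrix element of the creation operator between the components `n` and `n+1` of
`x`. Testing with the single component `n+1` gives `E (n+1) + conj (E n) = ±i ‖x (n+1)‖²`, so the
imaginary parts telescope to partial sums of `‖x n‖²`, while Cauchy–Schwarz bounds `E N` by `√(N+1)
‖x N‖ ‖x (N+1)‖` up to a constant. -/
theorem field_deficiency {f : 𝓢(ℝ, ℂ)} (hf : ∀ x, conj (f x) = f x) {s : ℝ} (hs : s ^ 2 = 1)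
    {x : Fock S} (hx : ∀ y : finiteParticle S,
      ⟪x, (fieldEnd S f y : Fock S)⟫_ℂ = (s * Complex.I) * ⟪x, (y : Fock S)⟫_ℂ) : x = 0 := by
  set E : ℕ → ℂ := fun n => ⟪x (n + 1), creationLevel S (hatPlus f) n (x n)⟫_ℂ with hE
  have hself : ∀ n, ⟪x n, x n⟫_ℂ = ((‖x n‖ ^ 2 : ℝ) : ℂ) := fun n => by
    have := inner_self_eq_norm_sq_to_K (𝕜 := ℂ) (x n)
    push_cast
    exact this
  have h0 : E 0 = s * Complex.I * (‖x 0‖ ^ 2 : ℝ) := by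
    have h := hx (singleParticle S 0 (x 0))
    rw [fieldEnd_apply, creationEnd_singleParticle, annihilationEnd_singleParticle_zero, add_zero,
      inner_singleParticle_right, inner_singleParticle_right] at h
    exact h.trans (congrArg _ (hself 0))
  have hsucc : ∀ n, E (n + 1) + conj (E n) = s * Complex.I * (‖x (n + 1)‖ ^ 2 : ℝ) := by
    intro n
    have h := hx (singleParticle S (n + 1) (x (n + 1)))
    rw [fieldEnd_apply, creationEnd_singleParticle, annihilationEnd_singleParticle_succ,
      Submodule.coe_add, inner_add_right, inner_singleParticle_right, inner_singleParticle_right,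
      inner_singleParticle_right, ← star_hatPlus_of_real hf, ← inner_creationLevel_left] at h
    refine Eq.trans ?_ (h.trans (congrArg _ (hself (n + 1))))
    exact congrArg (E (n + 1) + ·) (inner_conj_symm (𝕜 := ℂ)
      (creationLevel S (hatPlus f) n (x n)) (x (n + 1)))
  -- Multiplication by `s` with `s² = 1` treats both signs at once.
  have him : ∀ N, s * (E N).im = ∑ n ∈ Finset.range (N + 1), ‖x n‖ ^ 2 := by
    intro N
    induction N with
    | zero =>
      have := congrArg Complex.im h0
      simp only [Complex.mul_im, Complex.mul_re, Complex.ofReal_re, Complex.ofReal_im,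
        Complex.I_re, Complex.I_im] at this
      rw [this, Finset.sum_range_one]
      linear_combination ‖x 0‖ ^ 2 * hs
    | succ N ih =>
      have := congrArg Complex.im (hsucc N)
      simp only [Complex.add_im, Complex.conj_im, Complex.mul_im, Complex.mul_re,
        Complex.ofReal_re, Complex.ofReal_im, Complex.I_re, Complex.I_im] at this
      rw [Finset.sum_range_succ, ← ih]
      linear_combination s * this + ‖x (N + 1)‖ ^ 2 * hs
  have hzero : ∀ m, ‖x m‖ ^ 2 = 0 := by
    refine eq_zero_of_partial_sums_le (a := fun m => ‖x m‖ ^ 2) (fun n => sq_nonneg _)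
      (summable_norm_sq S x)
      (norm_nonneg (hatPlus f)) fun N => ?_
    rw [← him N]
    have hs1 : |s| = 1 := by
      rwa [← sq_eq_sq₀ (abs_nonneg s) zero_le_one, sq_abs, one_pow]
    have h1 : s * (E N).im ≤ ‖E N‖ := by
      refine (le_abs_self _).trans ?_
      rw [abs_mul, hs1, one_mul]
      exact Complex.abs_im_le_norm _
    refine h1.trans ((norm_inner_le_norm (𝕜 := ℂ) (x (N + 1))
      (creationLevel S (hatPlus f) N (x N))).trans ?_)
    have h2 := norm_creationLevel_le S (hatPlus f) N (x N)
    have h3 : ‖x N‖ * ‖x (N + 1)‖ ≤ ‖x N‖ ^ 2 + ‖x (N + 1)‖ ^ 2 := by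
      nlinarith [sq_nonneg (‖x N‖ - ‖x (N + 1)‖), sq_nonneg ‖x N‖, sq_nonneg ‖x (N + 1)‖]
    calc ‖x (N + 1)‖ * ‖creationLevel S (hatPlus f) N (x N)‖
        ≤ ‖x (N + 1)‖ * (Real.sqrt (N + 1) * ‖hatPlus f‖ * ‖x N‖) := by gcongr
      _ = ‖hatPlus f‖ * Real.sqrt (N + 1) * (‖x N‖ * ‖x (N + 1)‖) := by ring
      _ ≤ _ := by gcongr
  refine lp.ext (funext fun m => ?_)
  have := hzero m
  simpa using this

theorem field_deficiency_indices {f : 𝓢(ℝ, ℂ)} (hf : ∀ x, conj (f x) = f x) (z : ℂ)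
    (hz : z = Complex.I ∨ z = -Complex.I) (x : Fock S)
    (hx : ∀ y : (field S f).domain, ⟪x, field S f y⟫_ℂ = z * ⟪x, y⟫_ℂ) : x = 0 := by
  have hx' : ∀ y : finiteParticle S,
      ⟪x, (fieldEnd S f y : Fock S)⟫_ℂ = z * ⟪x, (y : Fock S)⟫_ℂ := fun y => by
    rw [← field_apply S f y ((field_domain S f).ge y.2)]
    exact hx ⟨y, _⟩
  rcases hz with rfl | rfl
  · exact field_deficiency S hf (s := 1) (by norm_num) (by simpa using hx')
  · exact field_deficiency S hf (s := -1) (by norm_num) (by simpa using hx')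

theorem field_dense (f : 𝓢(ℝ, ℂ)) : Dense ((field S f).domain : Set (Fock S)) := by
  rw [field_domain]; exact dense_finiteParticle S

end

end ChiralModel

namespace ChiralModel

noncomputable section

variable (S : ScatteringFunction)

/-! ### The reflected field -/

theorem reflectionRep_symm_apply (x : Fock S) : (reflectionRep S).symm x = reflectionRep S x := rfl

theorem reflectionRep_reflectionRep (x : Fock S) : reflectionRep S (reflectionRep S x) = x :=
  reflectionIsometry_invol S x

theorem coe_reflectionRep_apply (x : Fock S) (n : ℕ) :
    ((reflectionRep S x n : nParticle S n) : L2 n) = reflectionL2 n (x n : L2 n) := rfl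

theorem reflectionRep_mem {x : Fock S} (hx : x ∈ finiteParticle S) :
    reflectionRep S x ∈ finiteParticle S := by
  obtain ⟨N, hN⟩ := hx
  refine ⟨N, fun n hn => Subtype.ext ?_⟩
  rw [coe_reflectionRep_apply, hN n hn]
  exact map_zero (reflectionL2 n)

theorem reflectionRep_mem_iff {x : Fock S} :
    reflectionRep S x ∈ finiteParticle S ↔ x ∈ finiteParticle S :=
  ⟨fun h => by
    have := reflectionRep_mem S h
    rwa [reflectionRep_reflectionRep] at this, reflectionRep_mem S⟩

/-- The reflection `U(j)` on `𝒟`. -/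
def reflectEnd : finiteParticle S →ₛₗ[starRingEnd ℂ] finiteParticle S where
  toFun x := ⟨reflectionRep S x, reflectionRep_mem S x.2⟩
  map_add' x y := Subtype.ext (map_add (reflectionRep S) (x : Fock S) y)
  map_smul' c x := Subtype.ext ((reflectionRep S).map_smulₛₗ c (x : Fock S))

theorem coe_reflectEnd (x : finiteParticle S) :
    (reflectEnd S x : Fock S) = reflectionRep S x := rfl

@[simp]
theorem reflectEnd_reflectEnd (x : finiteParticle S) : reflectEnd S (reflectEnd S x) = x :=
  Subtype.ext (reflectionRep_reflectionRep S x)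

/-- `U(j) T U(j)` for an operator `T` on `𝒟`. -/
def reflectConj (T : Module.End ℂ (finiteParticle S)) : Module.End ℂ (finiteParticle S) :=
  (reflectEnd S).comp (T.comp (reflectEnd S))

theorem reflectConj_apply (T : Module.End ℂ (finiteParticle S)) (x : finiteParticle S) :
    reflectConj S T x = reflectEnd S (T (reflectEnd S x)) := rfl

theorem reflectConj_add (T T' : Module.End ℂ (finiteParticle S)) :
    reflectConj S (T + T') = reflectConj S T + reflectConj S T' :=
  LinearMap.ext fun _ => map_add (reflectEnd S) _ _

theorem reflectedField_domain (f : 𝓢(ℝ, ℂ)) :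
    (reflectedField S f).domain = finiteParticle S := by
  refine Submodule.ext fun x => ?_
  rw [reflectedField, mem_conjugateBy_domain, field_domain, reflectionRep_symm_apply,
    reflectionRep_mem_iff]

theorem reflectedField_apply (f : 𝓢(ℝ, ℂ)) (Φ : finiteParticle S)
    (h : (Φ : Fock S) ∈ (reflectedField S f).domain) :
    reflectedField S f ⟨Φ, h⟩ = reflectConj S (fieldEnd S (reflectTest f)) Φ := by
  rw [reflectConj_apply, coe_reflectEnd,
    ← field_apply S (reflectTest f) (reflectEnd S Φ) ((field_domain S _).ge (reflectEnd S Φ).2)]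
  rfl

/-- The reflection of test functions as a continuous map. -/
theorem continuous_reflectTest : Continuous reflectTest :=
  (SchwartzMap.compCLMOfContinuousLinearEquiv ℝ (ContinuousLinearEquiv.neg ℝ)).continuous.comp
    (SchwartzMap.postcompCLM (Complex.conjCLE : ℂ →L[ℝ] ℂ)).continuous

theorem reflectTest_add (f g : 𝓢(ℝ, ℂ)) : reflectTest (f + g) = reflectTest f + reflectTest g := by
  ext x
  simp [reflectTest_apply]

theorem reflectTest_smul (c : ℂ) (f : 𝓢(ℝ, ℂ)) : reflectTest (c • f) = conj c • reflectTest f := by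
  ext x
  simp [reflectTest_apply]

theorem reflectTest_reflectTest (f : 𝓢(ℝ, ℂ)) : reflectTest (reflectTest f) = f := by
  ext x
  simp [reflectTest_apply]

theorem reflectedField_isOperatorValuedTemperedDistribution :
    IsOperatorValuedTemperedDistribution (finiteParticle S) (reflectedField S) := by
  refine ⟨fun f => (reflectedField_domain S f).ge, fun f x hx => ?_, fun Ψ hΨ => ?_⟩
  · have := reflectedField_apply S f ⟨x, hx⟩ x.2
    rw [show reflectedField S f x = _ from this]
    exact (reflectConj S (fieldEnd S (reflectTest f)) ⟨x, hx⟩).2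
  · obtain ⟨T, hT⟩ := exists_fieldEnd_clm S (reflectEnd S ⟨Ψ, hΨ⟩)
    refine ⟨{ toFun := fun f => reflectionRep S (T (reflectTest f))
              map_add' := fun f g => by rw [reflectTest_add, map_add, map_add]
              map_smul' := fun c f => by
                rw [reflectTest_smul, map_smul, (reflectionRep S).map_smulₛₗ, Complex.conj_conj]
                rfl
              cont := (reflectionRep S).continuous.comp
                (T.continuous.comp continuous_reflectTest) }, fun f x hx => ?_⟩
    subst hx
    change _ = reflectionRep S (T (reflectTest f))
    rw [hT]
    exact reflectedField_apply S f ⟨x, hΨ⟩ x.2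

theorem reflectTest_real {f : 𝓢(ℝ, ℂ)} (hf : ∀ x, conj (f x) = f x) (x : ℝ) :
    conj (reflectTest f x) = reflectTest f x := by
  rw [reflectTest_apply, hf, hf]

theorem field_isEssentiallySelfAdjoint {f : 𝓢(ℝ, ℂ)} (hf : ∀ x, conj (f x) = f x) :
    IsEssentiallySelfAdjoint (field S f) :=
  isEssentiallySelfAdjoint_of_deficiency (field_dense S f) (field_isFormalAdjoint S hf)
    (field_deficiency_indices S hf)

theorem reflectedField_isEssentiallySelfAdjoint {f : 𝓢(ℝ, ℂ)} (hf : ∀ x, conj (f x) = f x) :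
    IsEssentiallySelfAdjoint (reflectedField S f) := by
  have hf' := reflectTest_real hf
  have hJ : ∀ x y : Fock S, ⟪reflectionRep S x, y⟫_ℂ = ⟪(reflectionRep S).symm y, x⟫_ℂ :=
    fun x y => by
      rw [← antiunitary_inner (reflectionRep S) x, LinearIsometryEquiv.apply_symm_apply]
  have hJ' : ∀ x y : Fock S, ⟪y, reflectionRep S x⟫_ℂ = ⟪x, (reflectionRep S).symm y⟫_ℂ :=
    fun x y => by
      rw [← antiunitary_inner (reflectionRep S) _ x, LinearIsometryEquiv.apply_symm_apply]
  refine isEssentiallySelfAdjoint_of_deficiency (dense_conjugateBy _ (field_dense S _)) ?_ ?_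
  · intro x y
    change ⟪reflectionRep S (field S (reflectTest f) ⟨_, x.2⟩), (y : Fock S)⟫_ℂ =
      ⟪(x : Fock S), reflectionRep S (field S (reflectTest f) ⟨_, y.2⟩)⟫_ℂ
    rw [hJ, hJ']
    exact (field_isFormalAdjoint S hf' ⟨_, y.2⟩ ⟨_, x.2⟩).symm
  · intro z hz x hx
    have h0 : reflectionRep S x = 0 := by
      -- Antiunitarity conjugates the deficiency equation and so interchanges the cases `i` and
      -- `-i`.
      refine field_deficiency_indices S hf' (conj z) ?_ _ fun y => ?_
      · rcases hz with rfl | rfl <;> simp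
      · have hy : reflectionRep S y ∈ (reflectedField S f).domain := by
          rw [reflectedField, mem_conjugateBy_domain, LinearIsometryEquiv.symm_apply_apply]
          exact y.2
        have h := hx ⟨_, hy⟩
        have hval : reflectedField S f ⟨_, hy⟩ =
            reflectionRep S (field S (reflectTest f) y) := by
          change reflectionRep S (field S (reflectTest f) ⟨_, hy⟩) = _
          congr 2
          exact Subtype.ext (LinearIsometryEquiv.symm_apply_apply _ _)
        rw [hval, hJ', hJ'] at h
        have h2 := congrArg conj h
        rw [map_mul, inner_conj_symm, inner_conj_symm] at h2
        exact h2
    exact (map_eq_zero_iff _ (reflectionRep S).injective).1 h0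

theorem reflectedField_isEntireAnalyticVector (f : 𝓢(ℝ, ℂ)) {Ψ : Fock S}
    (hΨ : Ψ ∈ finiteParticle S) : IsEntireAnalyticVector (reflectedField S f) Ψ := by
  obtain ⟨v, h0, h1, h2⟩ := field_isEntireAnalyticVector S (reflectTest f) (reflectionRep_mem S hΨ)
  refine ⟨fun n => reflectionRep S (v n), ?_, fun n => ?_, fun t => ?_⟩
  · simp only [h0, reflectionRep_reflectionRep]
  · obtain ⟨h, h'⟩ := h1 n
    have hd : reflectionRep S (v n) ∈ (reflectedField S f).domain := by
      rw [reflectedField_domain, reflectionRep_mem_iff, ← field_domain S (reflectTest f)]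
      exact h
    refine ⟨hd, ?_⟩
    simp only [h']
    change _ = reflectionRep S (field S (reflectTest f) ⟨_, hd⟩)
    congr 2
    exact Subtype.ext (LinearIsometryEquiv.symm_apply_apply _ _).symm
  · simpa only [LinearIsometryEquiv.norm_map] using h2 t

/-! ### Covariance -/

theorem projection_eq_of_inner {n : ℕ} {X : L2 n} {Y : nParticle S n}
    (h : ∀ Z : nParticle S n, ⟪(Z : L2 n), (Y : L2 n)⟫_ℂ = ⟪(Z : L2 n), X⟫_ℂ) :
    (nParticle S n).orthogonalProjectionOnto X = Y := by
  refine ext_inner_left ℂ fun Z => ?_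
  rw [Submodule.inner_orthogonalProjectionOnto_eq_of_mem_left]
  exact (h Z).symm

theorem memLp_affineOne (ξ t : ℝ) (ψ : L2R) :
    MemLp (fun β => Complex.exp (Complex.I * ((ξ * Real.exp β : ℝ) : ℂ)) * ψ (β + t)) 2
      volume := by
  have h := (Lp.memLp ψ).comp_measurePreserving (measurePreserving_add_right volume t)
  refine h.of_le ((Continuous.aestronglyMeasurable (by fun_prop)).mul h.1)
    (Eventually.of_forall fun β => ?_)
  rw [norm_mul, mul_comm Complex.I, Complex.norm_exp_ofReal_mul_I, one_mul]
  rfl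

/-- The action of `U(ξ,t)` on the single particle space. -/
def affineOne (ξ t : ℝ) (ψ : L2R) : L2R := (memLp_affineOne ξ t ψ).toLp _

theorem affineOne_ae (ξ t : ℝ) (ψ : L2R) : affineOne ξ t ψ =ᵐ[volume]
    fun β => Complex.exp (Complex.I * ((ξ * Real.exp β : ℝ) : ℂ)) * ψ (β + t) :=
  MemLp.coeFn_toLp (memLp_affineOne ξ t ψ)

theorem affineL2_ae (n : ℕ) (ξ t : ℝ) (Ψ : L2 n) : affineL2 n ξ t Ψ =ᵐ[volume]
    fun β => Complex.exp (Complex.I * ((ξ * ∑ i, Real.exp (β i) : ℝ) : ℂ)) *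
      Ψ (fun i => β i + t) :=
  weighted_ae _ _ _ Ψ

theorem affineL2_tensor {n : ℕ} (ξ t : ℝ) (ψ : L2R) (Φ : L2 n) :
    affineL2 (n + 1) ξ t (tensor ψ Φ) = tensor (affineOne ξ t ψ) (affineL2 n ξ t Φ) := by
  refine Lp.ext ?_
  filter_upwards [affineL2_ae (n + 1) ξ t (tensor ψ Φ),
    (measurePreserving_shift (n := n + 1) t).quasiMeasurePreserving.ae (tensor_ae ψ Φ),
    tensor_ae (affineOne ξ t ψ) (affineL2 n ξ t Φ),
    (quasiMeasurePreserving_head n).ae (affineOne_ae ξ t ψ),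
    (quasiMeasurePreserving_tail n).ae (affineL2_ae n ξ t Φ)] with β h1 h2 h3 h4 h5
  rw [h1, h2, h3, h4, h5, Fin.sum_univ_succ, mul_add, Complex.ofReal_add, mul_add,
    Complex.exp_add]
  ring

/-- The affine action and its inverse both preserve the `S`-symmetric subspace, hence also its
orthogonal complement, so the action commutes with the projection. -/
theorem affineL2_projection {n : ℕ} (ξ t : ℝ) (X : L2 n) :
    (nParticle S n).orthogonalProjectionOnto (affineL2 n ξ t X) =
      ⟨affineL2 n ξ t ((nParticle S n).orthogonalProjectionOnto X),
        affineL2_mem S ξ t ((nParticle S n).orthogonalProjectionOnto X).2⟩ := by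
  refine projection_eq_of_inner S fun Z => ?_
  -- Every symmetric `Z` is the image of a symmetric vector, so the isometry can be stripped from
  -- both sides of the inner product.
  have hZ : affineL2 n ξ t (affineL2 n (-(Real.exp (-t) * ξ)) (-t) Z) = Z := by
    rw [affineL2_comp, mul_neg, ← mul_assoc, ← Real.exp_add, add_neg_cancel, Real.exp_zero,
      one_mul, add_neg_cancel, affineL2_zero]
  have h := Submodule.inner_orthogonalProjectionOnto_eq_of_mem_left (K := nParticle S n)
    ⟨_, affineL2_mem S (-(Real.exp (-t) * ξ)) (-t) Z.2⟩ X
  rw [← hZ, LinearIsometry.inner_map_map, LinearIsometry.inner_map_map]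
  exact h

theorem coe_affineRep_apply (ξ t : ℝ) (x : Fock S) (n : ℕ) :
    ((affineRep S ξ t x n : nParticle S n) : L2 n) = affineL2 n ξ t (x n : L2 n) := rfl

theorem affineRep_symm (ξ t : ℝ) (x : Fock S) :
    (affineRep S ξ t).symm x = affineRep S (-(Real.exp (-t) * ξ)) (-t) x := rfl

theorem affineRep_mem {ξ t : ℝ} {x : Fock S} (hx : x ∈ finiteParticle S) :
    affineRep S ξ t x ∈ finiteParticle S := by
  obtain ⟨N, hN⟩ := hx
  refine ⟨N, fun n hn => Subtype.ext ?_⟩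
  rw [coe_affineRep_apply, hN n hn]
  exact map_zero (affineL2 n ξ t)

theorem affineRep_symm_mem_iff {ξ t : ℝ} {x : Fock S} :
    (affineRep S ξ t).symm x ∈ finiteParticle S ↔ x ∈ finiteParticle S := by
  refine ⟨fun h => ?_, fun h => by rw [affineRep_symm]; exact affineRep_mem S h⟩
  have := affineRep_mem S (ξ := ξ) (t := t) h
  rwa [LinearIsometryEquiv.apply_symm_apply] at this

theorem affineRep_creationEnd (ξ t : ℝ) (ψ : L2R) (Φ : finiteParticle S) :
    affineRep S ξ t (creationEnd S ψ Φ) =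
      creationEnd S (affineOne ξ t ψ) ⟨affineRep S ξ t Φ, affineRep_mem S Φ.2⟩ := by
  refine lp.ext (funext fun n => Subtype.ext ?_)
  rw [coe_affineRep_apply]
  rcases n with _ | n
  · exact map_zero (affineL2 0 ξ t)
  · rw [creationEnd_apply_succ, creationEnd_apply_succ, creationLevel_apply, creationLevel_apply,
      Submodule.coe_smul, Submodule.coe_smul, map_smul]
    congr 1
    change _ = (((nParticle S (n + 1)).orthogonalProjectionOnto
      (tensor (affineOne ξ t ψ) (affineL2 n ξ t ((Φ : Fock S) n : L2 n))) :
        nParticle S (n + 1)) : L2 (n + 1))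
    rw [← affineL2_tensor, affineL2_projection]

theorem conjugateBy_affineRep_creation (ξ t : ℝ) (ψ : L2R) :
    conjugateBy (affineRep S ξ t) (creation S ψ) = creation S (affineOne ξ t ψ) := by
  refine linearPMap_ext_mk (fun x => affineRep_symm_mem_iff S) fun x hA hB => ?_
  have h := affineRep_creationEnd S ξ t ψ ⟨(affineRep S ξ t).symm x, hA⟩
  refine Eq.trans ?_ (h.trans ?_)
  · rfl
  · have : (⟨affineRep S ξ t ((affineRep S ξ t).symm x), affineRep_mem S hA⟩ :
        finiteParticle S) = ⟨x, hB⟩ := Subtype.ext (LinearIsometryEquiv.apply_symm_apply _ _)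
    rw [this]
    rfl

theorem tilde_affineTest (ξ t : ℝ) (f : 𝓢(ℝ, ℂ)) (p : ℝ) :
    tilde (affineTest ξ t f) p =
      Real.exp t * (Complex.exp (Complex.I * ((ξ * p : ℝ) : ℂ)) * tilde f (p * Real.exp t)) := by
  have h1 : ∫ x : ℝ, affineTest ξ t f x * Complex.exp (Complex.I * p * x) =
      ∫ x : ℝ, f (Real.exp (-t) * x) * Complex.exp (Complex.I * p * ((x + ξ : ℝ) : ℂ)) := by
    rw [← integral_add_right_eq_self (fun x : ℝ => affineTest ξ t f x *
      Complex.exp (Complex.I * p * x)) ξ]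
    simp only [affineTest_apply, add_sub_cancel_right]
  have h2 : ∫ x : ℝ, f (Real.exp (-t) * x) * Complex.exp (Complex.I * p * ((x + ξ : ℝ) : ℂ)) =
      Real.exp t * ∫ y : ℝ, f y * Complex.exp (Complex.I * p * ((Real.exp t * y + ξ : ℝ) : ℂ)) := by
    have h := Measure.integral_comp_mul_left (fun y : ℝ => f y *
      Complex.exp (Complex.I * p * ((Real.exp t * y + ξ : ℝ) : ℂ))) (Real.exp (-t))
    rw [Real.exp_neg, inv_inv, abs_of_pos (Real.exp_pos t), Complex.real_smul] at h
    rw [← h, Real.exp_neg]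
    congr 1
    funext x
    rw [mul_inv_cancel_left₀ (Real.exp_pos t).ne']
  rw [tilde, tilde, h1, h2, mul_left_comm, mul_left_comm (Complex.exp _),
    ← integral_const_mul (Complex.exp _)]
  congr 3
  funext y
  rw [mul_left_comm, ← Complex.exp_add]
  congr 2
  push_cast
  ring

/-- The Jacobian `e^t` of the dilation combines with the prefactor `e^β` to `e^{β+t}`, and the
translation produces the phase `e^{iξ e^β}`. -/
theorem affineOne_hatPlus (ξ t : ℝ) (f : 𝓢(ℝ, ℂ)) :
    affineOne ξ t (hatPlus f) = hatPlus (affineTest ξ t f) := by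
  refine Lp.ext ?_
  filter_upwards [affineOne_ae ξ t (hatPlus f), hatPlus_ae (affineTest ξ t f),
    (measurePreserving_add_right volume t).quasiMeasurePreserving.ae (hatPlus_ae f)]
    with β h1 h2 h3
  rw [h1, h2, h3, hatPlusFun, hatPlusFun, tilde_affineTest, Real.exp_add]
  push_cast
  ring

/-- The conjugates are those in `y(ψ) = y†(conj ψ)^*`: conjugating the phase at momentum `-e^β`
gives the same factor `e^{iξ e^β}` as at positive momentum. -/
theorem star_affineOne_star_hatMinus (ξ t : ℝ) (f : 𝓢(ℝ, ℂ)) :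
    affineOne ξ t (star (hatMinus f)) = star (hatMinus (affineTest ξ t f)) := by
  refine Lp.ext ?_
  filter_upwards [affineOne_ae ξ t (star (hatMinus f)), Lp.coeFn_star (hatMinus (affineTest ξ t f)),
    hatMinus_ae (affineTest ξ t f),
    (measurePreserving_add_right volume t).quasiMeasurePreserving.ae (hatMinus_ae f),
    (measurePreserving_add_right volume t).quasiMeasurePreserving.ae (Lp.coeFn_star (hatMinus f))]
    with β h1 h2 h3 h4 h5
  rw [h1, h2, h5, Pi.star_apply, Pi.star_apply, h3, h4, hatMinusFun, hatMinusFun, tilde_affineTest,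
    Real.exp_add]
  simp only [RCLike.star_def, map_mul, ← Complex.exp_conj, Complex.conj_ofReal, Complex.conj_I,
    map_neg, Complex.ofReal_mul, Complex.ofReal_neg, neg_mul]
  ring_nf

theorem field_covariant (ξ t : ℝ) (f : 𝓢(ℝ, ℂ)) :
    conjugateBy (affineRep S ξ t) (field S f) = field S (affineTest ξ t f) := by
  rw [field, conjugateBy_add, conjugateBy_affineRep_creation, affineOne_hatPlus, annihilation,
    ← conjugateBy_adjoint _ (dense_finiteParticle S), conjugateBy_affineRep_creation,
    star_affineOne_star_hatMinus]
  rfl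

theorem conjugateBy_conjugateBy_comm {H : Type} [NormedAddCommGroup H] [InnerProductSpace ℂ H]
    (U U' : H ≃ₗᵢ[ℂ] H) (J : H ≃ₛₗᵢ[starRingEnd ℂ] H) (h : ∀ x, U (J x) = J (U' x))
    (A : H →ₗ.[ℂ] H) :
    conjugateBy U (conjugateBy J A) = conjugateBy J (conjugateBy U' A) := by
  have hs : ∀ x, J.symm (U.symm x) = U'.symm (J.symm x) := fun x => by
    apply U'.injective
    apply J.injective
    rw [← h, LinearIsometryEquiv.apply_symm_apply, LinearIsometryEquiv.apply_symm_apply,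
      LinearIsometryEquiv.apply_symm_apply, LinearIsometryEquiv.apply_symm_apply]
  refine linearPMap_ext_mk (fun x => ?_) fun x hA hB => ?_
  · rw [mem_conjugateBy_domain, mem_conjugateBy_domain, mem_conjugateBy_domain,
      mem_conjugateBy_domain, hs]
  · rw [conjugateBy_apply, conjugateBy_apply, conjugateBy_apply, conjugateBy_apply, h]
    congr 3
    exact Subtype.ext (hs x)

/-- Antilinearity reverses the phase of a translation and leaves dilations alone, matching the
relation of `x ↦ -x` to affine maps. -/
theorem affineRep_reflectionRep (ξ t : ℝ) (x : Fock S) :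
    affineRep S ξ t (reflectionRep S x) = reflectionRep S (affineRep S (-ξ) t x) := by
  refine lp.ext (funext fun n => Subtype.ext ?_)
  rw [coe_affineRep_apply, coe_reflectionRep_apply, coe_reflectionRep_apply, coe_affineRep_apply]
  refine Lp.ext ?_
  filter_upwards [affineL2_ae n ξ t (reflectionL2 n (x n : L2 n)),
    (measurePreserving_shift (n := n) t).quasiMeasurePreserving.ae (reflectionL2_ae (x n : L2 n)),
    reflectionL2_ae (affineL2 n (-ξ) t (x n : L2 n)),
    (measurePreserving_perm (Fin.revPerm (n := n))).quasiMeasurePreserving.ae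
      (affineL2_ae n (-ξ) t (x n : L2 n))] with β h1 h2 h3 h4
  rw [h1, h2, h3, h4, map_mul, ← Complex.exp_conj,
    Equiv.sum_comp Fin.revPerm (fun i => Real.exp (β i))]
  rw [map_mul, Complex.conj_I, Complex.conj_ofReal]
  congr 2
  push_cast
  ring

theorem reflectTest_affineTest (ξ t : ℝ) (f : 𝓢(ℝ, ℂ)) :
    reflectTest (affineTest ξ t f) = affineTest (-ξ) t (reflectTest f) := by
  ext x
  rw [reflectTest_apply, affineTest_apply, affineTest_apply, reflectTest_apply]
  congr 2
  ring

theorem reflectedField_covariant (ξ t : ℝ) (f : 𝓢(ℝ, ℂ)) :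
    conjugateBy (affineRep S ξ t) (reflectedField S f) =
      reflectedField S (affineTest ξ t f) := by
  rw [reflectedField, conjugateBy_conjugateBy_comm _ (affineRep S (-ξ) t) _
    (affineRep_reflectionRep S ξ t), field_covariant, ← reflectTest_affineTest]
  rfl

end

end ChiralModel

namespace ChiralModel

noncomputable section

variable (S : ScatteringFunction)

/-! ### The transpositions -/

theorem transpositionAction_ae {n k : ℕ} (hk : k + 1 < n) (Ψ : L2 n) :
    transpositionAction S n k hk Ψ =ᵐ[volume] fun β =>
      S.toFun ((β ⟨k + 1, hk⟩ - β ⟨k, by omega⟩ : ℝ) : ℂ) *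
        Ψ (fun i => β (Equiv.swap ⟨k, by omega⟩ ⟨k + 1, hk⟩ i)) :=
  weighted_ae _ _ _ Ψ

theorem transpositionAction_transpositionAction_ae {n k l : ℕ} (hk : k + 1 < n) (hl : l + 1 < n)
    (Ψ : L2 n) :
    transpositionAction S n k hk (transpositionAction S n l hl Ψ) =ᵐ[volume] fun β =>
      S.toFun ((β ⟨k + 1, hk⟩ - β ⟨k, by omega⟩ : ℝ) : ℂ) *
        (S.toFun ((β (Equiv.swap ⟨k, by omega⟩ ⟨k + 1, hk⟩ ⟨l + 1, hl⟩) -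
          β (Equiv.swap ⟨k, by omega⟩ ⟨k + 1, hk⟩ ⟨l, by omega⟩) : ℝ) : ℂ) *
        Ψ (fun i => β (Equiv.swap ⟨k, by omega⟩ ⟨k + 1, hk⟩
          (Equiv.swap ⟨l, by omega⟩ ⟨l + 1, hl⟩ i)))) :=
  weighted_weighted_ae _ _ _ _ _ _ Ψ

theorem swap_val {n k : ℕ} (hk : k + 1 < n) (i : Fin n) :
    (Equiv.swap (⟨k, by omega⟩ : Fin n) ⟨k + 1, hk⟩ i : ℕ) =
      if (i : ℕ) = k then k + 1 else if (i : ℕ) = k + 1 then k else i := by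
  rw [Equiv.swap_apply_def]
  simp only [Fin.ext_iff]
  split_ifs <;> rfl

theorem swap_of_ne {n k : ℕ} (hk : k + 1 < n) {i : Fin n} (h1 : (i : ℕ) ≠ k)
    (h2 : (i : ℕ) ≠ k + 1) : Equiv.swap (⟨k, by omega⟩ : Fin n) ⟨k + 1, hk⟩ i = i :=
  Equiv.swap_apply_of_ne_of_ne (fun h => h1 (Fin.ext_iff.1 h)) (fun h => h2 (Fin.ext_iff.1 h))

/-- The two phase factors are `S(θ)` and `S(-θ) = S(θ)⁻¹`. -/
theorem transpositionAction_invol {n k : ℕ} (hk : k + 1 < n) (Ψ : L2 n) :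
    transpositionAction S n k hk (transpositionAction S n k hk Ψ) = Ψ := by
  refine Lp.ext ?_
  filter_upwards [transpositionAction_transpositionAction_ae S hk hk Ψ] with β h
  rw [h, Equiv.swap_apply_left, Equiv.swap_apply_right]
  simp only [Equiv.swap_apply_self]
  have h2 := S.conj_real (β ⟨k + 1, hk⟩ - β ⟨k, by omega⟩)
  rw [← Complex.ofReal_neg, neg_sub] at h2
  rw [← mul_assoc, ← h2, S.conj_eq_inv, mul_inv_cancel₀ (S.ne_zero _), one_mul]

theorem transpositionAction_comm {n k l : ℕ} (hkl : k + 2 ≤ l) (hl : l + 1 < n) (Ψ : L2 n) :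
    transpositionAction S n k (by omega) (transpositionAction S n l hl Ψ) =
      transpositionAction S n l hl (transpositionAction S n k (by omega) Ψ) := by
  have hk : k + 1 < n := by omega
  refine Lp.ext ?_
  filter_upwards [transpositionAction_transpositionAction_ae S hk hl Ψ,
    transpositionAction_transpositionAction_ae S hl hk Ψ] with β h1 h2
  rw [h1, h2, swap_of_ne hk (by simp; omega) (by simp; omega),
    swap_of_ne hk (by simp; omega) (by simp; omega),
    swap_of_ne hl (by simp; omega) (by simp; omega),
    swap_of_ne hl (by simp; omega) (by simp; omega), mul_left_comm]
  congr 4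
  funext i
  congr 1
  refine Fin.ext ?_
  simp only [swap_val]
  split_ifs <;> omega

theorem swap_braid {α : Type*} [DecidableEq α] {a b c : α} (hab : a ≠ b) (hac : a ≠ c)
    (hbc : b ≠ c) (i : α) :
    Equiv.swap a b (Equiv.swap b c (Equiv.swap a b i)) =
      Equiv.swap b c (Equiv.swap a b (Equiv.swap b c i)) := by
  have h1 := Equiv.swap_mul_swap_mul_swap (x := a) (y := b) (z := c) hab hac
  have h2 := Equiv.swap_mul_swap_mul_swap (x := c) (y := b) (z := a) hbc.symm hac.symm
  rw [Equiv.swap_comm b a, Equiv.swap_comm c b, Equiv.swap_comm a c, ← h1] at h2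
  exact Equiv.congr_fun h2 i

/-- Both sides carry the product of `S` over the three differences of the variables `k, k+1, k+2`.
As `S` is scalar, the order of the factors is immaterial and only the braid relation of the
permutations is needed. -/
theorem transpositionAction_braid {n k : ℕ} (hk : k + 1 + 1 < n) (Ψ : L2 n) :
    transpositionAction S n k (by omega) (transpositionAction S n (k + 1) hk
        (transpositionAction S n k (by omega) Ψ)) =
      transpositionAction S n (k + 1) hk (transpositionAction S n k (by omega)
        (transpositionAction S n (k + 1) hk Ψ)) := by
  have hk' : k + 1 < n := by omega
  have e1 : Equiv.swap (⟨k, by omega⟩ : Fin n) ⟨k + 1, hk'⟩ ⟨k + 1 + 1, hk⟩ = ⟨k + 1 + 1, hk⟩ :=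
    swap_of_ne hk' (by simp; omega) (by simp)
  have e2 : Equiv.swap (⟨k + 1, by omega⟩ : Fin n) ⟨k + 1 + 1, hk⟩ ⟨k, by omega⟩ =
      ⟨k, by omega⟩ := swap_of_ne hk (by simp) (by simp; omega)
  refine Lp.ext ?_
  filter_upwards [transpositionAction_ae S hk'
      (transpositionAction S n (k + 1) hk (transpositionAction S n k hk' Ψ)),
    (measurePreserving_perm (Equiv.swap (⟨k, by omega⟩ : Fin n)
      ⟨k + 1, hk'⟩)).quasiMeasurePreserving.ae
      (transpositionAction_transpositionAction_ae S hk hk' Ψ),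
    transpositionAction_ae S hk
      (transpositionAction S n k hk' (transpositionAction S n (k + 1) hk Ψ)),
    (measurePreserving_perm (Equiv.swap (⟨k + 1, by omega⟩ : Fin n)
      ⟨k + 1 + 1, hk⟩)).quasiMeasurePreserving.ae
      (transpositionAction_transpositionAction_ae S hk' hk Ψ)] with β h1 h2 h3 h4
  rw [h1, h2, h3, h4]
  simp only [Equiv.swap_apply_left, Equiv.swap_apply_right, e1, e2]
  have harg : (fun i => β (Equiv.swap (⟨k, by omega⟩ : Fin n) ⟨k + 1, hk'⟩
      (Equiv.swap (⟨k + 1, by omega⟩ : Fin n) ⟨k + 1 + 1, hk⟩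
        (Equiv.swap (⟨k, by omega⟩ : Fin n) ⟨k + 1, hk'⟩ i)))) =
      fun i => β (Equiv.swap (⟨k + 1, by omega⟩ : Fin n) ⟨k + 1 + 1, hk⟩
        (Equiv.swap (⟨k, by omega⟩ : Fin n) ⟨k + 1, hk'⟩
          (Equiv.swap (⟨k + 1, by omega⟩ : Fin n) ⟨k + 1 + 1, hk⟩ i))) := by
    funext i
    rw [swap_braid (by simp) (by simp; omega) (by simp)]
  rw [harg]
  ring

theorem inner_transpositionAction {n k : ℕ} (hk : k + 1 < n) (Φ Ψ : L2 n) :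
    ⟪transpositionAction S n k hk Φ, Ψ⟫_ℂ = ⟪Φ, transpositionAction S n k hk Ψ⟫_ℂ := by
  conv_lhs => rw [← transpositionAction_invol S hk Ψ]
  exact LinearIsometry.inner_map_map _ _ _

theorem transpositionAction_tensor {n k : ℕ} (hk : k + 1 < n) (ψ : L2R) (Φ : L2 n) :
    transpositionAction S (n + 1) (k + 1) (by omega) (tensor ψ Φ) =
      tensor ψ (transpositionAction S n k hk Φ) := by
  have hk' : k + 1 + 1 < n + 1 := by omega
  refine Lp.ext ?_
  filter_upwards [transpositionAction_ae S hk' (tensor ψ Φ),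
    (measurePreserving_perm (Equiv.swap (⟨k + 1, by omega⟩ : Fin (n + 1))
      ⟨k + 1 + 1, hk'⟩)).quasiMeasurePreserving.ae (tensor_ae ψ Φ),
    tensor_ae ψ (transpositionAction S n k hk Φ),
    (quasiMeasurePreserving_tail n).ae (transpositionAction_ae S hk Φ)] with β h1 h2 h3 h4
  rw [h1, h2, h3, h4, swap_of_ne hk' (by simp) (by simp), mul_left_comm]
  congr 3
  funext i
  congr 1
  refine Fin.ext ?_
  rw [swap_val hk', Fin.val_succ, Fin.val_succ, swap_val hk]
  split_ifs <;> omega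

/-- Tensoring with `ψ` on the left intertwines the transposition `k` with `k + 1`; transpositions
are self-adjoint, so the adjoint intertwines them back. -/
theorem adjoint_tensorL_mem {n : ℕ} (ψ : L2R) {Φ : L2 (n + 1)} (hΦ : Φ ∈ nParticle S (n + 1)) :
    ContinuousLinearMap.adjoint (tensorL n ψ) Φ ∈ nParticle S n := by
  rw [mem_nParticle] at hΦ ⊢
  intro k hk
  refine ext_inner_left ℂ fun v => ?_
  rw [← inner_transpositionAction, ContinuousLinearMap.adjoint_inner_right,
    ContinuousLinearMap.adjoint_inner_right, tensorL_apply, tensorL_apply,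
    ← transpositionAction_tensor, inner_transpositionAction, hΦ (k + 1) (by omega)]

theorem inner_creationLevel_right (ψ : L2R) (n : ℕ) (Φ : nParticle S (n + 1))
    (v : nParticle S n) : ⟪Φ, creationLevel S ψ n v⟫_ℂ =
      ((Real.sqrt (n + 1) : ℝ) : ℂ) * ⟪(Φ : L2 (n + 1)), tensor ψ (v : L2 n)⟫_ℂ := by
  change ⟪(Φ : L2 (n + 1)), ((Real.sqrt (n + 1) : ℝ) : ℂ) •
    (((nParticle S (n + 1)).orthogonalProjectionOnto (tensor ψ (v : L2 n)) :
      nParticle S (n + 1)) : L2 (n + 1))⟫_ℂ = _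
  rw [inner_smul_right]
  exact congrArg _ (Submodule.inner_orthogonalProjectionOnto_eq_of_mem_left Φ _)

/-- No projection appears: contracting the first variable of a symmetric vector already gives a
symmetric vector. -/
theorem coe_annihilationLevel (ψ : L2R) (n : ℕ) (Φ : nParticle S (n + 1)) :
    ((annihilationLevel S ψ n Φ : nParticle S n) : L2 n) =
      ((Real.sqrt (n + 1) : ℝ) : ℂ) •
        ContinuousLinearMap.adjoint (tensorL n (star ψ)) (Φ : L2 (n + 1)) := by
  have h : annihilationLevel S ψ n Φ = ((Real.sqrt (n + 1) : ℝ) : ℂ) •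
      (⟨_, adjoint_tensorL_mem S (star ψ) Φ.2⟩ : nParticle S n) := by
    refine ext_inner_right ℂ fun v => ?_
    rw [inner_annihilationLevel_left, inner_creationLevel_right]
    change _ = ⟪((Real.sqrt (n + 1) : ℝ) : ℂ) •
      ContinuousLinearMap.adjoint (tensorL n (star ψ)) (Φ : L2 (n + 1)), (v : L2 n)⟫_ℂ
    rw [inner_smul_left, Complex.conj_ofReal, ContinuousLinearMap.adjoint_inner_left,
      tensorL_apply]
  rw [h]
  rfl

end

end ChiralModel

namespace ChiralModel

noncomputable section

/-! ### Uniqueness for boundary values in the upper half plane -/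

/-- Used for `a = ±1, ±i`, when multiplication by `a` maps the square to itself and `si + aw` stays
in the upper half plane. -/
theorem diffContOnCl_comp_rotation {G : ℂ → ℂ} (hc : ContinuousOn G {z | 0 ≤ z.im})
    (hd : DifferentiableOn ℂ G {z | 0 < z.im}) {s : ℝ} (hs : 0 < s) {a : ℂ}
    (ha : ∀ w : ℂ, |w.re| ≤ s → |w.im| ≤ s → |(a * w).im| ≤ s)
    (ha' : ∀ w : ℂ, |w.re| < s → |w.im| < s → |(a * w).im| < s) :
    DiffContOnCl ℂ (fun w => G (s * Complex.I + a * w)) (Set.Ioo (-s) s ×ℂ Set.Ioo (-s) s) := by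
  constructor
  · refine hd.comp (by fun_prop) fun w hw => ?_
    have := ha' w (abs_lt.2 hw.1) (abs_lt.2 hw.2)
    have h2 := (abs_lt.1 this).1
    simp only [Set.mem_ofPred_eq, Complex.add_im, Complex.mul_im, Complex.ofReal_re, Complex.I_im,
      Complex.ofReal_im, Complex.I_re] at h2 ⊢
    linarith
  · rw [Complex.closure_reProdIm, closure_Ioo (by linarith : -s ≠ s)]
    refine hc.comp (by fun_prop) fun w hw => ?_
    have := ha w (abs_le.2 hw.1) (abs_le.2 hw.2)
    have h2 := (abs_le.1 this).1
    simp only [Set.mem_ofPred_eq, Complex.add_im, Complex.mul_im, Complex.ofReal_re, Complex.I_im,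
      Complex.ofReal_im, Complex.I_re] at h2 ⊢
    linarith

/-- A function continuous on the closed and analytic in the open upper half plane vanishes if it
vanishes on an interval of the real line. The product of the four copies of the function that are
rotated about the center of a square with one side in the interval vanishes on the boundary of the
square. -/
theorem eq_zero_of_eq_zero_on_interval {G : ℂ → ℂ} (hc : ContinuousOn G {z | 0 ≤ z.im})
    (hd : DifferentiableOn ℂ G {z | 0 < z.im}) {ε : ℝ} (hε : 0 < ε)
    (h0 : ∀ t : ℝ, |t| < ε → G t = 0) {z : ℂ} (hz : 0 ≤ z.im) : G z = 0 := by
  -- The square has center `si` and half side `s`; its lower side `[-s, s]` lies inside the interval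
  -- where `G` vanishes.
  set s := ε / 2 with hs
  have hs0 : 0 < s := by positivity
  have hopen : IsOpen {z : ℂ | 0 < z.im} := isOpen_lt continuous_const Complex.continuous_im
  have han : AnalyticOnNhd ℂ G {z | 0 < z.im} := hd.analyticOnNhd hopen
  set F : ℂ → ℂ → ℂ := fun a w => G (s * Complex.I + a * w) with hF
  set Q := Set.Ioo (-s) s ×ℂ Set.Ioo (-s) s with hQ
  have hF1 : DiffContOnCl ℂ (F 1) Q := diffContOnCl_comp_rotation hc hd hs0
    (fun w _ h => by simpa using h) (fun w _ h => by simpa using h)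
  have hF2 : DiffContOnCl ℂ (F (-1)) Q := diffContOnCl_comp_rotation hc hd hs0
    (fun w _ h => by simpa using h) (fun w _ h => by simpa using h)
  have hF3 : DiffContOnCl ℂ (F Complex.I) Q := diffContOnCl_comp_rotation hc hd hs0
    (fun w h _ => by simpa using h) (fun w h _ => by simpa using h)
  have hF4 : DiffContOnCl ℂ (F (-Complex.I)) Q := diffContOnCl_comp_rotation hc hd hs0
    (fun w h _ => by simpa using h) (fun w h _ => by simpa using h)
  have hzero : ∀ (a w : ℂ), (a * w).im = -s → |(a * w).re| ≤ s → F a w = 0 := by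
    intro a w h1 h2
    have : s * Complex.I + a * w = (((a * w).re : ℝ) : ℂ) := by
      apply Complex.ext
      · simp only [Complex.add_re, Complex.ofReal_re, Complex.mul_re s, Complex.I_re,
          Complex.ofReal_im, Complex.I_im]; ring
      · rw [Complex.add_im, h1, Complex.mul_im, Complex.ofReal_im]; simp
    rw [hF]
    simp only [this]
    exact h0 _ (by linarith)
  have hprod : Set.EqOn (fun w => F 1 w * F (-1) w * F Complex.I w * F (-Complex.I) w)
      (fun _ => 0) Q := by
    refine Complex.eqOn_of_eqOn_frontier
      ((Metric.isBounded_Ioo _ _).reProdIm (Metric.isBounded_Ioo _ _))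
      (((hF1.smul hF2).smul hF3).smul hF4) diffContOnCl_const fun w hw => ?_
    have hne : -s ≠ s := by linarith
    rw [hQ, Complex.frontier_reProdIm, closure_Ioo hne, frontier_Ioo (by linarith)] at hw
    change F 1 w * F (-1) w * F Complex.I w * F (-Complex.I) w = 0
    rcases hw with ⟨h1, h2 | h2⟩ | ⟨h1 | h1, h2⟩
    · have : F 1 w = 0 := hzero 1 w (by simpa using h2) (by simpa using abs_le.2 h1)
      simp [this]
    · have : F (-1) w = 0 := hzero (-1) w (by simpa using h2) (by simpa using abs_le.2 h1)
      simp [this]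
    · have : F Complex.I w = 0 :=
        hzero Complex.I w (by simpa using h1) (by simpa using abs_le.2 h2)
      simp [this]
    · have : F (-Complex.I) w = 0 :=
        hzero (-Complex.I) w (by simpa using h1) (by simpa using abs_le.2 h2)
      simp [this]
  have hcent : (0 : ℝ) < (s * Complex.I : ℂ).im := by simpa using hs0
  -- Otherwise `G` has no zeros in a punctured neighborhood of the center, and the same is true of
  -- the four rotated copies, contradicting that their product vanishes.
  have hloc : ∀ᶠ z in 𝓝 (s * Complex.I : ℂ), G z = 0 := by
    rcases (han _ hcent).eventually_eq_zero_or_eventually_ne_zero with h | h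
    · exact h
    · exfalso
      have hrot : ∀ a : ℂ, a ≠ 0 → ∀ᶠ w in 𝓝[≠] (0 : ℂ), F a w ≠ 0 := by
        intro a ha
        have ht : Tendsto (fun w : ℂ => s * Complex.I + a * w) (𝓝[≠] 0)
            (𝓝[≠] (s * Complex.I : ℂ)) := by
          refine tendsto_nhdsWithin_iff.2 ⟨?_, ?_⟩
          · have : Continuous fun w : ℂ => s * Complex.I + a * w := by fun_prop
            have h' := this.tendsto 0
            simp only [mul_zero, add_zero] at h'
            exact h'.mono_left nhdsWithin_le_nhds
          · filter_upwards [self_mem_nhdsWithin] with w hw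
            simpa [ha] using hw
        exact ht.eventually h
      have hQ0 : ∀ᶠ w in 𝓝[≠] (0 : ℂ), w ∈ Q := by
        refine nhdsWithin_le_nhds (IsOpen.mem_nhds (isOpen_Ioo.reProdIm isOpen_Ioo) ?_)
        change (0 : ℂ) ∈ Set.Ioo (-s) s ×ℂ Set.Ioo (-s) s
        rw [Complex.mem_reProdIm]
        simp [hs0]
      obtain ⟨w, hw1, hw2, hw3, hw4, hw5⟩ := ((hrot 1 one_ne_zero).and
        ((hrot (-1) (by simp)).and ((hrot Complex.I Complex.I_ne_zero).and
        ((hrot (-Complex.I) (by simp)).and hQ0)))).exists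
      exact mul_ne_zero (mul_ne_zero (mul_ne_zero hw1 hw2) hw3) hw4 (hprod hw5)
  have hup : Set.EqOn G 0 {z | 0 < z.im} :=
    han.eqOn_zero_of_preconnected_of_eventuallyEq_zero
      (convex_halfSpace_im_gt 0).isPreconnected hcent hloc
  have hcl : closure {z : ℂ | 0 < z.im} = {z | 0 ≤ z.im} := Complex.closure_setOfPred_lt_im 0
  have : Set.EqOn G 0 {z | 0 ≤ z.im} :=
    hup.of_subset_closure hc continuousOn_const (fun z hz => show 0 ≤ z.im from le_of_lt hz) hcl.ge
  exact this hz

/-! ### Density of the one-particle vectors -/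

section OneParticle

variable {k : ℝ → ℂ}

theorem norm_exp_I_mul_exp (z : ℂ) (β : ℝ) :
    ‖Complex.exp (Complex.I * z * Real.exp β)‖ = Real.exp (-(z.im * Real.exp β)) := by
  rw [Complex.norm_exp]
  congr 1
  rw [Complex.re_mul_ofReal, Complex.I_mul_re, neg_mul]

theorem continuousOn_halfPlane_integral (hk : Integrable k) :
    ContinuousOn (fun z : ℂ => ∫ β, k β * Complex.exp (Complex.I * z * Real.exp β))
      {z | 0 ≤ z.im} := by
  refine continuousOn_of_dominated (bound := fun β => ‖k β‖)
    (fun z _ => hk.1.mul (Continuous.aestronglyMeasurable (by fun_prop)))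
    (fun z hz => Eventually.of_forall fun β => ?_) hk.norm
    (Eventually.of_forall fun β => by fun_prop)
  rw [norm_mul, norm_exp_I_mul_exp]
  refine mul_le_of_le_one_right (norm_nonneg _) (Real.exp_le_one_iff.2 ?_)
  have := mul_nonneg hz (Real.exp_pos β).le
  linarith

/-- Differentiation brings down the unbounded factor `e^β`, but `e^β e^{-δ e^β} ≤ 1/δ` uniformly on
`Im z > δ`. -/
theorem differentiableOn_halfPlane_integral (hk : Integrable k) :
    DifferentiableOn ℂ (fun z : ℂ => ∫ β, k β * Complex.exp (Complex.I * z * Real.exp β))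
      {z | 0 < z.im} := by
  intro z₀ hz₀
  have hz₀' : 0 < z₀.im := hz₀
  set δ := z₀.im / 2 with hδ
  have hδ0 : 0 < δ := by positivity
  have hs : {z : ℂ | δ < z.im} ∈ 𝓝 z₀ :=
    (isOpen_lt continuous_const Complex.continuous_im).mem_nhds
      (show δ < z₀.im by rw [hδ]; linarith)
  have hle : ∀ z : ℂ, 0 ≤ z.im → ∀ β, ‖Complex.exp (Complex.I * z * Real.exp β)‖ ≤ 1 := by
    intro z hz β
    rw [norm_exp_I_mul_exp, Real.exp_le_one_iff]
    have := mul_nonneg hz (Real.exp_pos β).le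
    linarith
  have h := hasDerivAt_integral_of_dominated_loc_of_deriv_le (μ := volume) (𝕜 := ℂ)
    (F := fun (z : ℂ) β => k β * Complex.exp (Complex.I * z * Real.exp β))
    (F' := fun (z : ℂ) β => k β * (Complex.exp (Complex.I * z * Real.exp β) *
      (Complex.I * Real.exp β)))
    (bound := fun β => ‖k β‖ * (1 / δ)) hs
    (Eventually.of_forall fun z => hk.1.mul (Continuous.aestronglyMeasurable (by fun_prop)))
    (hk.mul_bdd (c := 1) (Continuous.aestronglyMeasurable (by fun_prop))
      (Eventually.of_forall (hle z₀ hz₀'.le)))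
    (hk.1.mul (Continuous.aestronglyMeasurable (by fun_prop)))
    (Eventually.of_forall fun β z hz => ?_) (hk.norm.mul_const _)
    (Eventually.of_forall fun β z hz => ?_)
  · exact h.2.differentiableAt.differentiableWithinAt
  · rw [norm_mul, norm_mul, norm_exp_I_mul_exp, norm_mul, Complex.norm_I, one_mul,
      Complex.norm_real, Real.norm_of_nonneg (Real.exp_pos β).le]
    refine mul_le_mul_of_nonneg_left ?_ (norm_nonneg _)
    have hz' : δ < z.im := hz
    have h1 : Real.exp (-(z.im * Real.exp β)) ≤ Real.exp (-(δ * Real.exp β)) :=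
      Real.exp_le_exp.2 (by nlinarith [Real.exp_pos β])
    have h2 : δ * Real.exp β ≤ Real.exp (δ * Real.exp β) := by
      linarith [Real.add_one_le_exp (δ * Real.exp β)]
    have h3 : Real.exp (-(δ * Real.exp β)) * Real.exp (δ * Real.exp β) = 1 := by
      rw [← Real.exp_add]; simp
    rw [le_div_iff₀ hδ0]
    calc Real.exp (-(z.im * Real.exp β)) * Real.exp β * δ
        ≤ Real.exp (-(δ * Real.exp β)) * Real.exp β * δ := by gcongr
      _ = Real.exp (-(δ * Real.exp β)) * (δ * Real.exp β) := by ring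
      _ ≤ Real.exp (-(δ * Real.exp β)) * Real.exp (δ * Real.exp β) := by gcongr
      _ = 1 := h3
  · have h1 : HasDerivAt (fun z : ℂ => Complex.I * z * Real.exp β) (Complex.I * Real.exp β) z := by
      simpa using ((hasDerivAt_id z).const_mul Complex.I).mul_const (Real.exp β : ℂ)
    exact (h1.cexp).const_mul (k β)

/-- Rewrites a bump function of `β` as a function of `p = e^β`. Compact support in `β` keeps `g ∘
log` away from `p = 0` and from infinity, so extension by zero to `p ≤ 0` is smooth. -/
theorem contDiff_comp_log {g : ℝ → ℝ} (hg : ContDiff ℝ (⊤ : ℕ∞) g) (hc : HasCompactSupport g) :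
    ∃ M > 0, ContDiff ℝ (⊤ : ℕ∞) (fun p : ℝ => if 0 < p then ((g (Real.log p) : ℝ) : ℂ) else 0) ∧
      ∀ p, M < |p| → (if 0 < p then ((g (Real.log p) : ℝ) : ℂ) else 0) = 0 := by
  obtain ⟨R, hR⟩ := hc.isCompact.isBounded.subset_closedBall 0
  have hz : ∀ x, R < |x| → g x = 0 := fun x hx => by
    by_contra h
    have := hR (subset_tsupport g h)
    rw [Metric.mem_closedBall, dist_zero_right, Real.norm_eq_abs] at this
    linarith
  refine ⟨Real.exp (max R 0 + 1), Real.exp_pos _, ?_, fun p hp => ?_⟩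
  · rw [contDiff_iff_contDiffAt]
    intro p
    rcases lt_or_ge 0 p with h | h
    · have h1 : ContDiffAt ℝ (⊤ : ℕ∞) (fun p : ℝ => ((g (Real.log p) : ℝ) : ℂ)) p :=
        Complex.ofRealCLM.contDiff.contDiffAt.comp p
          (hg.contDiffAt.comp p (Real.contDiffAt_log.2 h.ne'))
      refine h1.congr_of_eventuallyEq ?_
      filter_upwards [lt_mem_nhds h] with q hq
      simp [hq]
    · refine (contDiffAt_const (c := (0 : ℂ))).congr_of_eventuallyEq ?_
      filter_upwards [gt_mem_nhds (lt_of_le_of_lt h (Real.exp_pos (-(max R 0 + 1))))] with q hq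
      split_ifs with hq0
      · rw [hz, Complex.ofReal_zero]
        have hlog : Real.log q < -(max R 0 + 1) := (Real.log_lt_iff_lt_exp hq0).2 hq
        rw [abs_of_neg (by linarith [le_max_right R 0])]
        linarith [le_max_left R 0]
      · rfl
  · split_ifs with hp0
    · rw [abs_of_pos hp0] at hp
      rw [hz, Complex.ofReal_zero]
      have hlog : max R 0 + 1 < Real.log p := (Real.lt_log_iff_exp_lt hp0).2 hp
      rw [abs_of_pos (by linarith [le_max_right R 0])]
      linarith [le_max_left R 0]
    · rfl

/-- A bump `g(β)` equals `Θ(e^β)` with `Θ` the Fourier transform of a Schwartz function, so by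
Fubini `∫ g k` is a superposition of the vanishing integrals. -/
theorem ae_eq_zero_of_exponential_integrals (hk : Integrable k)
    (h : ∀ t : ℝ, ∫ β, k β * Complex.exp (Complex.I * t * Real.exp β) = 0) :
    ∀ᵐ β, k β = 0 := by
  refine ae_eq_zero_of_integral_contDiff_smul_eq_zero hk.locallyIntegrable fun g hg hc => ?_
  obtain ⟨M, -, hsm, hM⟩ := contDiff_comp_log hg hc
  set Θ : ℝ → ℂ := fun p : ℝ => if 0 < p then ((g (Real.log p) : ℝ) : ℂ) else 0 with hΘ
  have hcs : HasCompactSupport Θ :=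
    HasCompactSupport.intro (isCompact_closedBall (0 : ℝ) M) fun p hp => hM p (by
      rw [Metric.mem_closedBall, dist_zero_right, Real.norm_eq_abs, not_le] at hp
      exact hp)
  set θ : 𝓢(ℝ, ℂ) := hcs.toSchwartzMap hsm with hθ
  set u : 𝓢(ℝ, ℂ) := FourierTransformInv.fourierInv θ with hu
  have hval : ∀ β : ℝ, ((g β : ℝ) : ℂ) =
      ∫ x : ℝ, Complex.exp (Complex.I * ((-(2 * Real.pi * x) : ℝ) : ℂ) * Real.exp β) * u x := by
    intro β
    have h1 : FourierTransform.fourier u (Real.exp β) = Θ (Real.exp β) := by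
      rw [hu, FourierTransform.fourier_fourierInv_eq]
      rfl
    rw [SchwartzMap.fourier_coe, Real.fourier_real_eq_integral_exp_smul] at h1
    simp only [hΘ, Real.exp_pos, if_true, Real.log_exp] at h1
    rw [← h1]
    congr 1
    funext x
    rw [smul_eq_mul]
    congr 2
    push_cast
    ring
  have hint : Integrable (fun z : ℝ × ℝ => k z.1 *
      (Complex.exp (Complex.I * ((-(2 * Real.pi * z.2) : ℝ) : ℂ) * Real.exp z.1) * u z.2))
      (volume.prod volume) := by
    have h1 : Integrable (fun z : ℝ × ℝ => k z.1 * u z.2) (volume.prod volume) :=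
      hk.mul_prod u.integrable
    have h2 := h1.bdd_mul (c := 1) (f := fun z : ℝ × ℝ =>
      Complex.exp (Complex.I * ((-(2 * Real.pi * z.2) : ℝ) : ℂ) * Real.exp z.1))
      (Continuous.aestronglyMeasurable (by fun_prop)) (Eventually.of_forall fun z => by
        rw [norm_exp_I_mul_exp]; simp)
    refine h2.congr (Eventually.of_forall fun z => ?_)
    simp only
    ring
  calc ∫ β, g β • k β
      = ∫ β, ∫ x : ℝ, k β * (Complex.exp (Complex.I * ((-(2 * Real.pi * x) : ℝ) : ℂ) *
          Real.exp β) * u x) := by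
        congr 1
        funext β
        rw [integral_const_mul, ← hval, Complex.real_smul, mul_comm]
    _ = ∫ x : ℝ, ∫ β, k β * (Complex.exp (Complex.I * ((-(2 * Real.pi * x) : ℝ) : ℂ) *
          Real.exp β) * u x) := integral_integral_swap hint
    _ = ∫ x : ℝ, (0 : ℂ) := by
        congr 1
        funext x
        simp_rw [← mul_assoc]
        rw [integral_mul_const, h, zero_mul]
    _ = 0 := by simp

/-- The one-particle vectors of test functions supported in `I`. -/
theorem exists_testFunction (x₀ ε p : ℝ) (hε : 0 < ε) :
    ∃ f : 𝓢(ℝ, ℂ), tsupport f ⊆ Metric.closedBall x₀ ε ∧ tilde f p ≠ 0 := by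
  let b : ContDiffBump x₀ := ⟨ε / 2, ε, by positivity, by linarith⟩
  -- The modulation by `e^{-ipx}` makes `f̃(p)` a nonzero multiple of the integral of the bump,
  -- which is positive.
  have hsm : ContDiff ℝ (⊤ : ℕ∞) fun x : ℝ => (b x : ℂ) * Complex.exp (-(Complex.I * p * x)) := by
    have h1 : ContDiff ℝ (⊤ : ℕ∞) fun x : ℝ => ((b x : ℝ) : ℂ) :=
      Complex.ofRealCLM.contDiff.comp b.contDiff
    have h2 : ContDiff ℝ (⊤ : ℕ∞) fun x : ℝ => (x : ℂ) := Complex.ofRealCLM.contDiff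
    exact h1.mul (Complex.contDiff_exp.comp ((contDiff_const.mul h2).neg))
  have hsupp : Function.support (fun x : ℝ => (b x : ℂ) * Complex.exp (-(Complex.I * p * x))) ⊆
      Metric.closedBall x₀ ε := by
    intro x hx
    have : b x ≠ 0 := fun h => hx (by simp [h])
    have : x ∈ Function.support b := this
    rw [b.support_eq] at this
    exact Metric.ball_subset_closedBall this
  have hcs : HasCompactSupport fun x : ℝ => (b x : ℂ) * Complex.exp (-(Complex.I * p * x)) :=
    HasCompactSupport.of_support_subset_isCompact (isCompact_closedBall _ _) hsupp
  refine ⟨hcs.toSchwartzMap hsm, closure_minimal hsupp Metric.isClosed_closedBall, ?_⟩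
  have h1 : ∫ x : ℝ, (hcs.toSchwartzMap hsm) x * Complex.exp (Complex.I * p * x) =
      ((∫ x, b x : ℝ) : ℂ) := by
    rw [← integral_complex_ofReal]
    congr 1
    funext x
    change (b x : ℂ) * Complex.exp (-(Complex.I * p * x)) * Complex.exp (Complex.I * p * x) = _
    rw [mul_assoc, ← Complex.exp_add]
    simp
  rw [tilde, h1]
  refine mul_ne_zero (one_div_ne_zero ?_) ?_
  · exact_mod_cast (Real.sqrt_pos.2 (by positivity)).ne'
  · exact_mod_cast (b.integral_pos (μ := volume)).ne'

/-- Small translates of `f` remain supported in `I`, and `⟪h, ·⟫` of the translate by `t` is `∫ conj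
h · f̂⁺ · e^{it e^β}`. This extends to an analytic function of `t` in the upper half plane, so it
vanishes for all `t` once it vanishes near 0. Hence `conj h · f̂⁺ = 0` almost everywhere, for enough
`f` to conclude. -/
theorem ae_eq_zero_of_orthogonal {I : Set ℝ} (hI : IsOpen I) {h : L2R} {x₀ : ℝ} (hx₀ : x₀ ∈ I)
    (hh : ∀ f : 𝓢(ℝ, ℂ), tsupport f ⊆ closure I → ⟪h, hatPlus f⟫_ℂ = 0) : h = 0 := by
  obtain ⟨r, hr, hrI⟩ := Metric.isOpen_iff.1 hI x₀ hx₀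
  have key : ∀ f : 𝓢(ℝ, ℂ), tsupport f ⊆ Metric.closedBall x₀ (r / 2) →
      ∀ᵐ β, conj (h β) * hatPlusFun f β = 0 := by
    intro f hf
    have hk : Integrable fun β => conj (h β) * hatPlusFun f β := by
      have := L2.integrable_inner (𝕜 := ℂ) h (hatPlus f)
      refine this.congr ?_
      filter_upwards [hatPlus_ae f] with β hβ
      rw [hβ, RCLike.inner_apply, mul_comm]
    refine ae_eq_zero_of_exponential_integrals hk fun t => ?_
    have h0 : ∀ t : ℝ, |t| < r / 2 → ∫ β, conj (h β) * hatPlusFun f β *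
        Complex.exp (Complex.I * t * Real.exp β) = 0 := by
      intro t ht
      -- Support within `r/2` of `x₀` and a shift below `r/2` keep the translate within the ball of
      -- radius `r` in `I`.
      have hsupp : tsupport (affineTest t 0 f) ⊆ closure I := by
        refine closure_minimal (fun x hx => subset_closure (hrI ?_)) isClosed_closure
        have hx' : x - t ∈ tsupport f := by
          refine subset_tsupport _ fun h0 => hx ?_
          rw [affineTest_apply, neg_zero, Real.exp_zero, one_mul, h0]
        have := hf hx'
        rw [Metric.mem_closedBall, Real.dist_eq] at this
        rw [Metric.mem_ball, Real.dist_eq]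
        calc |x - x₀| = |(x - t - x₀) + t| := by ring_nf
          _ ≤ |x - t - x₀| + |t| := abs_add_le _ _
          _ < r := by linarith
      have h1 := hh _ hsupp
      rw [← affineOne_hatPlus, L2.inner_def] at h1
      rw [← h1]
      refine integral_congr_ae ?_
      filter_upwards [affineOne_ae t 0 (hatPlus f),
        (measurePreserving_add_right volume (0 : ℝ)).quasiMeasurePreserving.ae (hatPlus_ae f)]
        with β h2 h3
      rw [h2, h3, RCLike.inner_apply, add_zero]
      push_cast
      ring_nf
    have := eq_zero_of_eq_zero_on_interval (continuousOn_halfPlane_integral hk)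
      (differentiableOn_halfPlane_integral hk) (half_pos hr) h0 (z := (t : ℂ)) (by simp)
    exact this
  -- Local argument: near each `β₀` some admissible `f̂⁺` is continuous and nonzero, which forces `h
  -- = 0` almost everywhere there.
  have hnull : volume {β | h β ≠ 0} = 0 := by
    refine measure_null_of_locally_null _ fun β₀ _ => ?_
    obtain ⟨f, hf, hf0⟩ := exists_testFunction x₀ (r / 2) (Real.exp β₀) (by positivity)
    have hcont : Continuous (hatPlusFun f) := by
      have := continuous_tilde f
      unfold hatPlusFun
      fun_prop
    have hne : hatPlusFun f β₀ ≠ 0 :=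
      mul_ne_zero (mul_ne_zero Complex.I_ne_zero (by exact_mod_cast (Real.exp_pos β₀).ne')) hf0
    refine ⟨{β | h β ≠ 0} ∩ {β | hatPlusFun f β ≠ 0}, ?_, ?_⟩
    · exact inter_mem self_mem_nhdsWithin
        (nhdsWithin_le_nhds (hcont.continuousAt.eventually_ne hne))
    · refine measure_mono_null (fun β hβ => ?_) (key f hf)
      have h1 : conj (h β) ≠ 0 := (map_ne_zero _).2 hβ.1
      exact mul_ne_zero h1 hβ.2
  refine Lp.ext ?_
  have : ∀ᵐ β, h β = 0 := hnull
  filter_upwards [this, Lp.coeFn_zero ℂ 2 (volume : Measure ℝ)] with β h1 h2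
  rw [h1, h2]
  rfl

end OneParticle

end

end ChiralModel

namespace ChiralModel

noncomputable section

/-! ### Product vectors are total -/

/-- An integrable function on a product space vanishes almost everywhere if its integrals over
all measurable rectangles vanish. -/
theorem ae_eq_zero_of_forall_rectangle {X Y : Type*} [MeasurableSpace X] [MeasurableSpace Y]
    {μ : Measure (X × Y)} {F : X × Y → ℂ} (hF : Integrable F μ)
    (h : ∀ (A : Set X) (B : Set Y), MeasurableSet A → MeasurableSet B →
      ∫ z in A ×ˢ B, F z ∂μ = 0) : F =ᵐ[μ] 0 := by
  have hall : ∀ E : Set (X × Y), MeasurableSet E → ∫ z in E, F z ∂μ = 0 := by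
    refine MeasurableSpace.induction_on_inter generateFrom_prod.symm isPiSystem_prod ?_ ?_ ?_ ?_
    · simp
    · rintro t ⟨A, hA, B, hB, rfl⟩
      exact h A B hA hB
    · intro t ht ih
      have h1 := integral_add_compl ht hF
      have h2 := h Set.univ Set.univ MeasurableSet.univ MeasurableSet.univ
      rw [Set.univ_prod_univ, setIntegral_univ] at h2
      rw [ih, h2, zero_add] at h1
      exact h1
    · intro f hd hm ih
      rw [integral_iUnion hm hd hF.integrableOn]
      simp [ih]
  exact hF.ae_eq_zero_of_forall_setIntegral_eq_zero fun E hE _ => hall E hE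

/-- Indicator functions of rectangles of finite measure are product vectors, so all integrals of
`conj u` over such rectangles vanish. -/
theorem eq_zero_of_inner_tensor_eq_zero {n : ℕ} {u : L2 (n + 1)}
    (hu : ∀ (ψ : L2R) (v : L2 n), ⟪u, tensor ψ v⟫_ℂ = 0) : u = 0 := by
  have hmp := measurePreserving_headTail n
  set e := MeasurableEquiv.piFinSuccAbove (fun _ : Fin (n + 1) => ℝ) 0 with he
  have hmps : MeasurePreserving e.symm (volume.prod volume) volume :=
    (volume_preserving_piFinSuccAbove (fun _ : Fin (n + 1) => ℝ) 0).symm e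
  set F : ℝ × (Fin n → ℝ) → ℂ := fun z => conj (u (e.symm z)) with hF
  have hFL : MemLp F 2 (volume.prod volume) :=
    MemLp.star ((Lp.memLp u).comp_measurePreserving hmps)
  have hFe : ∀ β : Fin (n + 1) → ℝ, F (β 0, fun i => β i.succ) = conj (u β) := fun β => by
    change conj (u (e.symm (e β))) = _
    rw [e.symm_apply_apply]
  -- integrals over rectangles of finite measure
  have hrect : ∀ (A : Set ℝ) (B : Set (Fin n → ℝ)), MeasurableSet A → MeasurableSet B →
      volume A ≠ ∞ → volume B ≠ ∞ → ∫ z in A ×ˢ B, F z ∂(volume.prod volume) = 0 := by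
    intro A B hA hB hA' hB'
    have h1 := hu (indicatorConstLp 2 hA hA' 1) (indicatorConstLp 2 hB hB' 1)
    rw [← integral_indicator (hA.prod hB), ← hmp.integral_comp (measurableEmbedding_headTail n),
      ← h1, L2.inner_def]
    refine integral_congr_ae ?_
    filter_upwards [tensor_ae (indicatorConstLp 2 hA hA' (1 : ℂ)) (indicatorConstLp 2 hB hB' 1),
      (quasiMeasurePreserving_head n).ae
        (indicatorConstLp_coeFn (p := 2) (hs := hA) (hμs := hA') (c := (1 : ℂ))),
      (quasiMeasurePreserving_tail n).ae
        (indicatorConstLp_coeFn (p := 2) (hs := hB) (hμs := hB') (c := (1 : ℂ)))] with β h2 h3 h4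
    rw [h2, h3, h4, RCLike.inner_apply]
    by_cases hβA : β 0 ∈ A <;> by_cases hβB : (fun i : Fin n => β i.succ) ∈ B <;>
      simp [Set.indicator, hβA, hβB, hFe]
  -- A square integrable function need not be integrable, but it is on bounded boxes; these exhaust
  -- the space.
  have hball : ∀ N : ℕ, ∀ᵐ z ∂(volume.prod volume),
      z ∈ Metric.closedBall (0 : ℝ) N ×ˢ Metric.closedBall (0 : Fin n → ℝ) N → F z = 0 := by
    intro N
    set A₀ := Metric.closedBall (0 : ℝ) N
    set B₀ := Metric.closedBall (0 : Fin n → ℝ) N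
    have hA₀ : MeasurableSet A₀ := measurableSet_closedBall
    have hB₀ : MeasurableSet B₀ := measurableSet_closedBall
    have hA₀' : volume A₀ ≠ ∞ := measure_closedBall_lt_top.ne
    have hB₀' : volume B₀ ≠ ∞ := measure_closedBall_lt_top.ne
    have hfin : IsFiniteMeasure (((volume : Measure ℝ).prod
        (volume : Measure (Fin n → ℝ))).restrict (A₀ ×ˢ B₀)) := by
      refine ⟨?_⟩
      rw [Measure.restrict_apply_univ, Measure.prod_prod]
      exact ENNReal.mul_lt_top hA₀'.lt_top hB₀'.lt_top
    have hint : Integrable F ((volume.prod volume).restrict (A₀ ×ˢ B₀)) :=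
      (hFL.restrict _).integrable one_le_two
    have := ae_eq_zero_of_forall_rectangle hint fun A B hA hB => by
      rw [Measure.restrict_restrict (hA.prod hB), Set.prod_inter_prod]
      exact hrect _ _ (hA.inter hA₀) (hB.inter hB₀)
        (measure_ne_top_of_subset Set.inter_subset_right hA₀')
        (measure_ne_top_of_subset Set.inter_subset_right hB₀')
    exact (ae_restrict_iff' (hA₀.prod hB₀)).1 this
  have hae : ∀ᵐ z ∂(volume.prod volume), F z = 0 := by
    filter_upwards [ae_all_iff.2 hball] with z hz
    obtain ⟨N, hN⟩ := exists_nat_ge (max ‖z.1‖ ‖z.2‖)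
    refine hz N ⟨?_, ?_⟩
    · rw [Metric.mem_closedBall, dist_zero_right]; exact (le_max_left _ _).trans hN
    · rw [Metric.mem_closedBall, dist_zero_right]; exact (le_max_right _ _).trans hN
  refine Lp.ext ?_
  filter_upwards [hmp.quasiMeasurePreserving.ae hae,
    Lp.coeFn_zero ℂ 2 (volume : Measure (Fin (n + 1) → ℝ))] with β h1 h2
  rw [hFe] at h1
  rw [h2, (map_eq_zero _).1 h1]
  rfl

variable (S : ScatteringFunction)

/-! ### The Reeh-Schlieder property -/

/-- One-particle density first extends orthogonality from `f̂⁺ ⊗ v` to `ψ ⊗ v` for all `ψ` and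
symmetric `v`. Contracting `u` with `ψ` gives a symmetric vector, so `v` may then be arbitrary, and
product vectors are total. -/
theorem eq_zero_of_orthogonal_creationLevel {I : Set ℝ} (hI : IsOpen I) (hI' : I.Nonempty) {n : ℕ}
    {u : nParticle S (n + 1)}
    (hu : ∀ f : 𝓢(ℝ, ℂ), tsupport f ⊆ closure I → ∀ v : nParticle S n,
      ⟪u, creationLevel S (hatPlus f) n v⟫_ℂ = 0) : u = 0 := by
  obtain ⟨x₀, hx₀⟩ := hI'
  have hc : ((Real.sqrt (n + 1) : ℝ) : ℂ) ≠ 0 := by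
    exact_mod_cast (Real.sqrt_pos.2 (by positivity)).ne'
  have h1 : ∀ f : 𝓢(ℝ, ℂ), tsupport f ⊆ closure I → ∀ v : nParticle S n,
      ⟪(u : L2 (n + 1)), tensor (hatPlus f) (v : L2 n)⟫_ℂ = 0 := by
    intro f hf v
    have := hu f hf v
    rw [inner_creationLevel_right] at this
    exact (mul_eq_zero.1 this).resolve_left hc
  have h2 : ∀ (v : nParticle S n) (ψ : L2R), ⟪(u : L2 (n + 1)), tensor ψ (v : L2 n)⟫_ℂ = 0 := by
    intro v
    let T : L2R →ₗ[ℂ] L2 (n + 1) :=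
      { toFun := fun ψ => tensor ψ (v : L2 n)
        map_add' := fun ψ ψ' => tensor_add_left ψ ψ' _
        map_smul' := fun c ψ => tensor_smul_left c ψ _ }
    let T' : L2R →L[ℂ] L2 (n + 1) := T.mkContinuous ‖(v : L2 n)‖ fun ψ => by
      rw [mul_comm]; exact (norm_tensor ψ _).le
    have hT : ∀ ψ, T' ψ = tensor ψ (v : L2 n) := fun ψ => rfl
    have h3 : ContinuousLinearMap.adjoint T' (u : L2 (n + 1)) = 0 := by
      refine ae_eq_zero_of_orthogonal hI hx₀ fun f hf => ?_
      rw [ContinuousLinearMap.adjoint_inner_left, hT, h1 f hf v]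
    intro ψ
    rw [← hT, ← ContinuousLinearMap.adjoint_inner_left, h3, inner_zero_left]
  refine Subtype.ext (eq_zero_of_inner_tensor_eq_zero fun ψ v => ?_)
  -- The contraction is itself an admissible symmetric `v`, hence orthogonal to itself.
  have h4 : ContinuousLinearMap.adjoint (tensorL n ψ) (u : L2 (n + 1)) = 0 := by
    rw [← inner_self_eq_zero (𝕜 := ℂ), ContinuousLinearMap.adjoint_inner_left]
    exact h2 ⟨_, adjoint_tensorL_mem S ψ u.2⟩ ψ
  rw [← tensorL_apply, ← ContinuousLinearMap.adjoint_inner_left, h4, inner_zero_left]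

/-- The vectors with less than `N` particles. -/
def levelBelow (N : ℕ) : Submodule ℂ (Fock S) where
  carrier := {x | ∀ n, N ≤ n → x n = 0}
  zero_mem' := fun _ _ => rfl
  add_mem' := fun {x y} hx hy n hn => by
    change x n + y n = 0
    rw [hx n hn, hy n hn, add_zero]
  smul_mem' := fun c x hx n hn => by
    change c • x n = 0
    rw [hx n hn, smul_zero]

theorem levelBelow_le (N : ℕ) : levelBelow S N ≤ finiteParticle S := fun _ hx => ⟨N, hx⟩

theorem levelBelow_mono {N M : ℕ} (h : N ≤ M) : levelBelow S N ≤ levelBelow S M :=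
  fun _ hx n hn => hx n (h.trans hn)

theorem isClosed_levelBelow (N : ℕ) : IsClosed (levelBelow S N : Set (Fock S)) := by
  have : (levelBelow S N : Set (Fock S)) = ⋂ (n : ℕ) (_ : N ≤ n),
      {x | lp.evalCLM ℂ (fun n => nParticle S n) 2 n x = 0} := by
    ext x
    simp only [Set.mem_iInter]
    exact Iff.rfl
  rw [this]
  exact isClosed_iInter fun n => isClosed_iInter fun _ =>
    isClosed_eq (ContinuousLinearMap.continuous _) continuous_const

/-- The span of the field vectors. -/
def fieldSpan (I : Set ℝ) : Submodule ℂ (Fock S) :=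
  Submodule.span ℂ {v | IsFieldVector (field S) (vacuum S) I v}

theorem vacuum_eq : vacuum S = singleParticle S 0 ⟨_, const_one_mem_nParticle_zero S⟩ := rfl

theorem isFieldVector_mem {I : Set ℝ} {x : Fock S}
    (hx : IsFieldVector (field S) (vacuum S) I x) : x ∈ finiteParticle S := by
  cases hx with
  | vacuum => rw [vacuum_eq]; exact Subtype.prop _
  | apply f hf x hx =>
    have hx' := (field_domain S f).le x.2
    rw [show field S f x = _ from field_apply S f ⟨x, hx'⟩ x.2]
    exact Subtype.prop _

theorem fieldEnd_mem_fieldSpan {I : Set ℝ} {f : 𝓢(ℝ, ℂ)} (hf : tsupport f ⊆ closure I)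
    {x : Fock S} (hx : x ∈ fieldSpan S I) :
    ∃ h : x ∈ finiteParticle S, (fieldEnd S f ⟨x, h⟩ : Fock S) ∈ fieldSpan S I := by
  have hle : fieldSpan S I ≤ ((fieldSpan S I).comap
      ((finiteParticle S).subtype.comp (fieldEnd S f))).map (finiteParticle S).subtype := by
    refine Submodule.span_le.2 fun x hx => ?_
    have h := isFieldVector_mem S hx
    refine ⟨⟨x, h⟩, Submodule.subset_span ?_, rfl⟩
    have h2 := IsFieldVector.apply f hf ⟨x, (field_domain S f).ge h⟩ hx
    rw [field_apply S f ⟨x, h⟩] at h2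
    exact h2
  obtain ⟨y, hy, rfl⟩ := hle hx
  exact ⟨y.2, hy⟩

/-- The closure of the span of the field vectors with less than `N` particles. -/
def fieldClosure (I : Set ℝ) (N : ℕ) : Submodule ℂ (Fock S) :=
  (fieldSpan S I ⊓ levelBelow S N).topologicalClosure

theorem fieldClosure_mono (I : Set ℝ) {N M : ℕ} (h : N ≤ M) :
    fieldClosure S I N ≤ fieldClosure S I M :=
  Submodule.topologicalClosure_mono (inf_le_inf_left _ (levelBelow_mono S h))

theorem fieldClosure_le (I : Set ℝ) (N : ℕ) : fieldClosure S I N ≤ levelBelow S N :=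
  Submodule.topologicalClosure_minimal _ inf_le_right (isClosed_levelBelow S N)

/-- On vectors with fewer than `N` particles the field is bounded, so it passes to limits. This is
why closures are taken inside a fixed particle bound. -/
theorem fieldEnd_mem_fieldClosure {I : Set ℝ} {f : 𝓢(ℝ, ℂ)} (hf : tsupport f ⊆ closure I) {N : ℕ}
    {x : finiteParticle S} (hx : (x : Fock S) ∈ fieldClosure S I N) :
    (fieldEnd S f x : Fock S) ∈ fieldClosure S I (N + 1) := by
  have hxN := fieldClosure_le S I N hx
  obtain ⟨w, hw, hlim⟩ := mem_closure_iff_seq_limit.1 hx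
  have hw' : ∀ k, w k ∈ finiteParticle S := fun k => levelBelow_le S N (hw k).2
  have hlim2 : Tendsto (fun k => (fieldEnd S f ⟨w k, hw' k⟩ : Fock S)) atTop
      (𝓝 (fieldEnd S f x : Fock S)) := by
    rw [tendsto_iff_norm_sub_tendsto_zero] at hlim ⊢
    refine squeeze_zero (fun k => norm_nonneg _) (fun k => ?_)
      (by simpa using hlim.const_mul (Real.sqrt N * (‖hatPlus f‖ + ‖hatMinus f‖)))
    have h1 := norm_fieldEnd_le S f (Φ := ⟨w k, hw' k⟩ - x) (N := N)
      (fun n hn => sub_mem (hw k).2 hxN n hn)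
    rw [map_sub] at h1
    exact h1
  refine mem_closure_of_tendsto hlim2 (Eventually.of_forall fun k => ⟨?_, ?_⟩)
  · exact (fieldEnd_mem_fieldSpan S hf (hw k).1).choose_spec
  · exact fun n hn => fieldEnd_apply_eq_zero S f (Φ := ⟨w k, hw' k⟩) (hw k).2 n hn

theorem singleParticle_mem_levelBelow (n : ℕ) (u : nParticle S n) :
    (singleParticle S n u : Fock S) ∈ levelBelow S (n + 1) := fun k hk => by
  rw [coe_singleParticle]
  exact lp.single_apply_ne (E := fun n => nParticle S n) 2 n u (by omega : k ≠ n)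

theorem nParticle_zero_eq (u : nParticle S 0) :
    ∃ c : ℂ, u = c • (⟨_, const_one_mem_nParticle_zero S⟩ : nParticle S 0) := by
  refine ⟨(u : L2 0) default, Subtype.ext (Lp.ext ?_)⟩
  have h := (memLp_const (μ := (volume : Measure (Fin 0 → ℝ))) (p := 2) (1 : ℂ)).coeFn_toLp
  filter_upwards [Lp.coeFn_smul ((u : L2 0) default)
    ((memLp_const (1 : ℂ)).toLp (fun _ : Fin 0 → ℝ => (1 : ℂ)) : L2 0), h] with β h1 h2
  rw [Submodule.coe_smul, h1, Pi.smul_apply, h2, smul_eq_mul, mul_one]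
  exact congrArg _ (Subsingleton.elim _ _)

/-- `u ↦ (0, …, 0, u, 0, …)` as a bounded operator. -/
def singleL (n : ℕ) : nParticle S n →L[ℂ] Fock S :=
  LinearMap.mkContinuous
    { toFun := fun u => (singleParticle S n u : Fock S)
      map_add' := fun u v => lp.single_add (E := fun n => nParticle S n) 2 n u v
      map_smul' := fun c u => lp.single_smul (E := fun n => nParticle S n) 2 n c u } 1 fun u => by
    rw [one_mul]
    exact (lp.norm_single (E := fun n => nParticle S n) (p := 2) (by norm_num) n u).le

theorem singleL_apply (n : ℕ) (u : nParticle S n) :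
    singleL S n u = (singleParticle S n u : Fock S) := rfl

/-- Induction on the particle bound: for `v` in the top level already reached, the annihilation part
of `φ(f)v` is covered by the induction hypothesis, so the creation part lies in the closure.
Creation parts with `f` supported in the closure of `I` are total in the next level. -/
theorem levelBelow_le_fieldClosure {I : Set ℝ} (hI : IsOpen I) (hI' : I.Nonempty) (N : ℕ) :
    levelBelow S N ≤ fieldClosure S I N := by
  induction N with
  | zero =>
    intro x hx
    have : x = 0 := lp.ext (funext fun n => hx n (Nat.zero_le n))
    rw [this]
    exact zero_mem _
  | succ N ih =>
    have hsingle : ∀ u : nParticle S N,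
        (singleParticle S N u : Fock S) ∈ fieldClosure S I (N + 1) := by
      rcases N with _ | M
      · intro u
        obtain ⟨c, rfl⟩ := nParticle_zero_eq S u
        rw [← singleL_apply, map_smul]
        refine Submodule.smul_mem _ c (Submodule.le_topologicalClosure _ ⟨?_, ?_⟩)
        · exact Submodule.subset_span IsFieldVector.vacuum
        · exact singleParticle_mem_levelBelow S 0 _
      · set K : Submodule ℂ (nParticle S (M + 1)) :=
          (fieldClosure S I (M + 1 + 1)).comap (singleL S (M + 1)).toLinearMap with hK
        have hKc : IsClosed (K : Set (nParticle S (M + 1))) :=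
          (Submodule.isClosed_topologicalClosure _).preimage (singleL S (M + 1)).continuous
        have hmem : ∀ f : 𝓢(ℝ, ℂ), tsupport f ⊆ closure I → ∀ v : nParticle S M,
            creationLevel S (hatPlus f) M v ∈ K := by
          intro f hf v
          change (singleParticle S (M + 1) (creationLevel S (hatPlus f) M v) : Fock S) ∈
            fieldClosure S I (M + 1 + 1)
          have h1 := fieldEnd_mem_fieldClosure S hf (x := singleParticle S M v)
            (ih (singleParticle_mem_levelBelow S M v))
          rw [fieldEnd_apply, creationEnd_singleParticle, Submodule.coe_add] at h1
          -- Lowering leaves a vector with fewer than `M + 1` particles.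
          have h2 : (annihilationEnd S (hatMinus f) (singleParticle S M v) : Fock S) ∈
              fieldClosure S I (M + 1 + 1) := by
            refine fieldClosure_mono S I (by omega) (ih fun k hk => ?_)
            rw [annihilationEnd_apply, singleParticle_mem_levelBelow S M v (k + 1) (by omega),
              map_zero]
          exact (Submodule.add_mem_iff_left _ h2).1 h1
        have hKc' : CompleteSpace K := hKc.completeSpace_coe
        have hKt : K = ⊤ := by
          rw [← Submodule.orthogonal_eq_bot_iff, Submodule.eq_bot_iff]
          intro u hu
          refine eq_zero_of_orthogonal_creationLevel S hI hI' fun f hf v => ?_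
          exact (Submodule.mem_orthogonal' _ _).1 hu _ (hmem f hf v)
        intro u
        have : u ∈ K := by rw [hKt]; trivial
        exact this
    intro x hx
    have hdec : x = (x - singleParticle S N (x N)) + singleParticle S N (x N) := by abel
    rw [hdec]
    refine add_mem (fieldClosure_mono S I (Nat.le_succ N) (ih fun n hn => ?_)) (hsingle _)
    change x n - (singleParticle S N (x N) : Fock S) n = 0
    rcases hn.eq_or_lt with rfl | h
    · rw [coe_singleParticle, lp.single_apply_self, sub_self]
    · rw [hx n h, singleParticle_mem_levelBelow S N (x N) n h, sub_zero]

theorem field_reehSchlieder {I : Set ℝ} (hI : IsOpen I) (hI' : I.Nonempty) :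
    Dense (Submodule.span ℂ {v | IsFieldVector (field S) (vacuum S) I v} : Set (Fock S)) := by
  have hD : finiteParticle S ≤ (fieldSpan S I).topologicalClosure := by
    rintro x ⟨N, hN⟩
    exact Submodule.topologicalClosure_mono inf_le_left
      (levelBelow_le_fieldClosure S hI hI' N hN)
  have : Dense (closure (fieldSpan S I : Set (Fock S))) := (dense_finiteParticle S).mono hD
  exact dense_closure.1 this

/-! ### The Reeh–Schlieder property of the reflected field. -/

theorem reflectionRep_vacuum : reflectionRep S (vacuum S) = vacuum S := by
  refine lp.ext (funext fun n => Subtype.ext ?_)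
  rw [coe_reflectionRep_apply, vacuum_eq]
  rcases n with _ | n
  · rw [coe_singleParticle, lp.single_apply_self]
    refine Lp.ext ?_
    have h := (memLp_const (μ := (volume : Measure (Fin 0 → ℝ))) (p := 2) (1 : ℂ)).coeFn_toLp
    filter_upwards [reflectionL2_ae ((memLp_const (1 : ℂ)).toLp
      (fun _ : Fin 0 → ℝ => (1 : ℂ)) : L2 0), h,
      (measurePreserving_perm (Fin.revPerm (n := 0))).quasiMeasurePreserving.ae h] with β h1 h2 h3
    rw [h1, h2, h3, map_one]
  · rw [singleParticle_mem_levelBelow S 0 _ (n + 1) (by omega)]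
    exact map_zero (reflectionL2 (n + 1))

theorem tsupport_reflectTest {I : Set ℝ} {f : 𝓢(ℝ, ℂ)}
    (hf : tsupport f ⊆ closure (Neg.neg ⁻¹' I)) : tsupport (reflectTest f) ⊆ closure I := by
  refine closure_minimal (fun x hx => ?_) isClosed_closure
  have h1 : f (-x) ≠ 0 := fun h => hx (by rw [reflectTest_apply, h, map_zero])
  have h2 := hf (subset_tsupport f h1)
  have h3 : Neg.neg ⁻¹' closure I = closure (Neg.neg ⁻¹' I : Set ℝ) :=
    (Homeomorph.neg ℝ).preimage_closure I
  rw [← h3, Set.mem_preimage, neg_neg] at h2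
  exact h2

theorem isFieldVector_reflectedField {I : Set ℝ} {x : Fock S}
    (hx : IsFieldVector (field S) (vacuum S) (Neg.neg ⁻¹' I) x) :
    IsFieldVector (reflectedField S) (vacuum S) I (reflectionRep S x) := by
  induction hx with
  | vacuum => rw [reflectionRep_vacuum]; exact IsFieldVector.vacuum
  | apply f hf x hx ih =>
    have hx' := (field_domain S f).le x.2
    have hd : reflectionRep S x ∈ (reflectedField S (reflectTest f)).domain := by
      rw [reflectedField_domain, reflectionRep_mem_iff]; exact hx'
    have h := IsFieldVector.apply (Φ := reflectedField S) (reflectTest f)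
      (tsupport_reflectTest hf) ⟨_, hd⟩ ih
    have hval : reflectedField S (reflectTest f) ⟨_, hd⟩ = reflectionRep S (field S f x) := by
      have h1 := reflectedField_apply S (reflectTest f) (reflectEnd S ⟨x, hx'⟩) hd
      rw [reflectTest_reflectTest, reflectConj_apply, reflectEnd_reflectEnd] at h1
      exact h1.trans (congrArg (reflectionRep S) (field_apply S f ⟨x, hx'⟩ x.2).symm)
    rwa [hval] at h

/-- `U(j)` fixes the vacuum, is isometric and onto, and carries field vectors for `-I` to reflected
field vectors for `I`. -/
theorem reflectedField_reehSchlieder {I : Set ℝ} (hI : IsOpen I) (hI' : I.Nonempty) :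
    Dense (Submodule.span ℂ {v | IsFieldVector (reflectedField S) (vacuum S) I v} :
      Set (Fock S)) := by
  have hne : (Neg.neg ⁻¹' I : Set ℝ).Nonempty := by
    obtain ⟨x, hx⟩ := hI'
    exact ⟨-x, by simpa using hx⟩
  have hd := field_reehSchlieder S (hI.preimage continuous_neg) hne
  have hsub : ∀ x ∈ Submodule.span ℂ {v | IsFieldVector (field S) (vacuum S) (Neg.neg ⁻¹' I) v},
      reflectionRep S x ∈
        Submodule.span ℂ {v | IsFieldVector (reflectedField S) (vacuum S) I v} := by
    intro x hx
    induction hx using Submodule.span_induction with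
    | mem x hx => exact Submodule.subset_span (isFieldVector_reflectedField S hx)
    | zero => rw [map_zero]; exact zero_mem _
    | add x y _ _ hx hy => rw [map_add]; exact add_mem hx hy
    | smul c x _ hx => rw [(reflectionRep S).map_smulₛₗ]; exact Submodule.smul_mem _ _ hx
  intro x
  have h1 := hd (reflectionRep S x)
  have h2 : reflectionRep S (reflectionRep S x) ∈ closure (reflectionRep S '' _) :=
    image_closure_subset_closure_image (reflectionRep S).continuous ⟨_, h1, rfl⟩
  rw [reflectionRep_reflectionRep] at h2
  refine closure_mono ?_ h2
  rintro _ ⟨y, hy, rfl⟩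
  exact hsub y hy

end

end ChiralModel

namespace ChiralModel

noncomputable section

/-! ### Symmetrization of vectors that are symmetric in all but the first variable -/

section Cycles

variable {V : Type*} [AddCommGroup V]

/-- The vectors `T (j-1) ⋯ T 1 (T 0 Θ)`. -/
def cycle (T : ℕ → V →+ V) (Θ : V) : ℕ → V
  | 0 => Θ
  | j + 1 => T j (cycle T Θ j)

variable {T : ℕ → V →+ V} {n : ℕ} {Θ : V}

/-- `T i` commutes past every factor of the cycle and reaches `Θ`, which it fixes. -/
theorem apply_cycle_of_lt (hcomm : ∀ k l, k + 2 ≤ l → l < n → ∀ v, T k (T l v) = T l (T k v))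
    (hΘ : ∀ k, k + 1 < n → T (k + 1) Θ = Θ) {i j : ℕ} (hji : j < i) (hi : i < n) :
    T i (cycle T Θ j) = cycle T Θ j := by
  induction j with
  | zero =>
    obtain ⟨k, rfl⟩ : ∃ k, i = k + 1 := ⟨i - 1, by omega⟩
    exact hΘ k hi
  | succ j ih =>
    rw [cycle, ← hcomm j i (by omega) hi, ih (by omega)]

/-- `T i` moves down to `T (i+1) (T i ·)`; the braid relation then turns it into an inner `T (i+1)`,
which fixes the shorter cycle. -/
theorem apply_cycle_of_gt (hcomm : ∀ k l, k + 2 ≤ l → l < n → ∀ v, T k (T l v) = T l (T k v))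
    (hbraid : ∀ k, k + 1 < n → ∀ v, T k (T (k + 1) (T k v)) = T (k + 1) (T k (T (k + 1) v)))
    (hΘ : ∀ k, k + 1 < n → T (k + 1) Θ = Θ) {i j : ℕ} (hij : i + 2 ≤ j) (hj : j ≤ n) :
    T i (cycle T Θ j) = cycle T Θ j := by
  induction j, hij using Nat.le_induction with
  | base =>
    change T i (T (i + 1) (T i (cycle T Θ i))) = T (i + 1) (T i (cycle T Θ i))
    rw [hbraid i (by omega), apply_cycle_of_lt hcomm hΘ (by omega) (by omega)]
  | succ j hij ih =>
    rw [cycle, hcomm i j hij (by omega), ih (by omega)]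

/-- `T i` interchanges the summands `i` and `i + 1` and fixes all the others. -/
theorem apply_sum_cycle (hinv : ∀ k < n, ∀ v, T k (T k v) = v)
    (hcomm : ∀ k l, k + 2 ≤ l → l < n → ∀ v, T k (T l v) = T l (T k v))
    (hbraid : ∀ k, k + 1 < n → ∀ v, T k (T (k + 1) (T k v)) = T (k + 1) (T k (T (k + 1) v)))
    (hΘ : ∀ k, k + 1 < n → T (k + 1) Θ = Θ) {i : ℕ} (hi : i < n) :
    T i (∑ j ∈ Finset.range (n + 1), cycle T Θ j) = ∑ j ∈ Finset.range (n + 1), cycle T Θ j := by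
  rw [map_sum]
  refine Finset.sum_equiv (Equiv.swap i (i + 1)) (fun j => ?_) fun j hj => ?_
  · rw [Equiv.swap_apply_def]
    simp only [Finset.mem_range]
    split_ifs <;> omega
  · rw [Finset.mem_range] at hj
    rw [Equiv.swap_apply_def]
    split_ifs with h1 h2
    · rw [h1]; rfl
    · rw [h2]; exact hinv i hi _
    · rcases lt_or_gt_of_ne h1 with h | h
      · exact apply_cycle_of_lt hcomm hΘ h hi
      · exact apply_cycle_of_gt hcomm hbraid hΘ (by omega) (by omega)

end Cycles

variable (S : ScatteringFunction)

/-- The transposition of `k` and `k + 1`, extended by the identity. -/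
def transposition (n k : ℕ) : L2 n →+ L2 n :=
  if hk : k + 1 < n then (transpositionAction S n k hk).toLinearMap.toAddMonoidHom
  else AddMonoidHom.id _

theorem transposition_apply {n k : ℕ} (hk : k + 1 < n) (Ψ : L2 n) :
    transposition S n k Ψ = transpositionAction S n k hk Ψ := by
  rw [transposition, dif_pos hk]
  rfl

theorem sum_cycle_mem {n : ℕ} (ψ : L2R) {x : L2 n} (hx : x ∈ nParticle S n) :
    ∑ j ∈ Finset.range (n + 1), cycle (transposition S (n + 1)) (tensor ψ x) j ∈
      nParticle S (n + 1) := by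
  rw [mem_nParticle] at hx ⊢
  intro i hi
  rw [← transposition_apply]
  refine apply_sum_cycle (fun k hk v => ?_) (fun k l hkl hl v => ?_) (fun k hk v => ?_)
    (fun k hk => ?_) (by omega)
  · rw [transposition_apply S (by omega), transposition_apply S (by omega),
      transpositionAction_invol]
  · have hk : k + 1 < n + 1 := by omega
    have hl' : l + 1 < n + 1 := by omega
    simp only [transposition_apply S hk, transposition_apply S hl']
    exact transpositionAction_comm S hkl hl' v
  · have hk1 : k + 1 < n + 1 := by omega
    have hk2 : k + 1 + 1 < n + 1 := by omega
    simp only [transposition_apply S hk1, transposition_apply S hk2]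
    exact transpositionAction_braid S hk2 v
  · rw [transposition_apply S (by omega), transpositionAction_tensor S hk, hx]

theorem inner_cycle {N : ℕ} (Θ Z : L2 N) (m : ℕ)
    (hZ : ∀ k, k < m → transposition S N k Z = Z) {j : ℕ} (hj : j ≤ m) :
    ⟪cycle (transposition S N) Θ j, Z⟫_ℂ = ⟪Θ, Z⟫_ℂ := by
  induction j with
  | zero => rfl
  | succ j ih =>
    rw [← ih (by omega), cycle]
    have hself : ∀ u v, ⟪transposition S N j u, v⟫_ℂ = ⟪u, transposition S N j v⟫_ℂ := by
      intro u v
      by_cases h : j + 1 < N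
      · rw [transposition_apply S h, transposition_apply S h, inner_transpositionAction]
      · rw [transposition, dif_neg h]; rfl
    rw [hself, hZ j (by omega)]

/-- As `ψ ⊗ x` is already symmetric in its last `n` variables, averaging over the `n + 1` positions
of the first variable replaces the average over all permutations. -/
theorem projection_tensor {n : ℕ} (ψ : L2R) {x : L2 n} (hx : x ∈ nParticle S n) :
    ((n + 1 : ℕ) : ℂ) • (((nParticle S (n + 1)).orthogonalProjectionOnto (tensor ψ x) :
      nParticle S (n + 1)) : L2 (n + 1)) =
      ∑ j ∈ Finset.range (n + 1), cycle (transposition S (n + 1)) (tensor ψ x) j := by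
  have h : (nParticle S (n + 1)).orthogonalProjectionOnto (tensor ψ x) =
      (((n + 1 : ℕ) : ℂ))⁻¹ • (⟨_, sum_cycle_mem S ψ hx⟩ : nParticle S (n + 1)) := by
    refine projection_eq_of_inner S fun Z => ?_
    rw [Submodule.coe_smul, inner_smul_right, inner_sum]
    have hZ : ∀ k, k < n → transposition S (n + 1) k Z = Z := fun k hk => by
      rw [transposition_apply S (by omega)]
      exact (mem_nParticle S).1 Z.2 k (by omega)
    have hterm : ∀ j ∈ Finset.range (n + 1),
        ⟪(Z : L2 (n + 1)), cycle (transposition S (n + 1)) (tensor ψ x) j⟫_ℂ =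
          ⟪(Z : L2 (n + 1)), tensor ψ x⟫_ℂ := fun j hj => by
      rw [← inner_conj_symm, inner_cycle S _ _ n hZ (by simpa [Nat.lt_succ_iff] using hj),
        inner_conj_symm]
    rw [Finset.sum_congr rfl hterm, Finset.sum_const, Finset.card_range, nsmul_eq_mul,
      inv_mul_cancel_left₀ (by exact_mod_cast Nat.succ_ne_zero n)]
  rw [h, Submodule.coe_smul, smul_inv_smul₀ (by exact_mod_cast Nat.succ_ne_zero n)]

/-! ### Tensor products with the additional variable on the right -/

section RightTensor

variable {n : ℕ}

theorem lastInit_eq_piFinSuccAbove (n : ℕ) :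
    (fun β : Fin (n + 1) → ℝ => (β (Fin.last n), fun i : Fin n => β i.castSucc)) =
      MeasurableEquiv.piFinSuccAbove (fun _ : Fin (n + 1) => ℝ) (Fin.last n) := by
  funext β
  refine Prod.ext rfl (funext fun i => ?_)
  change β i.castSucc = β ((Fin.last n).succAbove i)
  rw [Fin.succAbove_last]

theorem measurePreserving_lastInit (n : ℕ) :
    MeasurePreserving (fun β : Fin (n + 1) → ℝ => (β (Fin.last n), fun i : Fin n => β i.castSucc))
      volume (volume.prod volume) := by
  rw [lastInit_eq_piFinSuccAbove]
  exact volume_preserving_piFinSuccAbove (fun _ : Fin (n + 1) => ℝ) (Fin.last n)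

theorem measurableEmbedding_lastInit (n : ℕ) : MeasurableEmbedding
    (fun β : Fin (n + 1) → ℝ => (β (Fin.last n), fun i : Fin n => β i.castSucc)) := by
  rw [lastInit_eq_piFinSuccAbove]
  exact (MeasurableEquiv.piFinSuccAbove (fun _ : Fin (n + 1) => ℝ) _).measurableEmbedding

/-- `Φ ⊗ χ`. -/
def rightTensor (χ : L2R) (Φ : L2 n) : L2 (n + 1) :=
  reflectionL2 (n + 1) (tensor (star χ) (reflectionL2 n Φ))

theorem quasiMeasurePreserving_last (n : ℕ) :
    Measure.QuasiMeasurePreserving (fun β : Fin (n + 1) → ℝ => β (Fin.last n)) volume volume :=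
  Measure.quasiMeasurePreserving_fst.comp (measurePreserving_lastInit n).quasiMeasurePreserving

theorem quasiMeasurePreserving_init (n : ℕ) :
    Measure.QuasiMeasurePreserving (fun (β : Fin (n + 1) → ℝ) (i : Fin n) => β i.castSucc)
      volume volume :=
  Measure.quasiMeasurePreserving_snd.comp (measurePreserving_lastInit n).quasiMeasurePreserving

theorem rightTensor_ae (χ : L2R) (Φ : L2 n) :
    rightTensor χ Φ =ᵐ[volume] fun β => χ (β (Fin.last n)) * Φ (fun i => β i.castSucc) := by
  have hr := (measurePreserving_perm (Fin.revPerm (n := n + 1))).quasiMeasurePreserving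
  filter_upwards [reflectionL2_ae (tensor (star χ) (reflectionL2 n Φ)),
    hr.ae (tensor_ae (star χ) (reflectionL2 n Φ)),
    (quasiMeasurePreserving_last n).ae (Lp.coeFn_star χ),
    hr.ae ((quasiMeasurePreserving_tail n).ae (reflectionL2_ae Φ))] with β h1 h2 h3 h4
  rw [rightTensor, h1, h2, h4]
  simp only [Fin.revPerm_apply, Fin.rev_succ, Fin.rev_zero, Fin.rev_rev] at h3 ⊢
  rw [h3]
  simp

theorem inner_reflectionL2_right (Φ Ψ : L2 n) :
    ⟪Φ, reflectionL2 n Ψ⟫_ℂ = ⟪Ψ, reflectionL2 n Φ⟫_ℂ := by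
  rw [← antilinear_inner (reflectionL2 n) _ Ψ, reflectionL2_invol]

theorem inner_reflectionL2_left (Φ Ψ : L2 n) :
    ⟪reflectionL2 n Φ, Ψ⟫_ℂ = ⟪reflectionL2 n Ψ, Φ⟫_ℂ := by
  rw [← antilinear_inner (reflectionL2 n) Φ, reflectionL2_invol]

theorem inner_star_star_L2R (χ χ' : L2R) : ⟪star χ, star χ'⟫_ℂ = ⟪χ', χ⟫_ℂ := by
  rw [L2.inner_def, L2.inner_def]
  refine integral_congr_ae ?_
  filter_upwards [Lp.coeFn_star χ, Lp.coeFn_star χ'] with β h1 h2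
  rw [h1, h2]
  simp [mul_comm]

theorem inner_rightTensor_rightTensor (χ χ' : L2R) (Φ Φ' : L2 n) :
    ⟪rightTensor χ Φ, rightTensor χ' Φ'⟫_ℂ = ⟪χ, χ'⟫_ℂ * ⟪Φ, Φ'⟫_ℂ := by
  rw [rightTensor, rightTensor, antilinear_inner, inner_tensor_tensor, antilinear_inner,
    inner_star_star_L2R]

theorem rightTensor_tensor (ψ χ : L2R) (Φ : L2 n) :
    rightTensor χ (tensor ψ Φ) = tensor ψ (rightTensor χ Φ) := by
  refine Lp.ext ?_
  filter_upwards [rightTensor_ae χ (tensor ψ Φ),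
    (quasiMeasurePreserving_init (n + 1)).ae (tensor_ae ψ Φ), tensor_ae ψ (rightTensor χ Φ),
    (quasiMeasurePreserving_tail (n + 1)).ae (rightTensor_ae χ Φ)] with β h1 h2 h3 h4
  rw [h1, h2, h3, h4, mul_left_comm]
  rfl

theorem eq_zero_of_inner_rightTensor_eq_zero {u : L2 (n + 1)}
    (h : ∀ (χ : L2R) (v : L2 n), ⟪u, rightTensor χ v⟫_ℂ = 0) : u = 0 := by
  have h0 : reflectionL2 (n + 1) u = 0 := by
    refine eq_zero_of_inner_tensor_eq_zero fun ψ v => ?_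
    have := h (star ψ) (reflectionL2 n v)
    rw [rightTensor, star_star, reflectionL2_invol, inner_reflectionL2_right] at this
    rw [← inner_conj_symm, this, map_zero]
  rw [← reflectionL2_invol u, h0, map_zero]

/-- Contracting on the left commutes with tensoring on the right, as is seen by testing against the
total set of right tensors. -/
theorem inner_tensor_rightTensor (ψ χ : L2R) (x y : L2 (n + 1)) :
    ⟪tensor ψ x, rightTensor χ y⟫_ℂ =
      ⟪x, rightTensor χ (ContinuousLinearMap.adjoint (tensorL n ψ) y)⟫_ℂ := by
  have h : ContinuousLinearMap.adjoint (tensorL (n + 1) ψ) (rightTensor χ y) -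
      rightTensor χ (ContinuousLinearMap.adjoint (tensorL n ψ) y) = 0 := by
    refine eq_zero_of_inner_rightTensor_eq_zero fun χ' v => ?_
    rw [inner_sub_left, ContinuousLinearMap.adjoint_inner_left, tensorL_apply,
      ← rightTensor_tensor, inner_rightTensor_rightTensor, inner_rightTensor_rightTensor,
      ContinuousLinearMap.adjoint_inner_left, tensorL_apply, sub_self]
  rw [← sub_eq_zero.1 h, ContinuousLinearMap.adjoint_inner_right, tensorL_apply]

theorem transpositionAction_rightTensor {k : ℕ} (hk : k + 1 < n) (χ : L2R) (Φ : L2 n) :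
    transpositionAction S (n + 1) k (by omega) (rightTensor χ Φ) =
      rightTensor χ (transpositionAction S n k hk Φ) := by
  have hk' : k + 1 < n + 1 := by omega
  refine Lp.ext ?_
  filter_upwards [transpositionAction_ae S hk' (rightTensor χ Φ),
    (measurePreserving_perm (Equiv.swap (⟨k, by omega⟩ : Fin (n + 1))
      ⟨k + 1, hk'⟩)).quasiMeasurePreserving.ae (rightTensor_ae χ Φ),
    rightTensor_ae χ (transpositionAction S n k hk Φ),
    (quasiMeasurePreserving_init n).ae (transpositionAction_ae S hk Φ)] with β h1 h2 h3 h4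
  rw [h1, h2, h3, h4, swap_of_ne hk' (by simp; omega) (by simp; omega), mul_left_comm]
  congr 3
  funext i
  congr 1
  refine Fin.ext ?_
  rw [swap_val hk', Fin.val_castSucc, Fin.val_castSucc, swap_val hk]

/-- The adjoint of `Φ ↦ Φ ⊗ χ` preserves `S`-symmetry. -/
theorem exists_adjoint_rightTensor (χ : L2R) {x : L2 (n + 1)} (hx : x ∈ nParticle S (n + 1)) :
    ∃ z ∈ nParticle S n, ∀ v : L2 n, ⟪x, rightTensor χ v⟫_ℂ = ⟪z, v⟫_ℂ := by
  refine ⟨_, reflectionL2_mem S (adjoint_tensorL_mem S (star χ) (reflectionL2_mem S hx)),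
    fun v => ?_⟩
  rw [rightTensor, inner_reflectionL2_right, inner_reflectionL2_left,
    ContinuousLinearMap.adjoint_inner_right, tensorL_apply]

end RightTensor

end

end ChiralModel

namespace ChiralModel

noncomputable section

variable (S : ScatteringFunction)

/-! ### Reflected creation and annihilation operators -/

/-- The creation operator acting from the right. -/
def rightCreationEnd (χ : L2R) : Module.End ℂ (finiteParticle S) :=
  reflectConj S (creationEnd S (star χ))

/-- The annihilation operator acting from the right. -/
def rightAnnihilationEnd (χ : L2R) : Module.End ℂ (finiteParticle S) :=
  reflectConj S (annihilationEnd S (star χ))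

theorem inner_reflectEnd_right (x y : finiteParticle S) :
    ⟪(x : Fock S), (reflectEnd S y : Fock S)⟫_ℂ = ⟪(y : Fock S), (reflectEnd S x : Fock S)⟫_ℂ := by
  rw [coe_reflectEnd, coe_reflectEnd, ← antiunitary_inner (reflectionRep S) _ (y : Fock S),
    reflectionRep_reflectionRep]

theorem inner_reflectEnd_left (x y : finiteParticle S) :
    ⟪(reflectEnd S x : Fock S), (y : Fock S)⟫_ℂ = ⟪(reflectEnd S y : Fock S), (x : Fock S)⟫_ℂ := by
  rw [← inner_conj_symm, inner_reflectEnd_right, inner_conj_symm]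

theorem inner_rightCreation_left (χ : L2R) (x y : finiteParticle S) :
    ⟪(rightCreationEnd S χ x : Fock S), (y : Fock S)⟫_ℂ =
      ⟪(x : Fock S), (rightAnnihilationEnd S (star χ) y : Fock S)⟫_ℂ := by
  rw [rightCreationEnd, rightAnnihilationEnd, reflectConj_apply, reflectConj_apply,
    inner_reflectEnd_left, inner_reflectEnd_right, ← inner_conj_symm, inner_creation_left,
    inner_conj_symm]

theorem inner_rightCreation_succ (χ : L2R) (y : finiteParticle S) (n : ℕ)
    (x : nParticle S (n + 1)) :
    ⟪x, (rightCreationEnd S χ y : Fock S) (n + 1)⟫_ℂ =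
      ((Real.sqrt (n + 1) : ℝ) : ℂ) *
        ⟪(x : L2 (n + 1)), rightTensor χ ((y : Fock S) n : L2 n)⟫_ℂ := by
  have h := inner_creationLevel_right S (star χ) n ⟨_, reflectionL2_mem S x.2⟩
    ⟨_, reflectionL2_mem S ((y : Fock S) n).2⟩
  change ⟪(x : L2 (n + 1)), reflectionL2 (n + 1) ((creationLevel S (star χ) n
    ⟨_, reflectionL2_mem S ((y : Fock S) n).2⟩ : nParticle S (n + 1)) : L2 (n + 1))⟫_ℂ = _
  refine (inner_reflectionL2_right _ _).trans ?_
  rw [rightTensor, inner_reflectionL2_right (x : L2 (n + 1)), ← inner_conj_symm]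
  refine (congrArg conj h).trans ?_
  rw [map_mul, Complex.conj_ofReal, inner_conj_symm]

theorem rightCreation_zero (χ : L2R) (y : finiteParticle S) :
    (rightCreationEnd S χ y : Fock S) 0 = 0 :=
  Subtype.ext (map_zero (reflectionL2 0))

theorem inner_creation_succ (ψ : L2R) (y : finiteParticle S) (n : ℕ) (x : nParticle S (n + 1)) :
    ⟪x, (creationEnd S ψ y : Fock S) (n + 1)⟫_ℂ =
      ((Real.sqrt (n + 1) : ℝ) : ℂ) * ⟪(x : L2 (n + 1)), tensor ψ ((y : Fock S) n : L2 n)⟫_ℂ :=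
  inner_creationLevel_right S ψ n x _

/-- Against a symmetric vector both orders give the pairing with `ψ ⊗ y ⊗ χ`; projections drop out
because contracting a symmetric vector on either side preserves symmetry. -/
theorem creation_rightCreation_comm (ψ χ : L2R) (y : finiteParticle S) :
    creationEnd S ψ (rightCreationEnd S χ y) = rightCreationEnd S χ (creationEnd S ψ y) := by
  refine finiteParticle_ext S fun n => ?_
  rcases n with _ | n
  · rw [rightCreation_zero]; rfl
  refine ext_inner_left ℂ fun x => ?_
  rw [inner_creation_succ, inner_rightCreation_succ]
  congr 1
  obtain ⟨z, hz, hz'⟩ := exists_adjoint_rightTensor S χ x.2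
  rw [← tensorL_apply, ← ContinuousLinearMap.adjoint_inner_left, hz']
  have hw := adjoint_tensorL_mem S ψ x.2
  -- In the one-particle component both sides vanish, since two creators produce at least two
  -- particles.
  rcases n with _ | n
  · have h1 : (((rightCreationEnd S χ y : Fock S) 0 : nParticle S 0) : L2 0) = 0 :=
      congrArg Subtype.val (rightCreation_zero S χ y)
    rw [h1, inner_zero_right, creationEnd_apply_zero, Submodule.coe_zero, inner_zero_right]
  · refine (inner_rightCreation_succ S χ y n ⟨_, hw⟩).trans
      (Eq.trans ?_ (inner_creation_succ S ψ y n ⟨z, hz⟩).symm)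
    congr 1
    rw [ContinuousLinearMap.adjoint_inner_left, tensorL_apply, ← rightTensor_tensor, hz']

theorem finiteParticle_ext_inner {u v : finiteParticle S}
    (h : ∀ x : finiteParticle S, ⟪(x : Fock S), (u : Fock S)⟫_ℂ = ⟪(x : Fock S), (v : Fock S)⟫_ℂ) :
    u = v := by
  have := h (u - v)
  rw [← sub_eq_zero, ← inner_sub_right, ← Submodule.coe_sub, inner_self_eq_zero] at this
  exact sub_eq_zero.1 (Subtype.ext this)

theorem inner_annihilation_right (ψ : L2R) (Φ Ψ : finiteParticle S) :
    ⟪(Φ : Fock S), (annihilationEnd S ψ Ψ : Fock S)⟫_ℂ =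
      ⟪(creationEnd S (star ψ) Φ : Fock S), (Ψ : Fock S)⟫_ℂ := by
  rw [inner_creation_left, star_star]

theorem inner_creation_right (ψ : L2R) (Φ Ψ : finiteParticle S) :
    ⟪(Φ : Fock S), (creationEnd S ψ Ψ : Fock S)⟫_ℂ =
      ⟪(annihilationEnd S (star ψ) Φ : Fock S), (Ψ : Fock S)⟫_ℂ := by
  rw [inner_annihilation_left, star_star]

theorem inner_rightAnnihilation_right (ψ : L2R) (Φ Ψ : finiteParticle S) :
    ⟪(Φ : Fock S), (rightAnnihilationEnd S ψ Ψ : Fock S)⟫_ℂ =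
      ⟪(rightCreationEnd S (star ψ) Φ : Fock S), (Ψ : Fock S)⟫_ℂ := by
  rw [inner_rightCreation_left, star_star]

theorem annihilation_rightAnnihilation_comm (ψ χ : L2R) (y : finiteParticle S) :
    annihilationEnd S ψ (rightAnnihilationEnd S χ y) =
      rightAnnihilationEnd S χ (annihilationEnd S ψ y) := by
  refine finiteParticle_ext_inner S fun x => ?_
  rw [inner_annihilation_right, inner_rightAnnihilation_right, inner_rightAnnihilation_right,
    inner_annihilation_right, creation_rightCreation_comm]

/-! ### The mixed commutators -/

/-- Each transposition moves the first variable of `Θ` one place to the right, at the price of one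
factor `S`. -/
theorem cycle_ae {n : ℕ} (Θ : L2 (n + 1)) {j : ℕ} (hj : j < n + 1) :
    ∃ c : Equiv.Perm (Fin (n + 1)),
      (∀ i : Fin (n + 1), (c i : ℕ) =
        if (i : ℕ) = 0 then j else if (i : ℕ) ≤ j then (i : ℕ) - 1 else i) ∧
      (cycle (transposition S (n + 1)) Θ j : L2 (n + 1)) =ᵐ[volume] fun β =>
        (∏ l : Fin j, S.toFun ((β ⟨j, hj⟩ - β ⟨l, by omega⟩ : ℝ) : ℂ)) * Θ (fun i => β (c i)) := by
  induction j with
  | zero =>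
    refine ⟨Equiv.refl _, fun i => ?_, ?_⟩
    · simp only [Equiv.refl_apply]; split_ifs <;> omega
    · exact Eventually.of_forall fun β => by simp [cycle]
  | succ j ih =>
    obtain ⟨c, hc, h⟩ := ih (by omega)
    refine ⟨c.trans (Equiv.swap ⟨j, by omega⟩ ⟨j + 1, hj⟩), fun i => ?_, ?_⟩
    · rw [Equiv.trans_apply, swap_val, hc]; split_ifs <;> omega
    · rw [cycle, transposition_apply S hj]
      filter_upwards [transpositionAction_ae S hj (cycle (transposition S (n + 1)) Θ j),
        (measurePreserving_perm (Equiv.swap (⟨j, by omega⟩ : Fin (n + 1))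
          ⟨j + 1, hj⟩)).quasiMeasurePreserving.ae h] with β h1 h2
      have hsw : ∀ l : Fin j, Equiv.swap (⟨j, by omega⟩ : Fin (n + 1)) ⟨j + 1, hj⟩
          ⟨l, by omega⟩ = ⟨l, by omega⟩ := fun l =>
        swap_of_ne hj (by simp; omega) (by simp; omega)
      rw [h1, h2, Fin.prod_univ_castSucc, Equiv.swap_apply_left]
      simp only [hsw, Fin.val_castSucc, Fin.val_last, Equiv.trans_apply]
      ring

/-- The matrix elements of the commutator of `y(ψ)` with a reflected creation operator. -/
def mixedKernel {n : ℕ} (ψ χ : L2R) (x y : L2 n) : ℂ :=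
  ⟪cycle (transposition S (n + 1)) (tensor (star ψ) x) n, rightTensor χ y⟫_ℂ

/-- Moved to the left of the inner product, `y(ψ)` gives the `n + 1` cycles of `conj ψ ⊗ x`, paired
with `y ⊗ χ`. The `n` cycles that do not reach the last variable all contribute equally and add up
to the product in the opposite order; the full cycle is what remains as commutator. -/
theorem inner_annihilation_rightCreation (ψ χ : L2R) (x y : finiteParticle S) (n : ℕ) :
    ⟪(x : Fock S) n, (annihilationEnd S ψ (rightCreationEnd S χ y) : Fock S) n⟫_ℂ =
      mixedKernel S ψ χ ((x : Fock S) n : L2 n) ((y : Fock S) n : L2 n) +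
      ⟪(x : Fock S) n, (rightCreationEnd S χ (annihilationEnd S ψ y) : Fock S) n⟫_ℂ := by
  set X : nParticle S n := (x : Fock S) n with hX
  set Y : nParticle S n := (y : Fock S) n with hY
  have hinv : ∀ k < n - 1, transposition S (n + 1) k (rightTensor χ (Y : L2 n)) =
      rightTensor χ (Y : L2 n) := fun k hk => by
    rw [transposition_apply S (by omega), transpositionAction_rightTensor S (by omega),
      (mem_nParticle S).1 Y.2]
  have hsq : ((Real.sqrt (n + 1) : ℝ) : ℂ) * ((Real.sqrt (n + 1) : ℝ) : ℂ) = ((n + 1 : ℕ) : ℂ) := by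
    rw [← Complex.ofReal_mul, Real.mul_self_sqrt (by positivity)]
    push_cast; rfl
  have h1 : ⟪X, (annihilationEnd S ψ (rightCreationEnd S χ y) : Fock S) n⟫_ℂ =
      ∑ j ∈ Finset.range (n + 1), ⟪cycle (transposition S (n + 1)) (tensor (star ψ) (X : L2 n)) j,
        rightTensor χ (Y : L2 n)⟫_ℂ := by
    rw [annihilationEnd_apply, ← star_star ψ, ← inner_creationLevel_left, star_star,
      inner_rightCreation_succ, ← sum_inner, ← projection_tensor S (star ψ) X.2, inner_smul_left,
      creationLevel_apply, Submodule.coe_smul, inner_smul_left, ← mul_assoc, Complex.conj_ofReal,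
      hsq, Complex.conj_natCast]
  -- Cycles with `j < n` use only transpositions `k < n - 1`, which do not touch the last variable
  -- and therefore fix `y ⊗ χ`.
  have h2 : ∀ j ∈ Finset.range n, ⟪cycle (transposition S (n + 1)) (tensor (star ψ) (X : L2 n)) j,
      rightTensor χ (Y : L2 n)⟫_ℂ = ⟪tensor (star ψ) (X : L2 n), rightTensor χ (Y : L2 n)⟫_ℂ :=
    fun j hj => inner_cycle S _ _ (n - 1) hinv (by have := Finset.mem_range.1 hj; omega)
  rw [h1, Finset.sum_range_succ, add_comm, Finset.sum_congr rfl h2, Finset.sum_const,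
    Finset.card_range]
  refine congrArg (mixedKernel S ψ χ (X : L2 n) (Y : L2 n) + ·) ?_
  clear h1 h2 hsq hinv
  rcases n with _ | m
  · rw [rightCreation_zero, inner_zero_right, zero_smul]
  · rw [inner_rightCreation_succ, annihilationEnd_apply, coe_annihilationLevel,
      inner_tensor_rightTensor]
    have hs : rightTensor χ (((Real.sqrt (m + 1) : ℝ) : ℂ) •
        ContinuousLinearMap.adjoint (tensorL m (star ψ)) (Y : L2 (m + 1))) =
        ((Real.sqrt (m + 1) : ℝ) : ℂ) • rightTensor χ
        (ContinuousLinearMap.adjoint (tensorL m (star ψ)) (Y : L2 (m + 1))) := by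
      rw [rightTensor, rightTensor, LinearIsometry.map_smulₛₗ, map_smul, LinearIsometry.map_smulₛₗ,
        Complex.conj_conj]
    rw [hs, inner_smul_right, ← mul_assoc, ← Complex.ofReal_mul,
      Real.mul_self_sqrt (by positivity), nsmul_eq_mul]
    push_cast; rfl

theorem inner_commutator_annihilation_rightCreation (ψ χ : L2R) (x y : finiteParticle S) :
    ⟪(x : Fock S), ((annihilationEnd S ψ (rightCreationEnd S χ y) -
      rightCreationEnd S χ (annihilationEnd S ψ y) : finiteParticle S) : Fock S)⟫_ℂ =
      ∑' n, mixedKernel S ψ χ ((x : Fock S) n : L2 n) ((y : Fock S) n : L2 n) := by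
  rw [lp.inner_eq_tsum]
  refine tsum_congr fun n => ?_
  have h := inner_annihilation_rightCreation S ψ χ x y n
  refine (inner_sub_right (𝕜 := ℂ) ((x : Fock S) n) _ _).trans ?_
  rw [h, add_sub_cancel_right]

/-- Taking adjoints reduces this commutator to the previous one with the roles of `x` and `y`
exchanged. -/
theorem inner_commutator_rightAnnihilation_creation (ψ χ : L2R) (x y : finiteParticle S) :
    ⟪(x : Fock S), ((rightAnnihilationEnd S χ (creationEnd S ψ y) -
      creationEnd S ψ (rightAnnihilationEnd S χ y) : finiteParticle S) : Fock S)⟫_ℂ =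
      ∑' n, conj (mixedKernel S (star ψ) (star χ) ((y : Fock S) n : L2 n)
        ((x : Fock S) n : L2 n)) := by
  rw [← Complex.conj_tsum, ← inner_commutator_annihilation_rightCreation, inner_conj_symm,
    Submodule.coe_sub, Submodule.coe_sub, inner_sub_right, inner_sub_left,
    inner_rightAnnihilation_right, inner_creation_right, inner_creation_right,
    inner_rightAnnihilation_right]

/-- After the full cycle, `ψ` and `χ` depend on the same variable `θ`, so Fubini shows that the
commutator multiplies by a function of `β`. Conjugation turns `S(θ - β_l)` into `S(β_l - θ)`. -/
theorem mixedKernel_eq_integral {n : ℕ} (ψ χ : L2R) (x y : L2 n) :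
    mixedKernel S ψ χ x y = ∫ β : Fin n → ℝ, conj (x β) * y β *
      ∫ θ : ℝ, ψ θ * χ θ * ∏ l : Fin n, S.toFun ((β l - θ : ℝ) : ℂ) := by
  set F : ℝ × (Fin n → ℝ) → ℂ := fun p => conj (x p.2) * y p.2 *
    (ψ p.1 * χ p.1 * ∏ l : Fin n, S.toFun ((p.2 l - p.1 : ℝ) : ℂ)) with hF
  set u := cycle (transposition S (n + 1)) (tensor (star ψ) x) n with hu
  have hmp := measurePreserving_lastInit n
  obtain ⟨c, hc, hcyc⟩ := cycle_ae S (tensor (star ψ) x) (Nat.lt_succ_self n)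
  have hc0 : c 0 = Fin.last n := Fin.ext (by rw [hc]; simp)
  have hcs : ∀ i : Fin n, c i.succ = i.castSucc := fun i => Fin.ext (by
    rw [hc]; simp)
  have hae : (fun β : Fin (n + 1) → ℝ => ⟪u β, rightTensor χ y β⟫_ℂ) =ᵐ[volume]
      fun β => F (β (Fin.last n), fun i : Fin n => β i.castSucc) := by
    filter_upwards [hcyc, (measurePreserving_perm c).quasiMeasurePreserving.ae
        (tensor_ae (star ψ) x), (quasiMeasurePreserving_last n).ae (Lp.coeFn_star ψ),
      rightTensor_ae χ y] with β h1 h2 h3 h4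
    rw [hu, h1, h2, h4, hc0, h3]
    simp only [hcs, hF, RCLike.inner_apply, map_mul, Pi.star_apply, RCLike.star_def, map_prod,
      Complex.conj_conj, S.conj_real]
    have : ∀ l : Fin n, S.toFun (-((β (⟨n, Nat.lt_succ_self n⟩ : Fin (n + 1)) -
        β (⟨l, by omega⟩ : Fin (n + 1)) : ℝ) : ℂ)) =
        S.toFun ((β l.castSucc - β (Fin.last n) : ℝ) : ℂ) := fun l => by
      rw [← Complex.ofReal_neg, neg_sub]; rfl
    simp only [this]
    ring
  have hemb := measurableEmbedding_lastInit n
  have hint : Integrable F (volume.prod volume) := by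
    rw [← hmp.integrable_comp_emb hemb]
    exact (L2.integrable_inner u (rightTensor χ y)).congr hae
  rw [mixedKernel, L2.inner_def, integral_congr_ae hae, hmp.integral_comp hemb,
    integral_prod_symm F hint]
  refine integral_congr_ae (Eventually.of_forall fun β => ?_)
  exact integral_const_mul (conj (x β) * y β) _

end

end ChiralModel

namespace ChiralModel

noncomputable section

/-! ### Shifting a horizontal line of integration -/

theorem tendsto_inv_one_add_sq : Tendsto (fun R : ℝ => (1 + R ^ 2)⁻¹) atTop (𝓝 0) :=
  tendsto_inv_atTop_zero.comp
    (tendsto_atTop_add_const_left _ _ (tendsto_pow_atTop two_ne_zero))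

/-- Cauchy's theorem on the rectangles `[-R, R] × [-b, 0]`; the decay makes the vertical sides
vanish as `R → ∞`. -/
theorem integral_eq_integral_shift {H : ℂ → ℂ} {b C : ℝ} (hb : 0 ≤ b)
    (hc : ContinuousOn H (closedStrip (-b) 0)) (hd : DifferentiableOn ℂ H (strip (-b) 0))
    (hbound : ∀ ζ ∈ closedStrip (-b) 0, ‖H ζ‖ ≤ C * (1 + ζ.re ^ 2)⁻¹) :
    ∫ θ : ℝ, H θ = ∫ θ : ℝ, H (θ - b * Complex.I) := by
  have hint : ∀ y ∈ Set.Icc (-b) 0, Integrable fun x : ℝ => H (x + y * Complex.I) := by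
    intro y hy
    have hmem : ∀ x : ℝ, (x + y * Complex.I : ℂ) ∈ closedStrip (-b) 0 := fun x => by
      simpa [closedStrip] using hy
    refine (integrable_inv_one_add_sq.const_mul C).mono'
      (Continuous.aestronglyMeasurable (hc.comp_continuous (by fun_prop) hmem))
      (Eventually.of_forall fun x => ?_)
    simpa using hbound _ (hmem x)
  have hvert : ∀ r : ℝ, ‖∫ y : ℝ in (-b)..0, H (r + y * Complex.I)‖ ≤ C * (1 + r ^ 2)⁻¹ * b := by
    intro r
    have h := intervalIntegral.norm_integral_le_of_norm_le_const (a := -b) (b := 0)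
      (C := C * (1 + r ^ 2)⁻¹) (f := fun y : ℝ => H (r + y * Complex.I)) fun y hy => by
        rw [Set.uIoc_of_le (by linarith)] at hy
        simpa using hbound (r + y * Complex.I) (by simpa [closedStrip] using ⟨hy.1.le, hy.2⟩)
    rwa [zero_sub, neg_neg, abs_of_nonneg hb] at h
  have hlim : Tendsto (fun R : ℝ => C * (1 + R ^ 2)⁻¹ * b) atTop (𝓝 0) := by
    simpa using (tendsto_inv_one_add_sq.const_mul C).mul_const b
  have hv1 : Tendsto (fun R : ℝ => ∫ y : ℝ in (-b)..0, H (R + y * Complex.I)) atTop (𝓝 0) :=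
    squeeze_zero_norm hvert hlim
  have hv2 : Tendsto (fun R : ℝ => ∫ y : ℝ in (-b)..0, H ((-R : ℝ) + y * Complex.I)) atTop
      (𝓝 0) :=
    squeeze_zero_norm (fun R => by simpa using hvert (-R)) hlim
  have hh1 := intervalIntegral_tendsto_integral (hint (-b) ⟨le_rfl, by linarith⟩)
    tendsto_neg_atTop_atBot tendsto_id
  have hh2 := intervalIntegral_tendsto_integral (hint 0 ⟨by linarith, le_rfl⟩)
    tendsto_neg_atTop_atBot tendsto_id
  have hrect : ∀ R : ℝ, ((∫ x : ℝ in (-R)..R, H (x + (-b : ℝ) * Complex.I)) -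
      ∫ x : ℝ in (-R)..R, H (x + (0 : ℝ) * Complex.I)) +
      Complex.I * (∫ y : ℝ in (-b)..0, H (R + y * Complex.I)) -
      Complex.I * (∫ y : ℝ in (-b)..0, H ((-R : ℝ) + y * Complex.I)) = 0 := by
    intro R
    refine Complex.integral_boundary_rect_eq_zero_of_continuousOn_of_differentiableOn H
      ⟨-R, -b⟩ ⟨R, 0⟩ (hc.mono fun ζ hζ => ?_) (hd.mono fun ζ hζ => ?_)
    · have := hζ.2
      simp only [Set.mem_preimage] at this
      rwa [Set.uIcc_of_le (by linarith : -b ≤ 0)] at this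
    · have := hζ.2
      simp only [Set.mem_preimage] at this
      rwa [min_eq_left (by linarith : -b ≤ 0), max_eq_right (by linarith : -b ≤ 0)] at this
  have htot := ((hh1.sub hh2).add (hv1.const_mul Complex.I)).sub (hv2.const_mul Complex.I)
  have hzero := tendsto_nhds_unique (htot.congr hrect) tendsto_const_nhds
  simp only [mul_zero, add_zero, sub_zero, sub_eq_zero, Complex.ofReal_zero, zero_mul] at hzero
  rw [← hzero]
  refine integral_congr_ae (Eventually.of_forall fun x => ?_)
  simp only [Complex.ofReal_neg, neg_mul, sub_eq_add_neg]

/-! ### Fourier-Laplace transforms of functions supported on a half line -/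

/-- `∫ h(x) e^{-iwx} dx`. -/
def laplace (h : 𝓢(ℝ, ℂ)) (w : ℂ) : ℂ := ∫ x : ℝ, h x * Complex.exp (-(Complex.I * w * x))

section Laplace

variable {h : 𝓢(ℝ, ℂ)}

theorem norm_mul_exp_le {x : ℝ} (c : ℂ) (hc : x < 0 → c = 0) {w : ℂ} (hw : w.im ≤ 0) :
    ‖c * Complex.exp (-(Complex.I * w * x))‖ ≤ ‖c‖ := by
  rcases lt_or_ge x 0 with hx | hx
  · simp [hc hx]
  · rw [norm_mul, Complex.norm_exp]
    refine mul_le_of_le_one_right (norm_nonneg _) (Real.exp_le_one_iff.2 ?_)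
    have : (-(Complex.I * w * x)).re = w.im * x := by simp
    rw [this]
    exact mul_nonpos_of_nonpos_of_nonneg hw hx

theorem integrable_laplace (hh : ∀ x < 0, h x = 0) {w : ℂ} (hw : w.im ≤ 0) :
    Integrable fun x : ℝ => h x * Complex.exp (-(Complex.I * w * x)) :=
  h.integrable.mono (Continuous.aestronglyMeasurable (by have := h.continuous; fun_prop))
    (Eventually.of_forall fun x => norm_mul_exp_le _ (hh x) hw)

theorem norm_laplace_le (hh : ∀ x < 0, h x = 0) {w : ℂ} (hw : w.im ≤ 0) :
    ‖laplace h w‖ ≤ ∫ x, ‖h x‖ :=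
  norm_integral_le_of_norm_le h.integrable.norm
    (Eventually.of_forall fun x => norm_mul_exp_le _ (hh x) hw)

theorem continuousOn_laplace (hh : ∀ x < 0, h x = 0) :
    ContinuousOn (laplace h) {w | w.im ≤ 0} := by
  refine continuousOn_of_dominated (bound := fun x => ‖h x‖) (fun w hw => ?_) (fun w hw => ?_)
    h.integrable.norm (Eventually.of_forall fun x => ?_)
  · exact (integrable_laplace hh hw).1
  · exact Eventually.of_forall fun x => norm_mul_exp_le _ (hh x) hw
  · exact Continuous.continuousOn (by fun_prop)

theorem differentiableAt_laplace (hh : ∀ x < 0, h x = 0) {w : ℂ} (hw : w.im < 0) :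
    DifferentiableAt ℂ (laplace h) w := by
  have hopen : IsOpen {w : ℂ | w.im < 0} := isOpen_lt Complex.continuous_im continuous_const
  have hcont := h.continuous
  refine (hasDerivAt_integral_of_dominated_loc_of_deriv_le (μ := volume)
    (F := fun (w : ℂ) (x : ℝ) => h x * Complex.exp (-(Complex.I * w * x)))
    (F' := fun (w : ℂ) (x : ℝ) => (h x * -(Complex.I * x)) * Complex.exp (-(Complex.I * w * x)))
    (bound := fun x => ‖x‖ ^ 1 * ‖h x‖)
    (hopen.mem_nhds hw) ?_ (integrable_laplace hh hw.le) ?_ ?_ (h.integrable_pow_mul volume 1)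
    ?_).2.differentiableAt
  · exact Eventually.of_forall fun w => Continuous.aestronglyMeasurable (by fun_prop)
  · exact Continuous.aestronglyMeasurable (by fun_prop)
  · refine Eventually.of_forall fun x w' hw' => ?_
    refine (norm_mul_exp_le _ (fun hx => by simp [hh x hx]) (le_of_lt hw')).trans ?_
    simp [mul_comm]
  · refine Eventually.of_forall fun x w' _ => ?_
    have h1 : HasDerivAt (fun w : ℂ => -(Complex.I * w * x)) (-(Complex.I * x)) w' := by
      have := (((hasDerivAt_id w').const_mul Complex.I).mul_const (x : ℂ)).fun_neg
      simpa using this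
    exact (h1.cexp.const_mul (h x)).congr_deriv (by ring)

theorem deriv_eq_zero_of_support (hh : ∀ x < 0, h x = 0) :
    ∀ x < 0, SchwartzMap.derivCLM ℂ ℂ h x = 0 := by
  intro x hx
  rw [SchwartzMap.derivCLM_apply]
  have : (h : ℝ → ℂ) =ᶠ[𝓝 x] fun _ => 0 := by
    filter_upwards [Iio_mem_nhds hx] with y hy using hh y hy
  rw [this.deriv_eq, deriv_const]

/-- Integration by parts over all of `ℝ`; no boundary term arises, because the function and its
derivative are integrable against the exponential. -/
theorem laplace_deriv (hh : ∀ x < 0, h x = 0) {w : ℂ} (hw : w.im ≤ 0) :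
    laplace (SchwartzMap.derivCLM ℂ ℂ h) w = Complex.I * w * laplace h w := by
  have hd := integrable_laplace (deriv_eq_zero_of_support hh) hw
  have hi := integrable_laplace hh hw
  have h0 := integral_eq_zero_of_hasDerivAt_of_integrable
    (f := fun x : ℝ => h x * Complex.exp (-(Complex.I * w * x)))
    (f' := fun x : ℝ => SchwartzMap.derivCLM ℂ ℂ h x * Complex.exp (-(Complex.I * w * x)) -
      Complex.I * w * (h x * Complex.exp (-(Complex.I * w * x)))) (fun x => ?_)
    (hd.sub (hi.const_mul _)) hi
  · rw [integral_sub hd (hi.const_mul _), integral_const_mul, sub_eq_zero] at h0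
    exact h0
  · have h1 : HasDerivAt (fun x : ℝ => -(Complex.I * w * x)) (-(Complex.I * w)) x := by
      have := (((Complex.ofRealCLM.hasDerivAt (x := x))).const_mul (Complex.I * w)).fun_neg
      simpa using this
    have h2 := (h.hasDerivAt x).mul h1.cexp
    rw [SchwartzMap.derivCLM_apply]
    exact h2.congr_deriv (by ring)

/-- Two derivatives, again supported on the half line, supply the factor `w²` up to and including
the real boundary. -/
theorem exists_laplace_decay (hh : ∀ x < 0, h x = 0) :
    ∃ C, 0 ≤ C ∧ ∀ w : ℂ, w.im ≤ 0 → (1 + ‖w‖ ^ 2) * ‖laplace h w‖ ≤ C := by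
  have h1 := deriv_eq_zero_of_support hh
  have h2 := deriv_eq_zero_of_support h1
  refine ⟨(∫ x, ‖h x‖) +
    ∫ x, ‖SchwartzMap.derivCLM ℂ ℂ (SchwartzMap.derivCLM ℂ ℂ h) x‖,
    add_nonneg (integral_nonneg fun _ => norm_nonneg _) (integral_nonneg fun _ => norm_nonneg _),
    fun w hw => ?_⟩
  have e := norm_laplace_le h2 hw
  rw [laplace_deriv h1 hw, laplace_deriv hh hw, norm_mul, norm_mul, norm_mul, norm_mul,
    Complex.norm_I, one_mul] at e
  have e0 := norm_laplace_le hh hw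
  nlinarith

end Laplace

/-! ### The mixed commutators of test functions with separated supports -/

/-- `x ↦ f(x + a)`. -/
def shiftTest (a : ℝ) (f : 𝓢(ℝ, ℂ)) : 𝓢(ℝ, ℂ) := SchwartzMap.compSubConstCLM ℂ (-a) f

/-- `x ↦ g(a - x)`. -/
def flipTest (a : ℝ) (g : 𝓢(ℝ, ℂ)) : 𝓢(ℝ, ℂ) :=
  SchwartzMap.compCLMOfContinuousLinearEquiv ℂ (ContinuousLinearEquiv.neg ℝ) (shiftTest a g)

theorem shiftTest_apply (a : ℝ) (f : 𝓢(ℝ, ℂ)) (x : ℝ) : shiftTest a f x = f (x + a) := by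
  rw [shiftTest, SchwartzMap.compSubConstCLM_apply, sub_neg_eq_add]

theorem flipTest_apply (a : ℝ) (g : 𝓢(ℝ, ℂ)) (x : ℝ) : flipTest a g x = g (a - x) := by
  change shiftTest a g (-x) = _
  rw [shiftTest_apply, neg_add_eq_sub]

theorem tilde_eq_laplace_shiftTest (a : ℝ) (f : 𝓢(ℝ, ℂ)) (p : ℝ) :
    tilde f p = 1 / (Real.sqrt (2 * Real.pi) : ℂ) *
      (Complex.exp (Complex.I * p * a) * laplace (shiftTest a f) ((-p : ℝ) : ℂ)) := by
  rw [tilde, laplace, ← integral_const_mul (Complex.exp _), ← integral_add_right_eq_self _ a]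
  congr 2
  funext x
  rw [shiftTest_apply, mul_left_comm, ← Complex.exp_add]
  congr 2
  push_cast
  ring

theorem tilde_eq_laplace_flipTest (a : ℝ) (g : 𝓢(ℝ, ℂ)) (p : ℝ) :
    tilde g p = 1 / (Real.sqrt (2 * Real.pi) : ℂ) *
      (Complex.exp (Complex.I * p * a) * laplace (flipTest a g) (p : ℂ)) := by
  rw [tilde, laplace, ← integral_const_mul (Complex.exp _),
    ← integral_sub_left_eq_self _ volume a]
  congr 2
  funext x
  rw [flipTest_apply, mul_left_comm, ← Complex.exp_add]
  congr 2
  push_cast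
  ring

/-- At opposite momenta the phases `e^{∓ipa}` cancel. For supports on opposite sides of `a`, both
remaining factors are Laplace transforms of functions on the positive half line, analytic in the
lower half plane. -/
theorem tilde_mul_tilde (a : ℝ) (f g : 𝓢(ℝ, ℂ)) (p : ℝ) :
    tilde f (-p) * tilde g p = 1 / (2 * Real.pi) *
      (laplace (shiftTest a f) p * laplace (flipTest a g) p) := by
  rw [tilde_eq_laplace_shiftTest a, tilde_eq_laplace_flipTest a, neg_neg]
  have h1 : Complex.exp (Complex.I * ((-p : ℝ) : ℂ) * a) * Complex.exp (Complex.I * p * a) = 1 := by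
    rw [← Complex.exp_add, Complex.exp_eq_one_iff]
    exact ⟨0, by push_cast; ring⟩
  have h2 : (1 / (Real.sqrt (2 * Real.pi) : ℂ)) * (1 / (Real.sqrt (2 * Real.pi) : ℂ)) =
      1 / (2 * Real.pi) := by
    rw [div_mul_div_comm, one_mul, ← Complex.ofReal_mul, Real.mul_self_sqrt (by positivity)]
    push_cast
    rfl
  rw [← h2]
  linear_combination (1 / (Real.sqrt (2 * Real.pi) : ℂ)) * (1 / (Real.sqrt (2 * Real.pi) : ℂ)) *
    laplace (shiftTest a f) p * laplace (flipTest a g) p * h1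

variable (S : ScatteringFunction)

/-- For `-π ≤ Im ζ ≤ 0`, `e^ζ` lies in the closed lower half plane, where both Laplace transforms
decay, and `β_l - ζ` lies in the strip where `S` is controlled. On the lower line `e^ζ = -e^θ`
interchanges `f̂⁺` with `f̂⁻` and `ĝ⁺` with `ĝ⁻`, while crossing turns `S(β_l - θ + iπ)` into `S(θ -
β_l)`. -/
theorem integral_hat_contour_shift {f g : 𝓢(ℝ, ℂ)} {a : ℝ} (hf : ∀ x < a, f x = 0)
    (hg : ∀ x, a < x → g x = 0) {n : ℕ} (β : Fin n → ℝ) :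
    ∫ θ : ℝ, hatMinusFun f θ * hatPlusFun g θ * ∏ l, S.toFun ((β l - θ : ℝ) : ℂ) =
      ∫ θ : ℝ, hatPlusFun f θ * hatMinusFun g θ * ∏ l, S.toFun ((θ - β l : ℝ) : ℂ) := by
  have hf' : ∀ x < 0, shiftTest a f x = 0 := fun x hx => by
    rw [shiftTest_apply]; exact hf _ (by linarith)
  have hg' : ∀ x < 0, flipTest a g x = 0 := fun x hx => by
    rw [flipTest_apply]; exact hg _ (by linarith)
  set F := laplace (shiftTest a f) with hF
  set G := laplace (flipTest a g) with hG
  obtain ⟨C₁, hC₁, hF₁⟩ := exists_laplace_decay hf'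
  obtain ⟨C₂, hC₂, hG₁⟩ := exists_laplace_decay hg'
  obtain ⟨M, hM⟩ := S.bounded
  -- The common analytic continuation: `1/(2π)` comes from the two normalizations, `e^{2ζ}` from the
  -- two prefactors, and `(-i) · i = 1`.
  set H : ℂ → ℂ := fun ζ => 1 / (2 * Real.pi) * (Complex.exp ζ ^ 2 *
    (F (Complex.exp ζ) * G (Complex.exp ζ))) * ∏ l, S.toFun (β l - ζ) with hH
  have hexp : ∀ ζ ∈ closedStrip (-Real.pi) 0, (Complex.exp ζ).im ≤ 0 := fun ζ hζ => by
    rw [Complex.exp_im]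
    exact mul_nonpos_of_nonneg_of_nonpos (Real.exp_pos _).le
      (Real.sin_nonpos_of_nonpos_of_neg_pi_le hζ.2 hζ.1)
  have hexp' : ∀ ζ ∈ strip (-Real.pi) 0, (Complex.exp ζ).im < 0 := fun ζ hζ => by
    rw [Complex.exp_im]
    exact mul_neg_of_pos_of_neg (Real.exp_pos _)
      (Real.sin_neg_of_neg_of_neg_pi_lt hζ.2 hζ.1)
  have hmem : ∀ l, ∀ ζ ∈ closedStrip (-Real.pi) 0, (β l - ζ : ℂ) ∈ closedStrip 0 Real.pi :=
    fun l ζ hζ => by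
      have h1 := hζ.1
      have h2 := hζ.2
      constructor <;> simp <;> linarith
  have hmem' : ∀ l, ∀ ζ ∈ strip (-Real.pi) 0, (β l - ζ : ℂ) ∈ strip 0 Real.pi :=
    fun l ζ hζ => by
      have h1 := hζ.1
      have h2 := hζ.2
      constructor <;> simp <;> linarith
  have hcont : ContinuousOn H (closedStrip (-Real.pi) 0) := by
    have e1 : ContinuousOn (fun ζ => F (Complex.exp ζ)) (closedStrip (-Real.pi) 0) :=
      (continuousOn_laplace hf').comp Complex.continuous_exp.continuousOn hexp
    have e2 : ContinuousOn (fun ζ => G (Complex.exp ζ)) (closedStrip (-Real.pi) 0) :=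
      (continuousOn_laplace hg').comp Complex.continuous_exp.continuousOn hexp
    have e3 : ContinuousOn (fun ζ => ∏ l, S.toFun (β l - ζ)) (closedStrip (-Real.pi) 0) :=
      continuousOn_finsetProd _ fun l _ => S.continuousOn.comp
        (Continuous.continuousOn (by fun_prop)) (hmem l)
    have e4 : ContinuousOn (fun ζ => Complex.exp ζ ^ 2) (closedStrip (-Real.pi) 0) :=
      Continuous.continuousOn (by fun_prop)
    exact (continuousOn_const.mul (e4.mul (e1.mul e2))).mul e3
  have hdiff : DifferentiableOn ℂ H (strip (-Real.pi) 0) := by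
    intro ζ hζ
    refine DifferentiableAt.differentiableWithinAt ?_
    have e1 : DifferentiableAt ℂ (fun ζ => F (Complex.exp ζ)) ζ :=
      (differentiableAt_laplace hf' (hexp' ζ hζ)).comp ζ Complex.differentiableAt_exp
    have e2 : DifferentiableAt ℂ (fun ζ => G (Complex.exp ζ)) ζ :=
      (differentiableAt_laplace hg' (hexp' ζ hζ)).comp ζ Complex.differentiableAt_exp
    have e3 : DifferentiableAt ℂ (fun ζ => ∏ l, S.toFun (β l - ζ)) ζ := by
      refine DifferentiableAt.fun_finsetProd fun l _ => ?_
      exact DifferentiableAt.comp ζ (S.analytic _ (hmem' l ζ hζ)).differentiableAt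
        ((differentiableAt_const _).sub differentiableAt_id)
    have e4 : DifferentiableAt ℂ (fun ζ => Complex.exp ζ ^ 2) ζ := by fun_prop
    exact ((differentiableAt_const _).mul (e4.mul (e1.mul e2))).mul e3
  have hbound : ∀ ζ ∈ closedStrip (-Real.pi) 0,
      ‖H ζ‖ ≤ (‖(1 / (2 * Real.pi) : ℂ)‖ * (C₁ * C₂) * M ^ n) * (1 + ζ.re ^ 2)⁻¹ := by
    intro ζ hζ
    have hP : ‖∏ l, S.toFun (β l - ζ)‖ ≤ M ^ n := by
      rw [norm_prod]
      refine (Finset.prod_le_prod (fun _ _ => norm_nonneg _)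
        fun l _ => hM _ (hmem l ζ hζ)).trans ?_
      simp
    have h1 := hF₁ _ (hexp ζ hζ)
    have h2 := hG₁ _ (hexp ζ hζ)
    have h3 := one_add_sq_mul_exp_sq_le ζ.re
    rw [Complex.norm_exp] at h1 h2
    set e := Real.exp ζ.re
    -- Decay of order `|w|⁻²` from each transform beats `e^{2ζ}` in both directions of the strip.
    have hFG : e ^ 2 * (‖F (Complex.exp ζ)‖ * ‖G (Complex.exp ζ)‖) ≤
        C₁ * C₂ * (1 + ζ.re ^ 2)⁻¹ := by
      rw [← div_eq_mul_inv, le_div_iff₀ (by positivity)]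
      calc e ^ 2 * (‖F (Complex.exp ζ)‖ * ‖G (Complex.exp ζ)‖) * (1 + ζ.re ^ 2)
          = ((1 + ζ.re ^ 2) * e ^ 2) * (‖F (Complex.exp ζ)‖ * ‖G (Complex.exp ζ)‖) := by ring
        _ ≤ (1 + e ^ 2) ^ 2 * (‖F (Complex.exp ζ)‖ * ‖G (Complex.exp ζ)‖) := by gcongr
        _ = ((1 + e ^ 2) * ‖F (Complex.exp ζ)‖) * ((1 + e ^ 2) * ‖G (Complex.exp ζ)‖) := by ring
        _ ≤ C₁ * C₂ := by gcongr
    rw [hH]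
    simp only [norm_mul, norm_pow, Complex.norm_exp]
    calc _ ≤ ‖(1 / (2 * Real.pi) : ℂ)‖ * (C₁ * C₂ * (1 + ζ.re ^ 2)⁻¹) * M ^ n := by
          gcongr
      _ = _ := by ring
  have hshift := integral_eq_integral_shift Real.pi_pos.le hcont hdiff hbound
  have key : ∀ p : ℝ, tilde f (-p) * tilde g p = 1 / (2 * Real.pi) * (F p * G p) :=
    tilde_mul_tilde a f g
  refine Eq.trans (integral_congr_ae (Eventually.of_forall fun θ => ?_))
    (hshift.trans (integral_congr_ae (Eventually.of_forall fun θ => ?_)))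
  · have h := key (Real.exp θ)
    simp only [hH, hatMinusFun, hatPlusFun, ← Complex.ofReal_exp, Complex.ofReal_sub] at h ⊢
    linear_combination (-Complex.I ^ 2 * (Real.exp θ : ℂ) ^ 2 *
      ∏ l, S.toFun (β l - θ)) * h + ((Real.exp θ : ℂ) ^ 2 * (1 / (2 * Real.pi) *
        (F (Real.exp θ) * G (Real.exp θ))) * ∏ l, S.toFun (β l - θ)) * (-Complex.I_sq)
  · have h := key (-Real.exp θ)
    have he : Complex.exp (θ - Real.pi * Complex.I) = ((-Real.exp θ : ℝ) : ℂ) := by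
      rw [Complex.exp_sub, Complex.exp_pi_mul_I, ← Complex.ofReal_exp]
      push_cast
      ring
    have hS : ∀ l, S.toFun (β l - (θ - Real.pi * Complex.I)) = S.toFun ((θ - β l : ℝ) : ℂ) :=
      fun l => by
        have := S.crossing_eq_neg (β l - θ)
        rw [← Complex.ofReal_neg, neg_sub] at this
        rw [← this]
        congr 1
        push_cast
        ring
    simp only [hH, hatMinusFun, hatPlusFun, he, hS]
    rw [neg_neg] at h
    push_cast at h ⊢
    linear_combination (Complex.I ^ 2 * (Complex.exp θ : ℂ) ^ 2 *
      ∏ l, S.toFun (θ - β l)) * h + (1 / (2 * Real.pi) * (Complex.exp θ ^ 2 *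
        (F (-Complex.exp θ) * G (-Complex.exp θ))) * ∏ l, S.toFun (θ - β l)) * Complex.I_sq

end

end ChiralModel

namespace ChiralModel

noncomputable section

/-! ### Relative half-locality -/

theorem tilde_reflectTest (g : 𝓢(ℝ, ℂ)) (p : ℝ) : tilde (reflectTest g) p = conj (tilde g p) := by
  rw [tilde_conj, tilde, ← integral_neg_eq_self]
  congr 2
  funext ξ
  rw [reflectTest_apply, neg_neg]
  congr 2
  push_cast
  ring

/-- The reflection conjugates `f̃` at the same momentum; the minus sign comes from conjugating the
prefactor `i`. -/
theorem hatPlusFun_reflectTest (g : 𝓢(ℝ, ℂ)) (θ : ℝ) :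
    hatPlusFun (reflectTest g) θ = -conj (hatPlusFun g θ) := by
  simp only [hatPlusFun, tilde_reflectTest, map_mul, Complex.conj_I, Complex.conj_ofReal]
  ring

theorem hatMinusFun_reflectTest (g : 𝓢(ℝ, ℂ)) (θ : ℝ) :
    hatMinusFun (reflectTest g) θ = -conj (hatMinusFun g θ) := by
  simp only [hatMinusFun, tilde_reflectTest, map_mul, map_neg, Complex.conj_I,
    Complex.conj_ofReal]
  ring

variable (S : ScatteringFunction)

/-- Both kernels are multiplication operators; undoing the conjugations leaves the same minus sign
on both sides and the two integrals related by the contour shift. -/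
theorem mixedKernel_eq_conj {f g : 𝓢(ℝ, ℂ)} {a : ℝ} (hf : ∀ x < a, f x = 0)
    (hg : ∀ x, a < x → g x = 0) {n : ℕ} (x y : L2 n) :
    mixedKernel S (hatMinus f) (star (hatPlus (reflectTest g))) x y =
      conj (mixedKernel S (star (hatPlus f)) (hatMinus (reflectTest g)) y x) := by
  rw [mixedKernel_eq_integral, mixedKernel_eq_integral, ← integral_conj]
  refine integral_congr_ae (Eventually.of_forall fun β => ?_)
  simp only [map_mul, Complex.conj_conj]
  rw [mul_comm (y β), ← integral_conj]
  congr 1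
  have h1 : ∫ θ : ℝ, hatMinus f θ * (star (hatPlus (reflectTest g)) : L2R) θ *
      ∏ l, S.toFun ((β l - θ : ℝ) : ℂ) =
      -∫ θ : ℝ, hatMinusFun f θ * hatPlusFun g θ * ∏ l, S.toFun ((β l - θ : ℝ) : ℂ) := by
    rw [← integral_neg]
    refine integral_congr_ae ?_
    filter_upwards [hatMinus_ae f, Lp.coeFn_star (hatPlus (reflectTest g)),
      hatPlus_ae (reflectTest g)] with θ e1 e2 e3
    rw [e1, e2, Pi.star_apply, e3, hatPlusFun_reflectTest]
    simp
  have h2 : ∫ θ : ℝ, conj ((star (hatPlus f) : L2R) θ * hatMinus (reflectTest g) θ *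
      ∏ l, S.toFun ((β l - θ : ℝ) : ℂ)) =
      -∫ θ : ℝ, hatPlusFun f θ * hatMinusFun g θ * ∏ l, S.toFun ((θ - β l : ℝ) : ℂ) := by
    rw [← integral_neg]
    refine integral_congr_ae ?_
    filter_upwards [hatPlus_ae f, Lp.coeFn_star (hatPlus f),
      hatMinus_ae (reflectTest g)] with θ e1 e2 e3
    rw [e3, e2, Pi.star_apply, e1, hatMinusFun_reflectTest]
    simp only [map_mul, map_prod, S.conj_real, ← Complex.ofReal_neg, neg_sub, RCLike.star_def,
      Complex.conj_conj, map_neg]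
    ring
  rw [h1, h2, integral_hat_contour_shift S hf hg]

/-- Of the four commutators, those of two creators and of two annihilators vanish separately; the
two mixed ones cancel each other by the equality of their kernels. -/
theorem fieldEnd_reflectConj_comm {f g : 𝓢(ℝ, ℂ)} {a : ℝ} (hf : ∀ x < a, f x = 0)
    (hg : ∀ x, a < x → g x = 0) (y : finiteParticle S) :
    fieldEnd S f (reflectConj S (fieldEnd S (reflectTest g)) y) =
      reflectConj S (fieldEnd S (reflectTest g)) (fieldEnd S f y) := by
  set χp := star (hatPlus (reflectTest g)) with hp
  set χm := star (hatMinus (reflectTest g)) with hm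
  have hφ' : reflectConj S (fieldEnd S (reflectTest g)) =
      rightCreationEnd S χp + rightAnnihilationEnd S χm := by
    rw [rightCreationEnd, rightAnnihilationEnd, hp, hm, star_star, star_star, ← reflectConj_add]
    rfl
  have key : annihilationEnd S (hatMinus f) (rightCreationEnd S χp y) -
      rightCreationEnd S χp (annihilationEnd S (hatMinus f) y) =
      rightAnnihilationEnd S χm (creationEnd S (hatPlus f) y) -
      creationEnd S (hatPlus f) (rightAnnihilationEnd S χm y) := by
    refine finiteParticle_ext_inner S fun x => ?_
    rw [inner_commutator_annihilation_rightCreation, inner_commutator_rightAnnihilation_creation]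
    refine tsum_congr fun n => ?_
    rw [hm, star_star]
    exact mixedKernel_eq_conj S hf hg _ _
  rw [hφ', LinearMap.add_apply, LinearMap.add_apply, fieldEnd_apply, fieldEnd_apply, map_add,
    map_add, map_add, map_add, creation_rightCreation_comm, annihilation_rightAnnihilation_comm]
  rw [← sub_eq_zero] at key ⊢
  rw [← key]
  abel

theorem field_reflectedField_commuteAt {f g : 𝓢(ℝ, ℂ)} {a : ℝ} (hf : tsupport f ⊆ Set.Ioi a)
    (hg : tsupport g ⊆ Set.Iio a) {Ψ : Fock S} (hΨ : Ψ ∈ finiteParticle S) :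
    CommuteAt (field S f) (reflectedField S g) Ψ := by
  have hf' : ∀ x < a, f x = 0 := fun x hx =>
    image_eq_zero_of_notMem_tsupport fun h => (lt_asymm hx (hf h))
  have hg' : ∀ x, a < x → g x = 0 := fun x hx =>
    image_eq_zero_of_notMem_tsupport fun h => (lt_asymm hx (hg h))
  set y : finiteParticle S := ⟨Ψ, hΨ⟩
  have hA : Ψ ∈ (field S f).domain := (field_domain S f).ge hΨ
  have hB : Ψ ∈ (reflectedField S g).domain := (reflectedField_domain S g).ge hΨ
  have eA : field S f ⟨Ψ, hA⟩ = fieldEnd S f y := field_apply S f y hA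
  have eB : reflectedField S g ⟨Ψ, hB⟩ = reflectConj S (fieldEnd S (reflectTest g)) y :=
    reflectedField_apply S g y hB
  have hAB : reflectedField S g ⟨Ψ, hB⟩ ∈ (field S f).domain := by
    rw [field_domain, eB]; exact Subtype.property _
  have hBA : field S f ⟨Ψ, hA⟩ ∈ (reflectedField S g).domain := by
    rw [reflectedField_domain, eA]; exact Subtype.property _
  refine ⟨hA, hB, hAB, hBA, sub_eq_zero.2 ?_⟩
  have e1 : field S f ⟨_, hAB⟩ =
      fieldEnd S f (reflectConj S (fieldEnd S (reflectTest g)) y) := by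
    rw [← field_apply S f _ ((field_domain S f).ge (Subtype.property _))]
    congr 1
    exact Subtype.ext eB
  have e2 : reflectedField S g ⟨_, hBA⟩ =
      reflectConj S (fieldEnd S (reflectTest g)) (fieldEnd S f y) := by
    rw [← reflectedField_apply S g _ ((reflectedField_domain S g).ge (Subtype.property _))]
    congr 1
    exact Subtype.ext eA
  rw [e1, e2, fieldEnd_reflectConj_comm S hf' hg']

end

end ChiralModel

theorem mainTheorem8 (S : ChiralModel.ScatteringFunction) (hS : S.HasLimit) :
    -- the first three properties hold for `φ` and for `φ'`
    (∀ Φ : 𝓢(ℝ, ℂ) → ChiralModel.Fock S →ₗ.[ℂ] ChiralModel.Fock S,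
      Φ = ChiralModel.field S ∨ Φ = ChiralModel.reflectedField S →
      -- tempered distribution, essential self-adjointness, entire analytic vectors
      (ChiralModel.IsOperatorValuedTemperedDistribution (ChiralModel.finiteParticle S) Φ ∧
        ∀ f : 𝓢(ℝ, ℂ), (∀ x, conj (f x) = f x) →
          ChiralModel.IsEssentiallySelfAdjoint (Φ f) ∧
          ∀ Ψ ∈ ChiralModel.finiteParticle S, ChiralModel.IsEntireAnalyticVector (Φ f) Ψ) ∧
      -- covariance
      (∀ (ξ t : ℝ) (f : 𝓢(ℝ, ℂ)),
        ChiralModel.conjugateBy (ChiralModel.affineRep S ξ t) (Φ f) =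
          Φ (ChiralModel.affineTest ξ t f)) ∧
      -- the Reeh-Schlieder property
      (∀ I : Set ℝ, IsOpen I → I.Nonempty → I.OrdConnected →
        Dense (Submodule.span ℂ {v | ChiralModel.IsFieldVector Φ (ChiralModel.vacuum S) I v} :
          Set (ChiralModel.Fock S)))) ∧
    -- relative half-locality of `φ` and `φ'`
    (∀ (f g : 𝓢(ℝ, ℂ)) (a : ℝ), tsupport f ⊆ Set.Ioi a → tsupport g ⊆ Set.Iio a →
      ∀ Ψ ∈ ChiralModel.finiteParticle S,
        ChiralModel.CommuteAt (ChiralModel.field S f) (ChiralModel.reflectedField S g) Ψ) := by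
  refine ⟨fun Φ hΦ => ?_, fun f g a hf hg Ψ hΨ =>
    ChiralModel.field_reflectedField_commuteAt S hf hg hΨ⟩
  rcases hΦ with rfl | rfl
  · exact ⟨⟨ChiralModel.field_isOperatorValuedTemperedDistribution S, fun f hf =>
      ⟨ChiralModel.field_isEssentiallySelfAdjoint S hf,
        fun Ψ hΨ => ChiralModel.field_isEntireAnalyticVector S f hΨ⟩⟩,
      ChiralModel.field_covariant S, fun I hI hI' _ => ChiralModel.field_reehSchlieder S hI hI'⟩
  · exact ⟨⟨ChiralModel.reflectedField_isOperatorValuedTemperedDistribution S, fun f hf =>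
      ⟨ChiralModel.reflectedField_isEssentiallySelfAdjoint S hf,
        fun Ψ hΨ => ChiralModel.reflectedField_isEntireAnalyticVector S f hΨ⟩⟩,
      ChiralModel.reflectedField_covariant S,
      fun I hI hI' _ => ChiralModel.reflectedField_reehSchlieder S hI hI'⟩
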